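/- Fix a dimension $d$. A polygonal curve $P:[0,1]\to\mathbb R^d$ with $n\ge 2$ vertices is given by vertex parameters $0=t_1<\dots<t_n=1$ and vertices $p_i=P(t_i)$ (consecutive vertices may coincide), with $P$ interpolating linearly on each $[t_i,t_{i+1}]$. Write $P[a,b]$ for the subcurve of $P$ from $P(a)$ to $P(b)$ and $\overline{p\,q}$ for the segment from $p$ to $q$, both parametrized over $[0,1]$, and let $$d_F(X,Y)=\inf_{\alpha,\beta}\ \sup_{t\in[0,1]}\|X(\alpha(t))-Y(\beta(t))\|$$ be the Fréchet distance, where $\alpha,\beta$ range over the non-decreasing, surjective, continuous maps $[0,1]\to[0,1]$ and $\|\cdot\|$ is the Euclidean norm. For $\Delta>0$, a nonempty set of indices $1\le i_1<\dots<i_k\le n$ defines a $\Delta$-good simplification of $P$ if (i) $\|p_{i_j}-p_{i_{j+1}}\|\ge\Delta/3$ for $1\le j<k$; (ii) $d_F(P[t_{i_j},t_{i_{j+1}}],\overline{p_{i_j}\,p_{i_{j+1}}})\le 3\Delta$ for $1\le j<k$; (iii) $d_F(P[t_1,t_{i_1}],\overline{p_{i_1}\,p_{i_1}})\le 3\Delta$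 and $d_F(P[t_{i_k},t_n],\overline{p_{i_k}\,p_{i_k}})\le 3\Delta$; (iv) $d_F(P[t_{i_j},t_{i_{j+2}}],\overline{p_{i_j}\,p_{i_{j+2}}})>2\Delta$ for $1\le j<k-1$. **Theorem.** For every $d$ there is an algorithm on the real RAM (cells store real numbers; the unit-cost operations are $+,-,\times,/$, square root, comparisons of reals with output $0$ or $1$, tests, rational constants, copying, and indirect memory access at natural-number addresses) which, given $n$, $\Delta>0$ and the vertices $p_1,\dots,p_n$ of any polygonal curve $P$ in $\mathbb R^d$ with $n\ge2$ vertices, outputs an index set $i_1<\dots<i_k$ that defines a $\Delta$-good simplification of $P$. It takes $O(n\log^2 n)$ time and $O(n)$ space, where the constants depend only on $d$. -/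

import Mathlib

/-! ### Polygonal curves and the Fréchet distance -/

/-- A polygonal curve in `ℝ^d` with `n` vertices: a map on `[0,1]` (values outside `[0,1]` are never
used) together with vertex parameters `0 = t_1 < ... < t_n = 1` such that the map interpolates
linearly between consecutive vertices. Consecutive vertices may coincide. -/
structure PolygonalCurve (d n : ℕ) where
  toFun : ℝ → EuclideanSpace ℝ (Fin d)
  param : Fin n → ℝ
  two_le : 2 ≤ n
  strictMono_param : StrictMono param
  param_first : param ⟨0, by omega⟩ = 0
  param_last : param ⟨n - 1, by omega⟩ = 1
  interp : ∀ (i : ℕ) (hi : i + 1 < n),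
    ∀ t ∈ Set.Icc (param ⟨i, by omega⟩) (param ⟨i + 1, hi⟩),
      toFun t =
        (1 - (t - param ⟨i, by omega⟩) / (param ⟨i + 1, hi⟩ - param ⟨i, by omega⟩)) •
            toFun (param ⟨i, by omega⟩) +
          ((t - param ⟨i, by omega⟩) / (param ⟨i + 1, hi⟩ - param ⟨i, by omega⟩)) •
            toFun (param ⟨i + 1, hi⟩)

/-- The vertices `p_i = P(t_i)`. -/
def PolygonalCurve.vertex {d n : ℕ} (P : PolygonalCurve d n) (i : Fin n) :
    EuclideanSpace ℝ (Fin d) :=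
  P.toFun (P.param i)

/-- The subcurve `P[a,b]`, parametrized over `[0,1]`. -/
def PolygonalCurve.subcurve {d n : ℕ} (P : PolygonalCurve d n) (a b : ℝ) :
    ℝ → EuclideanSpace ℝ (Fin d) :=
  fun t => P.toFun ((1 - t) * a + t * b)

/-- The edge from `p` to `q`, parametrized over `[0,1]`. -/
def edgeCurve {d : ℕ} (p q : EuclideanSpace ℝ (Fin d)) : ℝ → EuclideanSpace ℝ (Fin d) :=
  fun t => (1 - t) • p + t • q

/-- A traversal: a pair of non-decreasing, surjective, continuous maps `[0,1] → [0,1]`. -/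
structure Traversal where
  left : unitInterval → unitInterval
  right : unitInterval → unitInterval
  monotone_left : Monotone left
  monotone_right : Monotone right
  surjective_left : Function.Surjective left
  surjective_right : Function.Surjective right
  continuous_left : Continuous left
  continuous_right : Continuous right

/-- The Fréchet distance of two curves parametrized over `[0,1]`, as an extended nonnegative real
(so that the supremum and the infimum are the true ones). -/
noncomputable def frechetDist {d : ℕ} (P Q : ℝ → EuclideanSpace ℝ (Fin d)) : ENNReal :=
  ⨅ τ : Traversal, ⨆ t : unitInterval, edist (P (τ.left t : ℝ)) (Q (τ.right t : ℝ))

/-- The index sequence `i_1 < ... < i_(k+1)` defines a `Δ`-good simplification of `P`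
(indices are counted from `0` in `Fin`). -/
structure IsGoodSimplification {d n k : ℕ} (P : PolygonalCurve d n) (Δ : ℝ)
    (idx : Fin (k + 1) → Fin n) : Prop where
  strictMono : StrictMono idx
  /-- (i) no short edges -/
  no_short_edge : ∀ j : Fin k,
    Δ / 3 ≤ ‖P.vertex (idx j.castSucc) - P.vertex (idx j.succ)‖
  /-- (ii) every edge is close to the subcurve that it replaces -/
  edge_close : ∀ j : Fin k,
    frechetDist (P.subcurve (P.param (idx j.castSucc)) (P.param (idx j.succ)))
      (edgeCurve (P.vertex (idx j.castSucc)) (P.vertex (idx j.succ))) ≤ ENNReal.ofReal (3 * Δ)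
  /-- (iii) the initial part `P[t_1, t_(i_1)]`; here `t_1 = 0` -/
  start_close :
    frechetDist (P.subcurve 0 (P.param (idx 0)))
      (edgeCurve (P.vertex (idx 0)) (P.vertex (idx 0))) ≤ ENNReal.ofReal (3 * Δ)
  /-- (iii) the final part; here `t_n = 1` -/
  end_close :
    frechetDist (P.subcurve (P.param (idx (Fin.last k))) 1)
      (edgeCurve (P.vertex (idx (Fin.last k))) (P.vertex (idx (Fin.last k))))
        ≤ ENNReal.ofReal (3 * Δ)
  /-- (iv) no interior vertex can be left out within distance `2Δ` -/
  locally_maximal : ∀ (j : ℕ) (hj : j + 2 < k + 1),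
    ENNReal.ofReal (2 * Δ) <
      frechetDist
        (P.subcurve (P.param (idx ⟨j, by omega⟩)) (P.param (idx ⟨j + 2, hj⟩)))
        (edgeCurve (P.vertex (idx ⟨j, by omega⟩)) (P.vertex (idx ⟨j + 2, hj⟩)))

/-! ### The real RAM -/

namespace RealRAM

/-- Arithmetic and comparison operations. -/
inductive Op
  | add | sub | mul | div
  | eq | ne | lt | le | gt | ge

/-- Only a division by zero is undefined. -/
def Op.Defined : Op → ℝ → ℝ → Prop
  | .div, _, y => y ≠ 0
  | _, _, _ => True

open Classical in
/-- The value of an operation; comparisons have output `0` or `1`. -/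
noncomputable def Op.eval : Op → ℝ → ℝ → ℝ
  | .add, x, y => x + y
  | .sub, x, y => x - y
  | .mul, x, y => x * y
  | .div, x, y => x / y
  | .eq, x, y => if x = y then 1 else 0
  | .ne, x, y => if x ≠ y then 1 else 0
  | .lt, x, y => if x < y then 1 else 0
  | .le, x, y => if x ≤ y then 1 else 0
  | .gt, x, y => if x > y then 1 else 0
  | .ge, x, y => if x ≥ y then 1 else 0

/-- The instructions. Registers are named by natural numbers; a program names finitely many of them.
The main memory is reached only through `load` and `store` (indirect addressing). -/
inductive Instr
  /-- `R a := q` for a rational constant `q` -/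
  | const (a : ℕ) (q : ℚ)
  /-- `R a := R b` -/
  | copy (a b : ℕ)
  /-- `R a := R b op R c` -/
  | bin (op : Op) (a b c : ℕ)
  /-- `R a := √(R b)` -/
  | sqrt (a b : ℕ)
  /-- `R a := M[R b]` -/
  | load (a b : ℕ)
  /-- `M[R a] := R b` -/
  | store (a b : ℕ)

/-- The state of the machine: registers and main memory, each cell holding a real number. -/
structure State where
  reg : ℕ → ℝ
  mem : ℕ → ℝ

/-- `Instr.Step s ι σ σ'`: on a machine whose memory has the `s` cells `0, ..., s - 1`, the
instruction `ι` leads from `σ` to `σ'`. There is no `σ'` (the machine crashes) on a division by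
zero, on the root of a negative number, and on a memory address that is not a natural number below
`s`. -/
inductive Instr.Step (s : ℕ) : Instr → State → State → Prop
  | const (σ : State) (a : ℕ) (q : ℚ) :
      Instr.Step s (.const a q) σ ⟨Function.update σ.reg a (q : ℝ), σ.mem⟩
  | copy (σ : State) (a b : ℕ) :
      Instr.Step s (.copy a b) σ ⟨Function.update σ.reg a (σ.reg b), σ.mem⟩
  | bin (σ : State) (op : Op) (a b c : ℕ) (h : op.Defined (σ.reg b) (σ.reg c)) :
      Instr.Step s (.bin op a b c) σ
        ⟨Function.update σ.reg a (op.eval (σ.reg b) (σ.reg c)), σ.mem⟩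
  | sqrt (σ : State) (a b : ℕ) (h : 0 ≤ σ.reg b) :
      Instr.Step s (.sqrt a b) σ ⟨Function.update σ.reg a (Real.sqrt (σ.reg b)), σ.mem⟩
  | load (σ : State) (a b m : ℕ) (hm : σ.reg b = (m : ℝ)) (hs : m < s) :
      Instr.Step s (.load a b) σ ⟨Function.update σ.reg a (σ.mem m), σ.mem⟩
  | store (σ : State) (a b m : ℕ) (hm : σ.reg a = (m : ℝ)) (hs : m < s) :
      Instr.Step s (.store a b) σ ⟨σ.reg, Function.update σ.mem m (σ.reg b)⟩

/-- Programs: instructions under sequencing, branching and loops. A test asks whether a register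
is nonzero. -/
inductive Program
  | skip
  | instr (ι : Instr)
  | seq (p q : Program)
  | ite (a : ℕ) (p q : Program)
  | while (a : ℕ) (p : Program)

/-- `Exec s p σ T σ'`: on a machine with `s` memory cells, the program `p`, started in `σ`, halts in
`σ'` after exactly `T` steps. Every instruction and every evaluation of a test is one step. -/
inductive Exec (s : ℕ) : Program → State → ℕ → State → Prop
  | skip (σ : State) : Exec s .skip σ 1 σ
  | instr {ι : Instr} {σ σ' : State} (h : ι.Step s σ σ') : Exec s (.instr ι) σ 1 σ'
  | seq {p q : Program} {σ₁ σ₂ σ₃ : State} {T₁ T₂ : ℕ}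
      (hp : Exec s p σ₁ T₁ σ₂) (hq : Exec s q σ₂ T₂ σ₃) : Exec s (.seq p q) σ₁ (T₁ + T₂) σ₃
  | ite_true {a : ℕ} {p q : Program} {σ σ' : State} {T : ℕ}
      (ha : σ.reg a ≠ 0) (hp : Exec s p σ T σ') : Exec s (.ite a p q) σ (T + 1) σ'
  | ite_false {a : ℕ} {p q : Program} {σ σ' : State} {T : ℕ}
      (ha : σ.reg a = 0) (hq : Exec s q σ T σ') : Exec s (.ite a p q) σ (T + 1) σ'
  | while_true {a : ℕ} {p : Program} {σ₁ σ₂ σ₃ : State} {T₁ T₂ : ℕ}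
      (ha : σ₁.reg a ≠ 0) (hp : Exec s p σ₁ T₁ σ₂) (hw : Exec s (.while a p) σ₂ T₂ σ₃) :
      Exec s (.while a p) σ₁ (T₁ + T₂ + 1) σ₃
  | while_false {a : ℕ} {p : Program} {σ : State}
      (ha : σ.reg a = 0) : Exec s (.while a p) σ 1 σ

/-- The input: register `0` holds `n`, register `1` holds `Δ`, the memory holds the coordinates of
the `n` points one after another, and everything else is `0`. -/
noncomputable def input {d n : ℕ} (p : Fin n → EuclideanSpace ℝ (Fin d)) (Δ : ℝ) : State where
  reg := fun a => if a = 0 then (n : ℝ) else if a = 1 then Δ else 0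
  mem := fun m =>
    if h : m < n * d then
      p ⟨m / d, Nat.div_lt_of_lt_mul (by rwa [Nat.mul_comm] at h)⟩
        ⟨m % d, Nat.mod_lt _ (Nat.pos_of_ne_zero (by rintro rfl; simp at h))⟩
    else 0

/-- The output of a sequence of `k + 1` indices on a machine with `s` memory cells: register `0`
holds its length, register `1` the address of its first entry, and its entries (counted from `1`,
so `1, ..., n`) are stored in consecutive cells. -/
def Outputs {n k : ℕ} (s : ℕ) (σ : State) (idx : Fin (k + 1) → Fin n) : Prop :=
  σ.reg 0 = ((k + 1 : ℕ) : ℝ) ∧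
    ∃ m : ℕ, σ.reg 1 = (m : ℝ) ∧ m + k < s ∧
      ∀ j : Fin (k + 1), σ.mem (m + (j : ℕ)) = (((idx j : ℕ) + 1 : ℕ) : ℝ)

end RealRAM

/-!
The vertices are read one after another, and a stack of vertices is kept that is a good
simplification of the part of the curve read so far. To process a new vertex `w`, the edge to `w`
from the vertex below the top of the stack is tested; while the test succeeds, the top is popped.
Then `w` is pushed, unless it is within distance `Δ/3` of the top, in which case it is skipped. The
test is approximate: a negative answer guarantees a Fréchet distance above `2Δ`, which gives
condition (iv), and a positive answer guarantees that the distance is at most `5Δ/2`. The gap up to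
`3Δ` is what makes skipping harmless: if the edge to a skipped vertex is shorter than `Δ/3`, then
all vertices since the top of the stack are within `5Δ/2 + Δ/3 ≤ 3Δ` of the top. These invariants
are `IsPopping.pop`, `IsPopping.absorb` and `IsPopping.push`. Every test is followed by a pop or by
a step to the next vertex, so that there are `O(n)` tests, and each has to take `O(log² n)` time.

Since curves and edges are linear between vertices, the Fréchet distance between a subcurve and an
edge is controlled by monotone matchings of the vertices to points of the edge (`MonotonePath`,
`frechetDist_le_of_monotonePath`, `monotonePath_of_frechetDist_lt`). For one edge, such a matching
is found by a greedy scan with a closed formula for the next parameter (`scan_le_one_iff`). For the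
fast test, a finite rational net `z` of a ball in `ℝ^d` is fixed (`exists_rational_net`). For each
vertex `m > 0`, counted from `0`, and each pair of net points around `m` and around `m - lowBit m`,
where `lowBit m` is the largest power of two that divides `m`, a table tells whether the segment
between these net points follows the subcurve between the two vertices. The numbers `lowBit m` sum
up to `O(n log n)` (`sum_lowBit_le`), and so does the time for the table, which has `O(n)` entries.
To test the edge from the vertex `a` to the vertex `w`, one walks from `w` down to `a` in dyadic
jumps from `c` to `c - lowBit c` and, where such a jump would pass `a`, in single steps; this takes
`O(log² n)` steps (`walkLength_le`). Along the walk, a dynamic program computes for each net point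
around the current vertex the least parameter on the edge that is close to it and can be reached
(`IsReachable`, `IsReachable.step`).

The running time is proved with a program logic: `Triple s p x B Q` says that the program `p`, on
`s` memory cells, started with visible content `x`, halts within `B` steps and satisfies `Q`
afterwards. Straight-line code is not written out. A function of the program variables is
`Evaluable` if some program without loops computes it, and programs are assembled from assignments,
loads, stores, conditionals and loops over evaluable functions. The net has a constant number `N` of
points, so that the values for all net points fit into registers. The memory holds the input in the
cells below `n * d`, the numbers `lowBit m` from `n * d` on, the stack from `n * d + 2 * n` on, and
the table, with `N * N` entries for each vertex, from `n * d + 3 * n` on.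
-/

/-! ### A program logic for the real RAM -/

namespace RealRAM

/-- The number of instructions and tests in the text of a program. It bounds the running time of a
program without loops. -/
def Program.size : Program → ℕ
  | .skip => 1
  | .instr _ => 1
  | .seq p q => p.size + q.size
  | .ite _ p q => p.size + q.size + 1
  | .while _ p => p.size + 1

/-- The register that holds the program variable `a`. Variables live in the even registers from `2`
on, so that they interfere neither with the registers `0`, `1` of the input and output convention
nor with temporaries. -/
def varReg {V : Type} [Encodable V] (a : V) : ℕ := 2 * Encodable.encode a + 2

/-- The `t`-th temporary register, used in the evaluation of expressions. -/
def tmpReg (t : ℕ) : ℕ := 2 * t + 3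

theorem varReg_injective {V : Type} [Encodable V] : Function.Injective (varReg (V := V)) := by
  intro a b h
  apply Encodable.encode_injective
  simp only [varReg] at h
  omega

theorem varReg_ne_tmpReg {V : Type} [Encodable V] (a : V) (t : ℕ) : varReg a ≠ tmpReg t := by
  simp only [varReg, tmpReg]
  omega

theorem tmpReg_injective : Function.Injective tmpReg := by
  intro a b h
  simp only [tmpReg] at h
  omega

/-- The content of the machine as seen by the program logic: the values of the program variables
and the main memory. Temporary registers are invisible. -/
@[ext]
structure Store (V : Type) where
  var : V → ℝ
  mem : ℕ → ℝ

section Logic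

variable {V : Type} [Encodable V]

/-- The visible part of a machine state. -/
def State.toStore (V : Type) [Encodable V] (σ : State) : Store V :=
  ⟨fun a => σ.reg (varReg a), σ.mem⟩

/-- `p` computes the function `f` of the program variables into the `t`-th temporary and changes
nothing but temporaries from the `t`-th on. -/
def Program.Evaluates (p : Program) (t : ℕ) (f : (V → ℝ) → ℝ) : Prop :=
  ∀ (s : ℕ) (σ : State), ∃ (T : ℕ) (reg : ℕ → ℝ), Exec s p σ T ⟨reg, σ.mem⟩ ∧ T ≤ p.size ∧
    reg (tmpReg t) = f (fun a => σ.reg (varReg a)) ∧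
    ∀ r, (∀ u, t ≤ u → r ≠ tmpReg u) → reg r = σ.reg r

/-- A function of the program variables is evaluable if a loop-free program computes it. This is
the shallow counterpart of an expression language. -/
def Evaluable (f : (V → ℝ) → ℝ) : Prop :=
  ∀ t, ∃ p : Program, p.Evaluates t f

theorem var_eq_of_eq {t : ℕ} {σ : State} {reg : ℕ → ℝ}
    (h : ∀ r, (∀ u, t ≤ u → r ≠ tmpReg u) → reg r = σ.reg r) :
    (fun a : V => reg (varReg a)) = fun a : V => σ.reg (varReg a) :=
  funext fun a => h _ fun u _ => varReg_ne_tmpReg a u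

theorem Evaluable.ratConst (q : ℚ) : Evaluable (V := V) fun _ => (q : ℝ) := fun t =>
  ⟨.instr (.const (tmpReg t) q), fun s σ => ⟨1, _, .instr (.const σ _ q), le_rfl, by simp, by
    intro r hr
    exact Function.update_of_ne (hr t le_rfl) _ _⟩⟩

theorem Evaluable.natConst (m : ℕ) : Evaluable (V := V) fun _ => (m : ℝ) := by
  simpa using Evaluable.ratConst (V := V) (m : ℚ)

theorem Evaluable.zero : Evaluable (V := V) fun _ => 0 := by
  simpa using Evaluable.natConst (V := V) 0

theorem Evaluable.one : Evaluable (V := V) fun _ => 1 := by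
  simpa using Evaluable.natConst (V := V) 1

theorem Evaluable.two : Evaluable (V := V) fun _ => 2 := by
  simpa using Evaluable.natConst (V := V) 2

theorem Evaluable.var (a : V) : Evaluable fun v : V → ℝ => v a := fun t =>
  ⟨.instr (.copy (tmpReg t) (varReg a)), fun s σ => ⟨1, _, .instr (.copy σ _ _), le_rfl, by simp, by
    intro r hr
    exact Function.update_of_ne (hr t le_rfl) _ _⟩⟩

/-- Two expressions evaluated into consecutive temporaries. -/
theorem Evaluable.pair {f g : (V → ℝ) → ℝ} (hf : Evaluable f) (hg : Evaluable g) (t : ℕ) :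
    ∃ p : Program, ∀ (s : ℕ) (σ : State), ∃ (T : ℕ) (reg : ℕ → ℝ), Exec s p σ T ⟨reg, σ.mem⟩ ∧
      T ≤ p.size ∧ reg (tmpReg t) = f (fun a => σ.reg (varReg a)) ∧
      reg (tmpReg (t + 1)) = g (fun a => σ.reg (varReg a)) ∧
      ∀ r, (∀ u, t ≤ u → r ≠ tmpReg u) → reg r = σ.reg r := by
  obtain ⟨p, hp⟩ := hf t
  obtain ⟨q, hq⟩ := hg (t + 1)
  refine ⟨.seq p q, fun s σ => ?_⟩
  obtain ⟨T₁, reg₁, he₁, hT₁, hv₁, hr₁⟩ := hp s σ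
  obtain ⟨T₂, reg₂, he₂, hT₂, hv₂, hr₂⟩ := hq s ⟨reg₁, σ.mem⟩
  refine ⟨T₁ + T₂, reg₂, .seq he₁ he₂, add_le_add hT₁ hT₂, ?_, ?_, ?_⟩
  · exact (hr₂ (tmpReg t) fun u hu => tmpReg_injective.ne (by omega)).trans hv₁
  · rw [hv₂]
    exact congrArg g (var_eq_of_eq hr₁)
  · intro r hr
    rw [hr₂ r fun u hu => hr u (by omega)]
    exact hr₁ r hr

theorem Evaluable.bin {f g : (V → ℝ) → ℝ} (hf : Evaluable f) (hg : Evaluable g) (op : Op)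
    (hop : ∀ v, op.Defined (f v) (g v)) : Evaluable fun v => op.eval (f v) (g v) := by
  intro t
  obtain ⟨p, hp⟩ := hf.pair hg t
  refine ⟨.seq p (.instr (.bin op (tmpReg t) (tmpReg t) (tmpReg (t + 1)))), fun s σ => ?_⟩
  obtain ⟨T, reg, he, hT, hf, hg, hr⟩ := hp s σ
  refine ⟨T + 1, _, .seq he (.instr (.bin _ op _ _ _ ?_)), add_le_add hT le_rfl, ?_, ?_⟩
  · simp only [hf, hg]
    exact hop _
  · simp [hf, hg]
  · intro r h
    simp only [Function.update_of_ne (h t le_rfl)]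
    exact hr r h

theorem Evaluable.add {f g : (V → ℝ) → ℝ} (hf : Evaluable f) (hg : Evaluable g) :
    Evaluable fun v => f v + g v :=
  hf.bin hg .add fun _ => trivial

theorem Evaluable.sub {f g : (V → ℝ) → ℝ} (hf : Evaluable f) (hg : Evaluable g) :
    Evaluable fun v => f v - g v :=
  hf.bin hg .sub fun _ => trivial

theorem Evaluable.mul {f g : (V → ℝ) → ℝ} (hf : Evaluable f) (hg : Evaluable g) :
    Evaluable fun v => f v * g v :=
  hf.bin hg .mul fun _ => trivial

theorem Evaluable.sq {f : (V → ℝ) → ℝ} (hf : Evaluable f) : Evaluable fun v => f v ^ 2 := by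
  simpa only [pow_two] using hf.mul hf

theorem Evaluable.ite_ne {c f g : (V → ℝ) → ℝ} (hc : Evaluable c) (hf : Evaluable f)
    (hg : Evaluable g) : Evaluable fun v => if c v ≠ 0 then f v else g v := by
  intro t
  obtain ⟨p, hp⟩ := hc t
  obtain ⟨q, hq⟩ := hf t
  obtain ⟨q', hq'⟩ := hg t
  refine ⟨.seq p (.ite (tmpReg t) q q'), fun s σ => ?_⟩
  obtain ⟨T₁, reg₁, he₁, hT₁, hv₁, hr₁⟩ := hp s σ
  by_cases h : c (fun a => σ.reg (varReg a)) ≠ 0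
  · obtain ⟨T₂, reg₂, he₂, hT₂, hv₂, hr₂⟩ := hq s ⟨reg₁, σ.mem⟩
    refine ⟨T₁ + (T₂ + 1), reg₂, .seq he₁ (.ite_true (by simpa only [hv₁] using h) he₂), ?_, ?_, ?_⟩
    · simp only [Program.size]
      omega
    · refine hv₂.trans (Eq.trans ?_ (if_pos h).symm)
      exact congrArg f (var_eq_of_eq hr₁)
    · intro r hr
      rw [hr₂ r hr]
      exact hr₁ r hr
  · obtain ⟨T₂, reg₂, he₂, hT₂, hv₂, hr₂⟩ := hq' s ⟨reg₁, σ.mem⟩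
    refine ⟨T₁ + (T₂ + 1), reg₂,
      .seq he₁ (.ite_false (by simpa only [hv₁] using not_not.1 h) he₂), ?_, ?_, ?_⟩
    · simp only [Program.size]
      omega
    · refine hv₂.trans (Eq.trans ?_ (if_neg h).symm)
      exact congrArg g (var_eq_of_eq hr₁)
    · intro r hr
      rw [hr₂ r hr]
      exact hr₁ r hr

theorem Evaluable.ite_le {a b f g : (V → ℝ) → ℝ} (ha : Evaluable a) (hb : Evaluable b)
    (hf : Evaluable f) (hg : Evaluable g) :
    Evaluable fun v => if a v ≤ b v then f v else g v := by
  simpa [Op.eval] using (ha.bin hb .le fun _ => trivial).ite_ne hf hg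

theorem Evaluable.ite_lt {a b f g : (V → ℝ) → ℝ} (ha : Evaluable a) (hb : Evaluable b)
    (hf : Evaluable f) (hg : Evaluable g) :
    Evaluable fun v => if a v < b v then f v else g v := by
  simpa [Op.eval] using (ha.bin hb .lt fun _ => trivial).ite_ne hf hg

theorem Evaluable.ite_eq {a b f g : (V → ℝ) → ℝ} (ha : Evaluable a) (hb : Evaluable b)
    (hf : Evaluable f) (hg : Evaluable g) :
    Evaluable fun v => if a v = b v then f v else g v := by
  simpa [Op.eval] using (ha.bin hb .eq fun _ => trivial).ite_ne hf hg

theorem Evaluable.max {f g : (V → ℝ) → ℝ} (hf : Evaluable f) (hg : Evaluable g) :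
    Evaluable fun v => max (f v) (g v) := by
  simpa only [max_def] using hf.ite_le hg hg hf

theorem Evaluable.min {f g : (V → ℝ) → ℝ} (hf : Evaluable f) (hg : Evaluable g) :
    Evaluable fun v => min (f v) (g v) := by
  simpa only [min_def] using hf.ite_le hg hf hg

/-- Division is evaluable with the convention `x / 0 = 0`: the program tests the divisor first. -/
theorem Evaluable.div {f g : (V → ℝ) → ℝ} (hf : Evaluable f) (hg : Evaluable g) :
    Evaluable fun v => f v / g v := by
  intro t
  obtain ⟨p, hp⟩ := hf.pair hg t
  refine ⟨.seq p (.ite (tmpReg (t + 1)) (.instr (.bin .div (tmpReg t) (tmpReg t) (tmpReg (t + 1))))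
    (.instr (.const (tmpReg t) 0))), fun s σ => ?_⟩
  obtain ⟨T, reg, he, hT, hf, hg, hr⟩ := hp s σ
  by_cases h : reg (tmpReg (t + 1)) = 0
  · refine ⟨T + (1 + 1), _, .seq he (.ite_false h (.instr (.const _ _ _))), ?_, ?_, ?_⟩
    · simp only [Program.size]
      omega
    · simp [← hg, h]
    · intro r hr'
      simp only [Function.update_of_ne (hr' t le_rfl)]
      exact hr r hr'
  · refine ⟨T + (1 + 1), _, .seq he (.ite_true h (.instr (.bin _ .div _ _ _ h))), ?_, ?_, ?_⟩
    · simp only [Program.size]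
      omega
    · simp [hf, hg, Op.eval]
    · intro r hr'
      simp only [Function.update_of_ne (hr' t le_rfl)]
      exact hr r hr'

/-- The square root is evaluable with the convention `√x = 0` for `x < 0`: the program replaces a
negative argument by `0` first. -/
theorem Evaluable.sqrt {f : (V → ℝ) → ℝ} (hf : Evaluable f) :
    Evaluable fun v => Real.sqrt (f v) := by
  intro t
  obtain ⟨p, hp⟩ := hf.max (Evaluable.zero (V := V)) t
  refine ⟨.seq p (.instr (.sqrt (tmpReg t) (tmpReg t))), fun s σ => ?_⟩
  obtain ⟨T, reg, he, hT, hv, hr⟩ := hp s σ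
  refine ⟨T + 1, _, .seq he (.instr (.sqrt _ _ _ ?_)), add_le_add hT le_rfl, ?_, ?_⟩
  · simp [hv]
  · rcases le_total 0 (f fun a => σ.reg (varReg a)) with h | h
    · simp [hv, h]
    · simp [hv, h, Real.sqrt_eq_zero_of_nonpos h]
  · intro r h
    simp only [Function.update_of_ne (h t le_rfl)]
    exact hr r h

theorem Evaluable.sum {ι : Type} (s : Finset ι) {f : ι → (V → ℝ) → ℝ}
    (hf : ∀ i, Evaluable (f i)) : Evaluable fun v => ∑ i ∈ s, f i v := by
  classical
  induction s using Finset.induction_on with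
  | empty => simpa using Evaluable.zero (V := V)
  | insert a s ha ih => simpa only [Finset.sum_insert ha] using (hf a).add ih

theorem Evaluable.inf' {ι : Type} {s : Finset ι} (hs : s.Nonempty) {f : ι → (V → ℝ) → ℝ}
    (hf : ∀ i, Evaluable (f i)) : Evaluable fun v => s.inf' hs fun i => f i v := by
  induction hs using Finset.Nonempty.cons_induction with
  | singleton a => simpa using hf a
  | cons a s h hs ih => simpa only [Finset.inf'_cons hs] using (hf a).min ih

/-! ### Triples -/

/-- On a machine with `s` memory cells, the program `p` started with visible content `x` halts
within `B` steps with a visible content that satisfies `Q`. -/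
def Triple (s : ℕ) (p : Program) (x : Store V) (B : ℕ) (Q : Store V → Prop) : Prop :=
  ∀ σ : State, σ.toStore V = x →
    ∃ (T : ℕ) (σ' : State), Exec s p σ T σ' ∧ T ≤ B ∧ Q (σ'.toStore V)

variable {s : ℕ} {p q : Program} {x : Store V} {B B' : ℕ} {Q Q' : Store V → Prop}

theorem Triple.mono (h : Triple s p x B Q) (hB : B ≤ B') (hQ : ∀ y, Q y → Q' y) :
    Triple s p x B' Q' := by
  intro σ hσ
  obtain ⟨T, σ', he, hT, hq⟩ := h σ hσ
  exact ⟨T, σ', he, hT.trans hB, hQ _ hq⟩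

theorem Triple.seq (h : Triple s p x B fun y => Triple s q y B' Q) :
    Triple s (.seq p q) x (B + B') Q := by
  intro σ hσ
  obtain ⟨T, σ', he, hT, hq⟩ := h σ hσ
  obtain ⟨T', σ'', he', hT', hq'⟩ := hq σ' rfl
  exact ⟨T + T', σ'', .seq he he', add_le_add hT hT', hq'⟩

theorem Triple.seq_size (h : Triple s p x p.size fun y => Triple s q y q.size Q) :
    Triple s (.seq p q) x (Program.seq p q).size Q :=
  Triple.seq h

theorem Triple.skip (h : Q x) : Triple s .skip x 1 Q := by
  rintro σ rfl
  exact ⟨1, σ, .skip σ, le_rfl, h⟩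

/-- A program, fixed by choice, that evaluates `f` into the `t`-th temporary. -/
noncomputable def evalProg (t : ℕ) (f : (V → ℝ) → ℝ) (hf : Evaluable f) : Program :=
  (hf t).choose

theorem evalProg_spec (t : ℕ) (f : (V → ℝ) → ℝ) (hf : Evaluable f) :
    (evalProg t f hf).Evaluates t f :=
  (hf t).choose_spec

/-- The assignment `a := f`. -/
noncomputable def assign (a : V) (f : (V → ℝ) → ℝ) (hf : Evaluable f) : Program :=
  .seq (evalProg 0 f hf) (.instr (.copy (varReg a) (tmpReg 0)))

/-- The assignment `a := M[f]`. -/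
noncomputable def loadAt (a : V) (f : (V → ℝ) → ℝ) (hf : Evaluable f) : Program :=
  .seq (evalProg 0 f hf) (.instr (.load (varReg a) (tmpReg 0)))

/-- The assignment `M[f] := g`. -/
noncomputable def storeAt (f g : (V → ℝ) → ℝ) (hf : Evaluable f) (hg : Evaluable g) : Program :=
  .seq (evalProg 0 f hf) (.seq (evalProg 1 g hg) (.instr (.store (tmpReg 0) (tmpReg 1))))

/-- The conditional with test `f ≠ 0`. -/
noncomputable def cond (f : (V → ℝ) → ℝ) (hf : Evaluable f) (p q : Program) : Program :=
  .seq (evalProg 0 f hf) (.ite (tmpReg 0) p q)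

/-- The loop with test `f ≠ 0`. -/
noncomputable def loop (f : (V → ℝ) → ℝ) (hf : Evaluable f) (p : Program) : Program :=
  .seq (evalProg 0 f hf) (.while (tmpReg 0) (.seq p (evalProg 0 f hf)))

theorem toStore_of_eq {t : ℕ} {σ : State} {reg : ℕ → ℝ}
    (h : ∀ r, (∀ u, t ≤ u → r ≠ tmpReg u) → reg r = σ.reg r) :
    State.toStore V ⟨reg, σ.mem⟩ = σ.toStore V := by
  simp only [State.toStore, Store.mk.injEq, and_true]
  exact var_eq_of_eq h

theorem toStore_update_var [DecidableEq V] (reg : ℕ → ℝ) (mem : ℕ → ℝ) (a : V) (r : ℝ) :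
    State.toStore V ⟨Function.update reg (varReg a) r, mem⟩ =
      ⟨Function.update (fun b => reg (varReg b)) a r, mem⟩ := by
  simp only [State.toStore, Store.mk.injEq, and_true]
  funext b
  by_cases h : b = a
  · subst h
    simp
  · rw [Function.update_of_ne h, Function.update_of_ne (varReg_injective.ne h)]

theorem Triple.assign [DecidableEq V] {a : V} {f : (V → ℝ) → ℝ} {hf : Evaluable f}
    (h : Q ⟨Function.update x.var a (f x.var), x.mem⟩) :
    Triple s (assign a f hf) x (assign a f hf).size Q := by
  rintro σ rfl
  obtain ⟨T, reg, he, hT, hv, hr⟩ := evalProg_spec 0 f hf s σ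
  refine ⟨T + 1, _, .seq he (.instr (.copy _ _ _)), add_le_add hT le_rfl, ?_⟩
  rw [toStore_update_var]
  simp only [hv]
  rw [var_eq_of_eq hr]
  exact h

theorem Triple.loadAt [DecidableEq V] {a : V} {f : (V → ℝ) → ℝ} {hf : Evaluable f} (m : ℕ)
    (hm : f x.var = m) (hs : m < s)
    (h : Q ⟨Function.update x.var a (x.mem m), x.mem⟩) :
    Triple s (loadAt a f hf) x (loadAt a f hf).size Q := by
  rintro σ rfl
  obtain ⟨T, reg, he, hT, hv, hr⟩ := evalProg_spec 0 f hf s σ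
  refine ⟨T + 1, _, .seq he (.instr (.load _ _ _ m (hv.trans hm) hs)), add_le_add hT le_rfl, ?_⟩
  rw [toStore_update_var]
  simp only
  rw [var_eq_of_eq hr]
  exact h

theorem Triple.storeAt {f g : (V → ℝ) → ℝ} {hf : Evaluable f} {hg : Evaluable g} (m : ℕ)
    (hm : f x.var = m) (hs : m < s)
    (h : Q ⟨x.var, Function.update x.mem m (g x.var)⟩) :
    Triple s (storeAt f g hf hg) x (storeAt f g hf hg).size Q := by
  rintro σ rfl
  obtain ⟨T, reg, he, hT, hv, hr⟩ := evalProg_spec 0 f hf s σ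
  obtain ⟨T', reg', he', hT', hv', hr'⟩ := evalProg_spec 1 g hg s ⟨reg, σ.mem⟩
  have h0 : reg' (tmpReg 0) = (m : ℝ) :=
    (hr' (tmpReg 0) fun u hu => tmpReg_injective.ne (by omega)).trans (hv.trans hm)
  refine ⟨T + (T' + 1), _, .seq he (.seq he' (.instr (.store _ _ _ m h0 hs))), ?_, ?_⟩
  · exact add_le_add hT (add_le_add hT' le_rfl)
  · have h1 := var_eq_of_eq (V := V) hr
    have h2 := var_eq_of_eq (V := V) hr'
    simp only at h2
    simp only [State.toStore, hv', h2, h1]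
    exact h

theorem Triple.cond {f : (V → ℝ) → ℝ} {hf : Evaluable f}
    (ht : f x.var ≠ 0 → Triple s p x B Q) (hn : f x.var = 0 → Triple s q x B Q) :
    Triple s (cond f hf p q) x ((evalProg 0 f hf).size + 1 + B) Q := by
  rintro σ rfl
  obtain ⟨T, reg, he, hT, hv, hr⟩ := evalProg_spec 0 f hf s σ
  by_cases h : f (fun a => σ.reg (varReg a)) = 0
  · obtain ⟨T', σ', he', hT', hq⟩ := hn h ⟨reg, σ.mem⟩ (toStore_of_eq hr)
    exact ⟨T + (T' + 1), σ', .seq he (.ite_false (hv.trans h) he'), by omega, hq⟩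
  · obtain ⟨T', σ', he', hT', hq⟩ := ht h ⟨reg, σ.mem⟩ (toStore_of_eq hr)
    exact ⟨T + (T' + 1), σ', .seq he (.ite_true (by simpa only [hv] using h) he'), by omega, hq⟩

theorem Triple.cond_size {f : (V → ℝ) → ℝ} {hf : Evaluable f}
    (ht : f x.var ≠ 0 → Triple s p x p.size Q) (hn : f x.var = 0 → Triple s q x q.size Q) :
    Triple s (RealRAM.cond f hf p q) x (RealRAM.cond f hf p q).size Q := by
  refine Triple.mono (B := (evalProg 0 f hf).size + 1 + (p.size + q.size))
    (Triple.cond (fun h => (ht h).mono (by omega) fun _ => id)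
      fun h => (hn h).mono (by omega) fun _ => id) ?_ fun _ => id
  simp only [RealRAM.cond, Program.size]
  omega

/-- The rule for loops. `Inv Φ` is an invariant with a potential `Φ` that pays for all remaining
iterations: the body, its test and the evaluation of the condition. -/
theorem Triple.loop {f : (V → ℝ) → ℝ} {hf : Evaluable f} (Inv : ℕ → Store V → Prop) (Φ : ℕ)
    (body : ∀ Φ y, Inv Φ y → f y.var ≠ 0 → ∃ B, Triple s p y B fun z =>
      ∃ Φ', Inv Φ' z ∧ Φ' + B + ((evalProg 0 f hf).size + 1) ≤ Φ)
    (h0 : Inv Φ x) (h1 : ∀ Φ y, Inv Φ y → f y.var = 0 → Q y) :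
    Triple s (loop f hf p) x (Φ + ((evalProg 0 f hf).size + 1)) Q := by
  have key : ∀ (Φ : ℕ) (σ : State), Inv Φ (σ.toStore V) →
      σ.reg (tmpReg 0) = f (fun a => σ.reg (varReg a)) →
      ∃ T σ', Exec s (.while (tmpReg 0) (.seq p (evalProg 0 f hf))) σ T σ' ∧ T ≤ Φ + 1 ∧
        Q (σ'.toStore V) := by
    intro Φ
    induction Φ using Nat.strong_induction_on with
    | _ Φ ih =>
      intro σ hi ht
      by_cases hz : f (fun a => σ.reg (varReg a)) = 0
      · exact ⟨1, σ, .while_false (ht.trans hz), by omega, h1 _ _ hi hz⟩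
      · obtain ⟨B, hb⟩ := body Φ _ hi hz
        obtain ⟨T, σ', he, hT, Φ', hi', hΦ⟩ := hb σ rfl
        obtain ⟨T', reg, he', hT', hv, hr⟩ := evalProg_spec 0 f hf s σ'
        have hst := toStore_of_eq (V := V) hr
        obtain ⟨T'', σ'', he'', hT'', hq⟩ := ih Φ' (by omega) ⟨reg, σ'.mem⟩
          (by rw [hst]; exact hi') (hv.trans (congrArg f (var_eq_of_eq hr).symm))
        exact ⟨T + T' + T'' + 1, σ'', .while_true (by rw [ht]; exact hz) (.seq he he') he'',
          by omega, hq⟩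
  rintro σ rfl
  obtain ⟨T, reg, he, hT, hv, hr⟩ := evalProg_spec 0 f hf s σ
  obtain ⟨T', σ', he', hT', hq⟩ := key Φ ⟨reg, σ.mem⟩
    (by rw [toStore_of_eq hr]; exact h0) (hv.trans (congrArg f (var_eq_of_eq hr).symm))
  exact ⟨T + T', σ', .seq he he', by omega, hq⟩

/-! ### Cost bounds that are multiples of the size -/

/-- The constants in the running time are never computed: the cost of a program is bounded by a
multiple of its own size, and the rules for its parts pass the multiplier `K` on. -/
theorem Triple.seq_mul {K : ℕ} (hK : 1 ≤ K)
    (h : Triple s p x p.size fun y => Triple s q y (q.size * K) Q) :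
    Triple s (.seq p q) x ((Program.seq p q).size * K) Q := by
  refine (Triple.seq h).mono ?_ fun _ => id
  simp only [Program.size]
  nlinarith

theorem Triple.mul_seq {K : ℕ} (hK : 1 ≤ K)
    (h : Triple s p x (p.size * K) fun y => Triple s q y q.size Q) :
    Triple s (.seq p q) x ((Program.seq p q).size * K) Q := by
  refine (Triple.seq h).mono ?_ fun _ => id
  simp only [Program.size]
  nlinarith

theorem Triple.cond_mul {K : ℕ} {f : (V → ℝ) → ℝ} {hf : Evaluable f} (hK : 1 ≤ K)
    (ht : f x.var ≠ 0 → Triple s p x (p.size * K) Q)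
    (hn : f x.var = 0 → Triple s q x (q.size * K) Q) :
    Triple s (RealRAM.cond f hf p q) x ((RealRAM.cond f hf p q).size * K) Q := by
  refine Triple.mono (B := (evalProg 0 f hf).size + 1 + (p.size * K + q.size * K))
    (Triple.cond (fun h => (ht h).mono (by omega) fun _ => id)
      fun h => (hn h).mono (by omega) fun _ => id) ?_ fun _ => id
  simp only [RealRAM.cond, Program.size]
  nlinarith

/-- The rule for a loop whose body runs in constant time, with a measure `μ` that bounds the number
of iterations. -/
theorem Triple.loop_size {f : (V → ℝ) → ℝ} {hf : Evaluable f} (Inv : ℕ → Store V → Prop) (μ : ℕ)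
    (body : ∀ μ y, Inv μ y → f y.var ≠ 0 → Triple s p y p.size fun z => ∃ μ' < μ, Inv μ' z)
    (h0 : Inv μ x) (h1 : ∀ μ y, Inv μ y → f y.var = 0 → Q y) :
    Triple s (RealRAM.loop f hf p) x ((RealRAM.loop f hf p).size * (μ + 1)) Q := by
  refine Triple.mono (Triple.loop
    (fun Φ y => ∃ μ, Inv μ y ∧ Φ = (p.size + (evalProg 0 f hf).size + 1) * μ) _ ?_ ⟨μ, h0, rfl⟩ ?_)
    ?_ fun _ => id
  · rintro _ y ⟨μ, hy, rfl⟩ hne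
    refine ⟨p.size, (body μ y hy hne).mono le_rfl ?_⟩
    rintro z ⟨μ', hlt, hz⟩
    refine ⟨_, ⟨μ', hz, rfl⟩, ?_⟩
    nlinarith
  · rintro _ y ⟨μ, hy, rfl⟩ h
    exact h1 μ y hy h
  · simp only [RealRAM.loop, Program.size]
    nlinarith

/-! ### Families of assignments -/

/-- The programs `p 0, ..., p (N - 1)` one after another. -/
def seqFam (N : ℕ) (p : ℕ → Program) : Program :=
  match N with
  | 0 => .skip
  | N + 1 => .seq (seqFam N p) (p N)

theorem Triple.seqFam {N : ℕ} {p : ℕ → Program} (Inv : ℕ → Store V → Prop)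
    (h0 : Inv 0 x) (hstep : ∀ k < N, ∀ y, Inv k y → Triple s (p k) y (p k).size (Inv (k + 1))) :
    Triple s (seqFam N p) x (RealRAM.seqFam N p).size (Inv N) := by
  induction N with
  | zero => exact Triple.skip h0
  | succ N ih =>
    exact Triple.seq_size ((ih fun k hk => hstep k (by omega)).mono le_rfl fun y hy =>
      hstep N (by omega) y hy)

/-- The assignments `M[f + k] := g k` for `k < N`. -/
noncomputable def storeFam (N : ℕ) (f : (V → ℝ) → ℝ) (hf : Evaluable f) (g : ℕ → (V → ℝ) → ℝ)
    (hg : ∀ k, Evaluable (g k)) : Program :=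
  seqFam N fun k => storeAt (fun v => f v + k) (g k) (hf.add (.natConst k)) (hg k)

theorem Triple.storeFam {N : ℕ} {f : (V → ℝ) → ℝ} {hf : Evaluable f} {g : ℕ → (V → ℝ) → ℝ}
    {hg : ∀ k, Evaluable (g k)} (m : ℕ) (hm : f x.var = m) (hs : m + N ≤ s)
    (h : Q ⟨x.var, fun j => if m ≤ j ∧ j < m + N then g (j - m) x.var else x.mem j⟩) :
    Triple s (storeFam N f hf g hg) x (RealRAM.storeFam N f hf g hg).size Q := by
  refine Triple.mono (Triple.seqFam
    (fun k y => y = ⟨x.var, fun j => if m ≤ j ∧ j < m + k then g (j - m) x.var else x.mem j⟩)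
    ?_ ?_) le_rfl ?_
  · ext j
    · rfl
    · exact (if_neg (by omega)).symm
  · rintro k hk y rfl
    refine Triple.storeAt (m + k) ?_ (by omega) ?_
    · simp only [hm]
      push_cast
      rfl
    · ext j
      · rfl
      · simp only [Function.update_apply]
        by_cases hj : j = m + k
        · subst hj
          simp
        · rw [if_neg hj]
          by_cases hj' : m ≤ j ∧ j < m + k
          · rw [if_pos hj', if_pos (by omega)]
          · rw [if_neg hj', if_neg (by omega)]
  · rintro y rfl
    exact h

end Logic

section Families

variable {V : Type} [DecidableEq V]

/-- The value of `dst k` is replaced by `g k` for `k < N`. -/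
noncomputable def updateFam (N : ℕ) (v : V → ℝ) (dst : ℕ → V) (g : ℕ → ℝ) : V → ℝ :=
  match N with
  | 0 => v
  | N + 1 => Function.update (updateFam N v dst g) (dst N) (g N)

theorem updateFam_of_ne {N : ℕ} {v : V → ℝ} {dst : ℕ → V} {g : ℕ → ℝ} {a : V}
    (h : ∀ k, a ≠ dst k) : updateFam N v dst g a = v a := by
  induction N with
  | zero => rfl
  | succ N ih => rw [updateFam, Function.update_of_ne (h N), ih]

theorem updateFam_apply {N : ℕ} {v : V → ℝ} {dst : ℕ → V} (hd : Function.Injective dst)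
    {g : ℕ → ℝ} {k : ℕ} : updateFam N v dst g (dst k) = if k < N then g k else v (dst k) := by
  induction N with
  | zero => simp [updateFam]
  | succ N ih =>
    rw [updateFam]
    by_cases h : k = N
    · subst h
      simp
    · rw [Function.update_of_ne (hd.ne h), ih]
      by_cases h' : k < N
      · rw [if_pos h', if_pos (by omega)]
      · rw [if_neg h', if_neg (by omega)]

variable [Encodable V] {s : ℕ} {x : Store V} {Q : Store V → Prop}

/-- The assignments `dst k := f k` for `k < N`. -/
noncomputable def assignFam (N : ℕ) (dst : ℕ → V) (f : ℕ → (V → ℝ) → ℝ)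
    (hf : ∀ k, Evaluable (f k)) : Program :=
  seqFam N fun k => assign (dst k) (f k) (hf k)

/-- The assignments of a family act simultaneously if no right-hand side depends on the
destinations of the others. -/
theorem Triple.assignFam {N : ℕ} {dst : ℕ → V} {f : ℕ → (V → ℝ) → ℝ} {hf : ∀ k, Evaluable (f k)}
    (hind : ∀ k < N, ∀ g, f k (updateFam k x.var dst g) = f k x.var)
    (h : Q ⟨updateFam N x.var dst fun k => f k x.var, x.mem⟩) :
    Triple s (assignFam N dst f hf) x (RealRAM.assignFam N dst f hf).size Q := by
  refine Triple.mono (Triple.seqFam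
    (fun k y => y = ⟨updateFam k x.var dst fun k => f k x.var, x.mem⟩) rfl ?_) le_rfl ?_
  · rintro k hk y rfl
    refine Triple.assign ?_
    simp only [updateFam, hind k hk]
  · rintro y rfl
    exact h

/-- The assignments `dst k := M[f + k]` for `k < N`. -/
noncomputable def loadFam (N : ℕ) (dst : ℕ → V) (f : (V → ℝ) → ℝ) (hf : Evaluable f) : Program :=
  seqFam N fun k => loadAt (dst k) (fun v => f v + k) (hf.add (.natConst k))

theorem Triple.loadFam {N : ℕ} {dst : ℕ → V} {f : (V → ℝ) → ℝ} {hf : Evaluable f} (m : ℕ)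
    (hind : ∀ k < N, ∀ g, f (updateFam k x.var dst g) = f x.var) (hm : f x.var = m)
    (hs : m + N ≤ s) (h : Q ⟨updateFam N x.var dst fun k => x.mem (m + k), x.mem⟩) :
    Triple s (loadFam N dst f hf) x (RealRAM.loadFam N dst f hf).size Q := by
  refine Triple.mono (Triple.seqFam
    (fun k y => y = ⟨updateFam k x.var dst fun k => x.mem (m + k), x.mem⟩) rfl ?_) le_rfl ?_
  · rintro k hk y rfl
    refine Triple.loadAt (m + k) ?_ (by omega) ?_
    · simp only [hind k hk, hm]
      push_cast
      rfl
    · simp only [updateFam]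
  · rintro y rfl
    exact h

end Families

end RealRAM

/-! ### Segments and monotone paths -/

section Geometry

variable {d : ℕ}

theorem edgeCurve_zero (u v : EuclideanSpace ℝ (Fin d)) : edgeCurve u v 0 = u := by
  simp [edgeCurve]

theorem edgeCurve_one (u v : EuclideanSpace ℝ (Fin d)) : edgeCurve u v 1 = v := by
  simp [edgeCurve]

theorem edgeCurve_swap (u v : EuclideanSpace ℝ (Fin d)) (t : ℝ) :
    edgeCurve u v (1 - t) = edgeCurve v u t := by
  simp only [edgeCurve, sub_sub_cancel]
  exact add_comm _ _

theorem edgeCurve_self (u : EuclideanSpace ℝ (Fin d)) (t : ℝ) : edgeCurve u u t = u := by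
  simp [edgeCurve, ← add_smul]

theorem edgeCurve_reparam (u v : EuclideanSpace ℝ (Fin d)) (a b t : ℝ) :
    edgeCurve (edgeCurve u v a) (edgeCurve u v b) t = edgeCurve u v (a + t * (b - a)) := by
  simp only [edgeCurve]
  module

theorem norm_edgeCurve_sub_edgeCurve_le {u v u' v' : EuclideanSpace ℝ (Fin d)} {δ t : ℝ}
    (hu : ‖u - u'‖ ≤ δ) (hv : ‖v - v'‖ ≤ δ) (h0 : 0 ≤ t) (h1 : t ≤ 1) :
    ‖edgeCurve u v t - edgeCurve u' v' t‖ ≤ δ := by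
  have : edgeCurve u v t - edgeCurve u' v' t = (1 - t) • (u - u') + t • (v - v') := by
    simp only [edgeCurve]
    module
  rw [this]
  refine (norm_add_le _ _).trans ?_
  rw [norm_smul, norm_smul, Real.norm_of_nonneg h0, Real.norm_of_nonneg (by linarith)]
  nlinarith

/-- The least parameter `t` with `s ≤ t ≤ 1` at which the segment from `u` to `v` is within distance
`r` of `x`; the value is `2` if there is none. The admissible parameters lie between the two roots
of a quadratic polynomial. The case `u = v`, where it degenerates, is treated apart. -/
noncomputable def nextParam (u v : EuclideanSpace ℝ (Fin d)) (r : ℝ)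
    (x : EuclideanSpace ℝ (Fin d)) (s : ℝ) : ℝ :=
  if ‖v - u‖ ^ 2 = 0 then
    if ‖x - u‖ ^ 2 - r ^ 2 ≤ 0 then (if s ≤ 1 then s else 2) else 2
  else
    if inner ℝ (x - u) (v - u) ^ 2 - ‖v - u‖ ^ 2 * (‖x - u‖ ^ 2 - r ^ 2) < 0 then 2
    else
      if max s ((inner ℝ (x - u) (v - u) - √(inner ℝ (x - u) (v - u) ^ 2 -
          ‖v - u‖ ^ 2 * (‖x - u‖ ^ 2 - r ^ 2))) / ‖v - u‖ ^ 2) ≤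
        (inner ℝ (x - u) (v - u) + √(inner ℝ (x - u) (v - u) ^ 2 -
          ‖v - u‖ ^ 2 * (‖x - u‖ ^ 2 - r ^ 2))) / ‖v - u‖ ^ 2
      then
        if max s ((inner ℝ (x - u) (v - u) - √(inner ℝ (x - u) (v - u) ^ 2 -
          ‖v - u‖ ^ 2 * (‖x - u‖ ^ 2 - r ^ 2))) / ‖v - u‖ ^ 2) ≤ 1
        then max s ((inner ℝ (x - u) (v - u) - √(inner ℝ (x - u) (v - u) ^ 2 -
          ‖v - u‖ ^ 2 * (‖x - u‖ ^ 2 - r ^ 2))) / ‖v - u‖ ^ 2)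
        else 2
      else 2

theorem norm_sub_edgeCurve_sq (u v x : EuclideanSpace ℝ (Fin d)) (t : ℝ) :
    ‖x - edgeCurve u v t‖ ^ 2 =
      ‖x - u‖ ^ 2 - 2 * t * inner ℝ (x - u) (v - u) + t ^ 2 * ‖v - u‖ ^ 2 := by
  have : x - edgeCurve u v t = (x - u) - t • (v - u) := by
    simp only [edgeCurve]
    module
  rw [this, norm_sub_sq_real, inner_smul_right, norm_smul, mul_pow, Real.norm_eq_abs, sq_abs]
  ring

theorem norm_sub_edgeCurve_le_iff {u v x : EuclideanSpace ℝ (Fin d)} {r : ℝ} (hr : 0 ≤ r)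
    (h : ‖v - u‖ ^ 2 ≠ 0) (t : ℝ) :
    ‖x - edgeCurve u v t‖ ≤ r ↔
      0 ≤ inner ℝ (x - u) (v - u) ^ 2 - ‖v - u‖ ^ 2 * (‖x - u‖ ^ 2 - r ^ 2) ∧
      (inner ℝ (x - u) (v - u) - √(inner ℝ (x - u) (v - u) ^ 2 -
          ‖v - u‖ ^ 2 * (‖x - u‖ ^ 2 - r ^ 2))) / ‖v - u‖ ^ 2 ≤ t ∧
      t ≤ (inner ℝ (x - u) (v - u) + √(inner ℝ (x - u) (v - u) ^ 2 -
          ‖v - u‖ ^ 2 * (‖x - u‖ ^ 2 - r ^ 2))) / ‖v - u‖ ^ 2 := by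
  rw [← sq_le_sq₀ (norm_nonneg _) hr, norm_sub_edgeCurve_sq]
  have hA : 0 < ‖v - u‖ ^ 2 := lt_of_le_of_ne (sq_nonneg _) (Ne.symm h)
  generalize ‖v - u‖ ^ 2 = A at *
  generalize inner ℝ (x - u) (v - u) = b
  generalize ‖x - u‖ ^ 2 = c
  rw [div_le_iff₀ hA, le_div_iff₀ hA]
  constructor
  · intro h
    have h1 : (t * A - b) ^ 2 ≤ b ^ 2 - A * (c - r ^ 2) := by nlinarith
    have h2 := Real.abs_le_sqrt h1
    rw [abs_le] at h2
    exact ⟨(sq_nonneg _).trans h1, by linarith, by linarith⟩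
  · rintro ⟨h0, h1, h2⟩
    have h3 : (t * A - b) ^ 2 ≤ b ^ 2 - A * (c - r ^ 2) := by
      rw [← Real.sq_sqrt h0]
      exact sq_le_sq' (by linarith) (by linarith)
    have h4 : A * (c - 2 * t * b + t ^ 2 * A) ≤ A * r ^ 2 := by nlinarith
    exact le_of_mul_le_mul_left h4 hA

theorem norm_sub_edgeCurve_le_iff_of_eq_zero {u v x : EuclideanSpace ℝ (Fin d)} {r : ℝ}
    (hr : 0 ≤ r) (h : ‖v - u‖ ^ 2 = 0) (t : ℝ) :
    ‖x - edgeCurve u v t‖ ≤ r ↔ ‖x - u‖ ^ 2 - r ^ 2 ≤ 0 := by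
  have h' : v - u = 0 := by simpa using h
  rw [← sq_le_sq₀ (norm_nonneg _) hr, norm_sub_edgeCurve_sq, h']
  simp

theorem nextParam_sound {u v x : EuclideanSpace ℝ (Fin d)} {r s : ℝ} (hr : 0 ≤ r)
    (h : nextParam u v r x s ≤ 1) :
    s ≤ nextParam u v r x s ∧ ‖x - edgeCurve u v (nextParam u v r x s)‖ ≤ r := by
  unfold nextParam at h ⊢
  split_ifs at h ⊢ with h1 h2 h3 h4 h5 h6
  · exact ⟨le_rfl, (norm_sub_edgeCurve_le_iff_of_eq_zero hr h1 _).2 h2⟩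
  all_goals try norm_num at h
  exact ⟨le_max_left _ _, (norm_sub_edgeCurve_le_iff hr h1 _).2
    ⟨not_lt.1 h4, le_max_right _ _, h5⟩⟩

theorem nextParam_le {u v x : EuclideanSpace ℝ (Fin d)} {r s t : ℝ} (hr : 0 ≤ r)
    (hs : s ≤ t) (ht : t ≤ 1) (h : ‖x - edgeCurve u v t‖ ≤ r) : nextParam u v r x s ≤ t := by
  unfold nextParam
  by_cases h1 : ‖v - u‖ ^ 2 = 0
  · rw [if_pos h1, if_pos ((norm_sub_edgeCurve_le_iff_of_eq_zero hr h1 _).1 h),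
      if_pos (hs.trans ht)]
    exact hs
  · obtain ⟨h2, h3, h4⟩ := (norm_sub_edgeCurve_le_iff hr h1 _).1 h
    rw [if_neg h1, if_neg (not_lt.2 h2), if_pos ((max_le hs h3).trans h4),
      if_pos ((max_le hs h3).trans ht)]
    exact max_le hs h3

/-- The vertices `p w, p (w - 1), ..., p c` can be matched, within distance `δ`, to points of the
segment from `u` to `v` whose parameters increase from `0` to `s`. -/
def MonotonePath (p : ℕ → EuclideanSpace ℝ (Fin d)) (u v : EuclideanSpace ℝ (Fin d)) (δ : ℝ)
    (w c : ℕ) (s : ℝ) : Prop :=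
  ∃ f : ℕ → ℝ, f w = 0 ∧ f c = s ∧ (∀ i j, c ≤ i → i ≤ j → j ≤ w → f j ≤ f i) ∧
    ∀ j, c ≤ j → j ≤ w → ‖p j - edgeCurve u v (f j)‖ ≤ δ

variable {p : ℕ → EuclideanSpace ℝ (Fin d)} {u v u' v' : EuclideanSpace ℝ (Fin d)}
  {δ δ' ε s s' : ℝ} {w c c' : ℕ}

theorem MonotonePath.refl (h : ‖p w - u‖ ≤ δ) : MonotonePath p u v δ w w 0 := by
  refine ⟨fun _ => 0, rfl, rfl, fun _ _ _ _ _ => le_rfl, fun j h1 h2 => ?_⟩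
  rw [show j = w by omega, edgeCurve_zero]
  exact h

theorem MonotonePath.mono (h : MonotonePath p u v δ w c s) (hδ : δ ≤ δ') :
    MonotonePath p u v δ' w c s := by
  obtain ⟨f, h0, h1, h2, h3⟩ := h
  exact ⟨f, h0, h1, h2, fun j hj hj' => (h3 j hj hj').trans hδ⟩

/-- Concatenation: a path along the segment `uv` is continued along a segment `u'v'` that is close
to the next part of `uv`. -/
theorem MonotonePath.trans (h : MonotonePath p u v δ' w c s) (hδ : δ' = δ + ε)
    (h' : MonotonePath p u' v' δ c c' 1)
    (hcw : c ≤ w) (hc : c' ≤ c) (hs : s ≤ s') (hu : ‖u' - edgeCurve u v s‖ ≤ ε)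
    (hv : ‖v' - edgeCurve u v s'‖ ≤ ε) : MonotonePath p u v δ' w c' s' := by
  subst hδ
  obtain ⟨f, f0, f1, f2, f3⟩ := h
  obtain ⟨g, g0, g1, g2, g3⟩ := h'
  have hg0 : ∀ j, c' ≤ j → j ≤ c → 0 ≤ g j := fun j h1 h2 => by
    rw [← g0]
    exact g2 j c h1 h2 le_rfl
  have hg1 : ∀ j, c' ≤ j → j ≤ c → g j ≤ 1 := fun j h1 h2 => by
    rw [← g1]
    exact g2 c' j le_rfl h1 h2
  refine ⟨fun j => if c ≤ j then f j else s + g j * (s' - s), ?_, ?_, ?_, ?_⟩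
  · simp only
    rw [if_pos hcw, f0]
  · simp only
    by_cases h : c ≤ c'
    · obtain rfl : c' = c := by omega
      rw [g0] at g1
      norm_num at g1
    · rw [if_neg h, g1]
      ring
  · intro i j hi hij hj
    simp only
    split_ifs with h1 h2 h2
    · exact f2 i j h2 hij hj
    · have h3 := f2 c j le_rfl h1 hj
      have h4 : 0 ≤ g i * (s' - s) := mul_nonneg (hg0 i hi (by omega)) (by linarith)
      linarith
    · omega
    · have h3 := g2 i j hi hij (by omega)
      nlinarith
  · intro j hj hj'
    simp only
    split_ifs with h1
    · exact f3 j h1 hj'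
    · have h2 := g3 j hj (by omega)
      have h3 : ‖edgeCurve u' v' (g j) - edgeCurve u v (s + g j * (s' - s))‖ ≤ ε := by
        rw [← edgeCurve_reparam]
        exact norm_edgeCurve_sub_edgeCurve_le hu hv (hg0 j hj (by omega)) (hg1 j hj (by omega))
      calc _ = ‖(p j - edgeCurve u' v' (g j)) +
          (edgeCurve u' v' (g j) - edgeCurve u v (s + g j * (s' - s)))‖ := by abel_nf
        _ ≤ _ := (norm_add_le _ _).trans (add_le_add h2 h3)

theorem MonotonePath.snoc (h : MonotonePath p u v δ w (c + 1) s) (hcw : c + 1 ≤ w) (hs : s ≤ s')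
    (hp : ‖p c - edgeCurve u v s'‖ ≤ δ) : MonotonePath p u v δ w c s' := by
  obtain ⟨f, f0, f1, f2, f3⟩ := h
  refine ⟨fun j => if j = c then s' else f j, ?_, ?_, ?_, ?_⟩
  · simp only
    rw [if_neg (by omega), f0]
  · simp
  · intro i j hi hij hj
    simp only
    split_ifs with h1 h2 h2
    · exact le_rfl
    · omega
    · have := f2 (c + 1) j le_rfl (by omega) hj
      linarith
    · exact f2 i j (by omega) hij hj
  · intro j hj hj'
    simp only
    split_ifs with h1
    · rw [h1]
      exact hp
    · exact f3 j (by omega) hj'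

/-- The last parameter of a path may be increased to any parameter that is still close to the last
vertex. -/
theorem MonotonePath.raise (h : MonotonePath p u v δ w c s) (hcw : c < w) (hs : s ≤ s')
    (hp : ‖p c - edgeCurve u v s'‖ ≤ δ) : MonotonePath p u v δ w c s' := by
  obtain ⟨f, f0, f1, f2, f3⟩ := h
  have : MonotonePath p u v δ w (c + 1) (f (c + 1)) :=
    ⟨f, f0, rfl, fun i j hi => f2 i j (by omega), fun j hj => f3 j (by omega)⟩
  exact this.snoc (by omega) ((f2 c (c + 1) le_rfl (by omega) (by omega)).trans (f1 ▸ hs)) hp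

/-- Two consecutive vertices always admit a path along a segment with nearby end points. -/
theorem MonotonePath.single (hu : ‖p (c + 1) - u‖ ≤ δ) (hv : ‖p c - v‖ ≤ δ) :
    MonotonePath p u v δ (c + 1) c 1 :=
  (MonotonePath.refl hu).snoc le_rfl zero_le_one (by rwa [edgeCurve_one])

/-- The greedy scan: the least parameter on the segment from `u` to `v` that can be reached after
matching `p (m - 1), ..., p (m - k)` in this order. -/
noncomputable def scan (p : ℕ → EuclideanSpace ℝ (Fin d)) (u v : EuclideanSpace ℝ (Fin d)) (δ : ℝ)
    (m : ℕ) : ℕ → ℝ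
  | 0 => 0
  | k + 1 => nextParam u v δ (p (m - (k + 1))) (scan p u v δ m k)

theorem scan_sound {m k : ℕ} (hδ : 0 ≤ δ) (hu : ‖p m - u‖ ≤ δ) (hk : k ≤ m)
    (h : scan p u v δ m k ≤ 1) : MonotonePath p u v δ m (m - k) (scan p u v δ m k) := by
  induction k with
  | zero => exact MonotonePath.refl hu
  | succ k ih =>
    obtain ⟨h1, h2⟩ := nextParam_sound hδ h
    have := ih (by omega) (h1.trans h)
    rw [show m - k = m - (k + 1) + 1 by omega] at this
    exact this.snoc (by omega) h1 h2

theorem scan_le {m k : ℕ} {g : ℕ → ℝ} (hδ : 0 ≤ δ)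
    (hg0 : ∀ j, m - k ≤ j → j ≤ m → 0 ≤ g j) (hg1 : ∀ j, m - k ≤ j → j ≤ m → g j ≤ 1)
    (hg : ∀ i j, m - k ≤ i → i ≤ j → j ≤ m → g j ≤ g i)
    (hp : ∀ j, m - k ≤ j → j ≤ m → ‖p j - edgeCurve u v (g j)‖ ≤ δ) (hk : k ≤ m) :
    scan p u v δ m k ≤ g (m - k) := by
  induction k with
  | zero => exact hg0 _ le_rfl (by omega)
  | succ k ih =>
    have := ih (fun j h => hg0 j (by omega)) (fun j h => hg1 j (by omega))
      (fun i j h => hg i j (by omega)) (fun j h => hp j (by omega)) (by omega)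
    exact nextParam_le hδ (this.trans (hg _ _ le_rfl (by omega) (by omega)))
      (hg1 _ le_rfl (by omega)) (hp _ le_rfl (by omega))

/-- The scan decides the existence of a path whose end points are near those of the segment. -/
theorem scan_le_one_iff {m k : ℕ} (hδ : 0 ≤ δ) (hu : ‖p m - u‖ ≤ δ) (hv : ‖p (m - k) - v‖ ≤ δ)
    (hk : k ≤ m) (hk0 : 0 < k) :
    scan p u v δ m k ≤ 1 ↔ MonotonePath p u v δ m (m - k) 1 := by
  constructor
  · intro h
    exact (scan_sound hδ hu hk h).raise (by omega) h (by rwa [edgeCurve_one])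
  · rintro ⟨f, f0, f1, f2, f3⟩
    rw [← f1]
    refine scan_le hδ ?_ ?_ f2 f3 hk
    · intro j h1 h2
      rw [← f0]
      exact f2 j m h1 h2 le_rfl
    · intro j h1 h2
      rw [← f1]
      exact f2 _ j le_rfl h1 h2

/-- For a path to the end of a segment with nearby end points, monotone parameters in `[0, 1]`
suffice: the first and the last one can be moved to `0` and `1`. -/
theorem MonotonePath.of_nonneg {g : ℕ → ℝ} {m e : ℕ} (hem : e < m)
    (hg0 : ∀ j, e ≤ j → j ≤ m → 0 ≤ g j) (hg1 : ∀ j, e ≤ j → j ≤ m → g j ≤ 1)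
    (hg : ∀ i j, e ≤ i → i ≤ j → j ≤ m → g j ≤ g i)
    (hp : ∀ j, e ≤ j → j ≤ m → ‖p j - edgeCurve u v (g j)‖ ≤ δ)
    (hu : ‖p m - u‖ ≤ δ) (hv : ‖p e - v‖ ≤ δ) : MonotonePath p u v δ m e 1 := by
  refine ⟨fun j => if j = m then 0 else if j = e then 1 else g j, ?_, ?_, ?_, ?_⟩
  · simp
  · simp [hem.ne]
  · intro i j hi hij hj
    simp only
    split_ifs with h1 h2 h3 h4 h5 h6 h7 <;> try first | omega | norm_num
    · exact hg0 i hi (by omega)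
    · exact hg1 j (by omega) hj
    · exact hg i j hi hij hj
  · intro j hj hj'
    simp only
    split_ifs with h1 h2
    · rw [h1, edgeCurve_zero]
      exact hu
    · rw [h2, edgeCurve_one]
      exact hv
    · exact hp j hj hj'

/-- A path along `uv` restricts to the vertices between `m` and `e`, and there is also one along
any segment with end points near those of the corresponding part of `uv`. -/
theorem MonotonePath.restrict {f : ℕ → ℝ} {m e : ℕ} (hem : e < m)
    (hf : ∀ i j, e ≤ i → i ≤ j → j ≤ m → f j ≤ f i)
    (hp : ∀ j, e ≤ j → j ≤ m → ‖p j - edgeCurve u v (f j)‖ ≤ δ')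
    (hδ : δ' + ε ≤ δ)
    (hu : ‖u' - edgeCurve u v (f m)‖ ≤ ε) (hv : ‖v' - edgeCurve u v (f e)‖ ≤ ε) :
    MonotonePath p u' v' δ m e 1 := by
  have hme : f m ≤ f e := hf e m le_rfl hem.le le_rfl
  have hclose : ∀ (x y z : EuclideanSpace ℝ (Fin d)), ‖x - y‖ ≤ δ' → ‖z - y‖ ≤ ε → ‖x - z‖ ≤ δ := by
    intro x y z h1 h2
    calc ‖x - z‖ = ‖(x - y) - (z - y)‖ := by abel_nf
      _ ≤ δ := ((norm_sub_le _ _).trans (add_le_add h1 h2)).trans hδ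
  have h0 : ∀ j, e ≤ j → j ≤ m → 0 ≤ (f j - f m) / (f e - f m) := fun j h1 h2 =>
    div_nonneg (sub_nonneg.2 (hf j m h1 h2 le_rfl)) (sub_nonneg.2 hme)
  have h1 : ∀ j, e ≤ j → j ≤ m → (f j - f m) / (f e - f m) ≤ 1 := fun j h1 h2 =>
    div_le_one_of_le₀ (sub_le_sub_right (hf e j le_rfl h1 h2) _) (sub_nonneg.2 hme)
  refine MonotonePath.of_nonneg (g := fun j => (f j - f m) / (f e - f m)) hem h0 h1 ?_ ?_ ?_ ?_
  · intro i j hi hij hj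
    exact div_le_div_of_nonneg_right (sub_le_sub_right (hf i j hi hij hj) _) (sub_nonneg.2 hme)
  · intro j hj hj'
    refine hclose _ _ _ (hp j hj hj') ?_
    have h2 : f j = f m + (f j - f m) / (f e - f m) * (f e - f m) := by
      rcases eq_or_ne (f e - f m) 0 with h | h
      · have := hf j m hj hj' le_rfl
        have := hf e j le_rfl hj hj'
        rw [h]
        linarith
      · rw [div_mul_cancel₀ _ h]
        ring
    have h3 : edgeCurve u v (f j) = edgeCurve (edgeCurve u v (f m)) (edgeCurve u v (f e))
        ((f j - f m) / (f e - f m)) := by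
      rw [edgeCurve_reparam, ← h2]
    rw [h3]
    exact norm_edgeCurve_sub_edgeCurve_le hu hv (h0 j hj hj') (h1 j hj hj')
  · exact hclose _ _ _ (hp m hem.le le_rfl) hu
  · exact hclose _ _ _ (hp e le_rfl hem.le) hv

/-- A finite net of rational vectors for a ball, with `0` as first element. -/
theorem exists_rational_net (d : ℕ) (R ε : ℝ) (hR : 0 ≤ R) (hε : 0 < ε) :
    ∃ (N : ℕ) (z : ℕ → Fin d → ℚ), 0 < N ∧ z 0 = 0 ∧
      (∀ k, ‖(WithLp.toLp 2 fun i => (z k i : ℝ) : EuclideanSpace ℝ (Fin d))‖ ≤ R + ε) ∧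
      ∀ x : EuclideanSpace ℝ (Fin d), ‖x‖ ≤ R →
        ∃ k < N, ‖(WithLp.toLp 2 fun i => (z k i : ℝ) : EuclideanSpace ℝ (Fin d)) - x‖ ≤ ε := by
  have hd : DenseRange fun q : Fin d → ℚ =>
      (WithLp.toLp 2 fun i => (q i : ℝ) : EuclideanSpace ℝ (Fin d)) := by
    have h1 : DenseRange (Pi.map fun (_ : Fin d) (q : ℚ) => (q : ℝ)) :=
      DenseRange.piMap fun _ => Rat.denseRange_cast
    exact (WithLp.toLp_surjective 2).denseRange.comp h1
      (PiLp.continuous_toLp 2 (fun _ : Fin d => ℝ))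
  have hc : IsCompact (Metric.closedBall (0 : EuclideanSpace ℝ (Fin d)) R) :=
    isCompact_closedBall _ _
  obtain ⟨t, ht⟩ := hc.elim_finite_subcover
    (fun q : {q : Fin d → ℚ // ‖(WithLp.toLp 2 fun i => (q i : ℝ) :
      EuclideanSpace ℝ (Fin d))‖ ≤ R + ε} =>
      Metric.ball (WithLp.toLp 2 fun i => (q.1 i : ℝ) : EuclideanSpace ℝ (Fin d)) ε)
    (fun _ => Metric.isOpen_ball) (by
      intro x hx
      obtain ⟨q, hq⟩ := hd.exists_dist_lt x hε
      have hx' : ‖x‖ ≤ R := by simpa using hx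
      rw [dist_comm, dist_eq_norm] at hq
      refine Set.mem_iUnion.2 ⟨⟨q, ?_⟩, ?_⟩
      · have := norm_add_le x ((WithLp.toLp 2 fun i => (q i : ℝ) : EuclideanSpace ℝ (Fin d)) - x)
        rw [add_sub_cancel] at this
        linarith
      · rw [Metric.mem_ball, dist_comm, dist_eq_norm]
        exact hq)
  set l : List (Fin d → ℚ) := 0 :: t.toList.map Subtype.val with hl
  refine ⟨l.length, fun k => l.getD k 0, by simp [hl], by simp [hl], ?_, ?_⟩
  · intro k
    have h0 : ‖(WithLp.toLp 2 fun i => (((0 : Fin d → ℚ) i : ℚ) : ℝ) : EuclideanSpace ℝ (Fin d))‖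
        ≤ R + ε := by
      have : (WithLp.toLp 2 fun i => (((0 : Fin d → ℚ) i : ℚ) : ℝ) :
          EuclideanSpace ℝ (Fin d)) = 0 := by
        ext i
        simp
      rw [this, norm_zero]
      positivity
    by_cases hk : k < l.length
    · have h1 : l.getD k 0 ∈ l := by
        rw [List.getD_eq_getElem l 0 hk]
        exact List.getElem_mem hk
      rw [hl, List.mem_cons, List.mem_map] at h1
      rcases h1 with h1 | ⟨q, -, h1⟩
      · simp only
        rw [h1]
        exact h0
      · simp only
        rw [hl, ← h1]
        exact q.2
    · simp only
      rw [List.getD_eq_default l 0 (not_lt.1 hk)]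
      exact h0
  · intro x hx
    obtain ⟨q, hq, hqx⟩ := Set.mem_iUnion₂.1 (ht (by simpa using hx : x ∈ Metric.closedBall 0 R))
    have h1 : q.1 ∈ l := List.mem_cons_of_mem _ (List.mem_map_of_mem (Finset.mem_toList.2 hq))
    obtain ⟨k, hk, hkq⟩ := List.getElem_of_mem h1
    refine ⟨k, hk, ?_⟩
    simp only
    rw [List.getD_eq_getElem l 0 hk, hkq]
    rw [Metric.mem_ball, dist_comm, dist_eq_norm] at hqx
    exact hqx.le

end Geometry

/-! ### Monotone paths and the Fréchet distance -/

section Frechet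

variable {d n : ℕ}

/-- The parameter of the `j`-th vertex, for a natural number `j`. -/
noncomputable def PolygonalCurve.time (P : PolygonalCurve d n) (j : ℕ) : ℝ :=
  if h : j < n then P.param ⟨j, h⟩ else 1

/-- The `j`-th vertex, for a natural number `j`. -/
noncomputable def PolygonalCurve.point (P : PolygonalCurve d n) (j : ℕ) :
    EuclideanSpace ℝ (Fin d) :=
  P.toFun (P.time j)

theorem PolygonalCurve.time_val (P : PolygonalCurve d n) (i : Fin n) : P.time i = P.param i := by
  simp [PolygonalCurve.time]

theorem PolygonalCurve.point_val (P : PolygonalCurve d n) (i : Fin n) : P.point i = P.vertex i := by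
  simp [PolygonalCurve.point, PolygonalCurve.vertex, PolygonalCurve.time_val]

theorem PolygonalCurve.time_lt_time (P : PolygonalCurve d n) {i j : ℕ} (hij : i < j) (hj : j < n) :
    P.time i < P.time j := by
  rw [PolygonalCurve.time, PolygonalCurve.time, dif_pos hj, dif_pos (hij.trans hj)]
  exact P.strictMono_param hij

theorem PolygonalCurve.time_le_time (P : PolygonalCurve d n) {i j : ℕ} (hij : i ≤ j) (hj : j < n) :
    P.time i ≤ P.time j := by
  rcases hij.eq_or_lt with rfl | h
  · exact le_rfl
  · exact (P.time_lt_time h hj).le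

theorem PolygonalCurve.time_zero (P : PolygonalCurve d n) : P.time 0 = 0 := by
  have := P.two_le
  rw [PolygonalCurve.time, dif_pos (by omega)]
  exact P.param_first

theorem PolygonalCurve.time_last (P : PolygonalCurve d n) : P.time (n - 1) = 1 := by
  have := P.two_le
  rw [PolygonalCurve.time, dif_pos (by omega)]
  exact P.param_last

theorem PolygonalCurve.toFun_eq_edgeCurve (P : PolygonalCurve d n) {i : ℕ} (hi : i + 1 < n) {t : ℝ}
    (h0 : P.time i ≤ t) (h1 : t ≤ P.time (i + 1)) :
    P.toFun t = edgeCurve (P.point i) (P.point (i + 1))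
      ((t - P.time i) / (P.time (i + 1) - P.time i)) := by
  simp only [PolygonalCurve.point, PolygonalCurve.time, dif_pos hi,
    dif_pos (show i < n by omega)] at h0 h1 ⊢
  exact P.interp i hi t ⟨h0, h1⟩

theorem PolygonalCurve.exists_edge (P : PolygonalCurve d n) {a c : ℕ} (hac : a < c) {t : ℝ}
    (h0 : P.time a ≤ t) (h1 : t ≤ P.time c) :
    ∃ i, a ≤ i ∧ i < c ∧ P.time i ≤ t ∧ t ≤ P.time (i + 1) := by
  induction c, hac using Nat.le_induction with
  | base => exact ⟨a, le_rfl, by omega, h0, h1⟩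
  | succ c hac ih =>
    rcases le_total t (P.time c) with h | h
    · obtain ⟨i, hi, hi', h2⟩ := ih h
      exact ⟨i, hi, by omega, h2⟩
    · exact ⟨c, by omega, by omega, h, h1⟩

theorem subcurve_time_mem {a c x : ℝ} (hac : a ≤ c) (h0 : 0 ≤ x) (h1 : x ≤ 1) :
    a ≤ (1 - x) * a + x * c ∧ (1 - x) * a + x * c ≤ c := by
  constructor <;> nlinarith

theorem div_time_mem (P : PolygonalCurve d n) {i : ℕ} (hi : i + 1 < n) {t : ℝ}
    (h0 : P.time i ≤ t) (h1 : t ≤ P.time (i + 1)) :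
    0 ≤ (t - P.time i) / (P.time (i + 1) - P.time i) ∧
      (t - P.time i) / (P.time (i + 1) - P.time i) ≤ 1 := by
  have := P.time_lt_time (Nat.lt_succ_self i) hi
  exact ⟨div_nonneg (by linarith) (by linarith), div_le_one_of_le₀ (by linarith) (by linarith)⟩

theorem surjective_of_continuous_of_endpoints {g : unitInterval → unitInterval} (hg : Continuous g)
    (h0 : g 0 = 0) (h1 : g 1 = 1) : Function.Surjective g := by
  intro y
  have := intermediate_value_univ (0 : unitInterval) 1 hg
  rw [h0, h1] at this
  exact this ⟨unitInterval.nonneg', unitInterval.le_one'⟩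

/-- A traversal that runs through the first curve at unit speed. -/
noncomputable def Traversal.ofRight (g : unitInterval → unitInterval) (hm : Monotone g)
    (hc : Continuous g) (h0 : g 0 = 0) (h1 : g 1 = 1) : Traversal where
  left := id
  right := g
  monotone_left := monotone_id
  monotone_right := hm
  surjective_left := Function.surjective_id
  surjective_right := surjective_of_continuous_of_endpoints hc h0 h1
  continuous_left := continuous_id
  continuous_right := hc

theorem frechetDist_le_of_right {X Y : ℝ → EuclideanSpace ℝ (Fin d)} {δ : ℝ}
    (g : unitInterval → unitInterval) (hm : Monotone g) (hc : Continuous g) (h0 : g 0 = 0)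
    (h1 : g 1 = 1) (h : ∀ t : unitInterval, ‖X t - Y (g t)‖ ≤ δ) :
    frechetDist X Y ≤ ENNReal.ofReal δ := by
  refine iInf_le_of_le (Traversal.ofRight g hm hc h0 h1) (iSup_le fun t => ?_)
  rw [edist_dist, dist_eq_norm]
  exact ENNReal.ofReal_le_ofReal (h t)

/-- The piecewise linear function with the values `f j` at the vertex parameters between the
`a`-th and the `c`-th, up to an additive constant. -/
noncomputable def PolygonalCurve.interpolate (P : PolygonalCurve d n) (f : ℕ → ℝ) (a c : ℕ)
    (t : ℝ) : ℝ :=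
  ∑ j ∈ Finset.Ico a c,
    (f (j + 1) - f j) * max 0 (min 1 ((t - P.time j) / (P.time (j + 1) - P.time j)))

theorem PolygonalCurve.continuous_interpolate (P : PolygonalCurve d n) (f : ℕ → ℝ) (a c : ℕ) :
    Continuous (P.interpolate f a c) := by
  unfold PolygonalCurve.interpolate
  fun_prop

theorem PolygonalCurve.monotone_interpolate (P : PolygonalCurve d n) {f : ℕ → ℝ} {a c : ℕ}
    (hc : c < n) (hf : ∀ j, a ≤ j → j < c → f j ≤ f (j + 1)) :
    Monotone (P.interpolate f a c) := by
  intro x y hxy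
  refine Finset.sum_le_sum fun j hj => ?_
  rw [Finset.mem_Ico] at hj
  have := P.time_lt_time (Nat.lt_succ_self j) (by omega : j + 1 < n)
  refine mul_le_mul_of_nonneg_left (max_le_max le_rfl (min_le_min le_rfl ?_))
    (sub_nonneg.2 (hf j hj.1 hj.2))
  exact div_le_div_of_nonneg_right (by linarith) (by linarith)

theorem PolygonalCurve.interpolate_eq (P : PolygonalCurve d n) (f : ℕ → ℝ) {a c i : ℕ}
    (hc : c < n) (hai : a ≤ i) (hic : i < c) {t : ℝ} (h0 : P.time i ≤ t)
    (h1 : t ≤ P.time (i + 1)) :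
    P.interpolate f a c t =
      f i - f a + (t - P.time i) / (P.time (i + 1) - P.time i) * (f (i + 1) - f i) := by
  have h2 := div_time_mem P (by omega : i + 1 < n) h0 h1
  unfold PolygonalCurve.interpolate
  rw [← Finset.sum_Ico_consecutive _ hai hic.le, Finset.sum_eq_sum_Ico_succ_bot hic]
  have hL : ∑ j ∈ Finset.Ico a i,
      (f (j + 1) - f j) * max 0 (min 1 ((t - P.time j) / (P.time (j + 1) - P.time j))) =
      ∑ j ∈ Finset.Ico a i, (f (j + 1) - f j) := by
    refine Finset.sum_congr rfl fun j hj => ?_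
    rw [Finset.mem_Ico] at hj
    have h3 := P.time_lt_time (Nat.lt_succ_self j) (by omega : j + 1 < n)
    have h4 := P.time_le_time (show j + 1 ≤ i by omega) (by omega)
    rw [min_eq_left ((one_le_div (by linarith)).2 (by linarith)), max_eq_right zero_le_one, mul_one]
  have hR : ∑ j ∈ Finset.Ico (i + 1) c,
      (f (j + 1) - f j) * max 0 (min 1 ((t - P.time j) / (P.time (j + 1) - P.time j))) = 0 := by
    refine Finset.sum_eq_zero fun j hj => ?_
    rw [Finset.mem_Ico] at hj
    have h3 := P.time_lt_time (Nat.lt_succ_self j) (by omega : j + 1 < n)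
    have h4 := P.time_le_time (show i + 1 ≤ j by omega) (by omega)
    rw [max_eq_left (min_le_of_right_le
      (div_nonpos_of_nonpos_of_nonneg (by linarith) (by linarith))), mul_zero]
  rw [hL, hR, Finset.sum_Ico_sub f hai, min_eq_right h2.2, max_eq_right h2.1]
  ring

/-- Matching the vertices of a subcurve monotonically to points of a segment bounds the Fréchet
distance: between vertices, both curves are linear. -/
theorem frechetDist_le_of_monotone (P : PolygonalCurve d n) {u v : EuclideanSpace ℝ (Fin d)}
    {a c : ℕ} {δ : ℝ} (hac : a < c) (hc : c < n) (f : ℕ → ℝ)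
    (hf : ∀ i j, a ≤ i → i ≤ j → j ≤ c → f i ≤ f j) (ha : f a = 0) (hc1 : f c = 1)
    (hp : ∀ j, a ≤ j → j ≤ c → ‖P.point j - edgeCurve u v (f j)‖ ≤ δ) :
    frechetDist (P.subcurve (P.time a) (P.time c)) (edgeCurve u v) ≤ ENNReal.ofReal δ := by
  have htime := P.time_lt_time hac hc
  let τ : unitInterval → ℝ := fun x => (1 - (x : ℝ)) * P.time a + x * P.time c
  have hτc : Continuous τ := by
    unfold τ
    fun_prop
  have hτm : Monotone τ := by
    intro x y hxy
    have : (x : ℝ) ≤ y := hxy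
    simp only [τ]
    nlinarith
  have hstep : ∀ j, a ≤ j → j < c → f j ≤ f (j + 1) := fun j h1 h2 => hf j (j + 1) h1 (by omega) h2
  have hmono := P.monotone_interpolate hc hstep
  have h0 : P.interpolate f a c (P.time a) = 0 := by
    rw [P.interpolate_eq f hc le_rfl hac le_rfl (P.time_le_time (by omega) (by omega))]
    simp
  have h1 : P.interpolate f a c (P.time c) = 1 := by
    obtain ⟨b, rfl⟩ : ∃ b, c = b + 1 := ⟨c - 1, by omega⟩
    have h2 := P.time_lt_time (Nat.lt_succ_self b) hc
    rw [P.interpolate_eq f hc (i := b) (by omega) (by omega) h2.le le_rfl,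
      div_self (by linarith), ha, hc1]
    ring
  refine frechetDist_le_of_right
    (fun x => Set.projIcc 0 1 zero_le_one (P.interpolate f a c (τ x)))
    ((Set.monotone_projIcc _).comp (hmono.comp hτm))
    (continuous_projIcc.comp ((P.continuous_interpolate f a c).comp hτc)) ?_ ?_ ?_
  · simp only [τ, Set.Icc.coe_zero, sub_zero, one_mul, zero_mul, add_zero, h0]
    exact Set.projIcc_left _
  · simp only [τ, Set.Icc.coe_one, sub_self, one_mul, zero_mul, zero_add, h1]
    exact Set.projIcc_right _
  · intro x
    obtain ⟨hx0, hx1⟩ := subcurve_time_mem htime.le x.2.1 x.2.2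
    have hmem : P.interpolate f a c (τ x) ∈ Set.Icc (0 : ℝ) 1 :=
      ⟨h0 ▸ hmono hx0, h1 ▸ hmono hx1⟩
    simp only [Set.projIcc_of_mem _ hmem]
    obtain ⟨i, hai, hic, hi0, hi1⟩ := P.exists_edge hac hx0 hx1
    obtain ⟨hl0, hl1⟩ := div_time_mem P (by omega : i + 1 < n) hi0 hi1
    change ‖P.toFun (τ x) - edgeCurve u v (P.interpolate f a c (τ x))‖ ≤ δ
    rw [P.toFun_eq_edgeCurve (by omega) hi0 hi1, P.interpolate_eq f hc hai hic hi0 hi1, ha,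
      sub_zero, ← edgeCurve_reparam]
    exact norm_edgeCurve_sub_edgeCurve_le (hp i hai hic.le) (hp (i + 1) (by omega) hic) hl0 hl1

/-- A subcurve all of whose vertices are close to a point is close to that point. -/
theorem frechetDist_const_le (P : PolygonalCurve d n) {x : EuclideanSpace ℝ (Fin d)} {a c : ℕ}
    {δ : ℝ} (hac : a ≤ c) (hc : c < n) (hp : ∀ j, a ≤ j → j ≤ c → ‖P.point j - x‖ ≤ δ) :
    frechetDist (P.subcurve (P.time a) (P.time c)) (edgeCurve x x) ≤ ENNReal.ofReal δ := by
  refine frechetDist_le_of_right id monotone_id continuous_id rfl rfl fun t => ?_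
  obtain ⟨hx0, hx1⟩ := subcurve_time_mem (P.time_le_time hac hc) t.2.1 t.2.2
  rw [id, edgeCurve_self]
  change ‖P.toFun _ - x‖ ≤ δ
  rcases hac.eq_or_lt with rfl | hac
  · rw [le_antisymm hx1 hx0]
    exact hp a le_rfl le_rfl
  · obtain ⟨i, hai, hic, hi0, hi1⟩ := P.exists_edge hac hx0 hx1
    obtain ⟨hl0, hl1⟩ := div_time_mem P (by omega : i + 1 < n) hi0 hi1
    rw [P.toFun_eq_edgeCurve (by omega) hi0 hi1, ← edgeCurve_self x
      ((_ - P.time i) / (P.time (i + 1) - P.time i))]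
    exact norm_edgeCurve_sub_edgeCurve_le (hp i hai hic.le) (hp (i + 1) (by omega) hic) hl0 hl1

theorem frechetDist_le_of_monotonePath (P : PolygonalCurve d n) {a c : ℕ} {δ : ℝ} (hac : a < c)
    (hc : c < n) (h : MonotonePath P.point (P.point c) (P.point a) δ c a 1) :
    frechetDist (P.subcurve (P.time a) (P.time c)) (edgeCurve (P.point a) (P.point c)) ≤
      ENNReal.ofReal δ := by
  obtain ⟨f, f0, f1, f2, f3⟩ := h
  refine frechetDist_le_of_monotone P hac hc (fun j => 1 - f j) ?_ ?_ ?_ ?_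
  · intro i j h1 h2 h3
    linarith [f2 i j h1 h2 h3]
  · simp [f1]
  · simp [f0]
  · intro j h1 h2
    rw [edgeCurve_swap]
    exact f3 j h1 h2

/-- A traversal of a subcurve and a segment matches the vertices monotonically. -/
theorem monotonePath_of_frechetDist_lt (P : PolygonalCurve d n) {a c : ℕ} {δ : ℝ} (hac : a < c)
    (hc : c < n)
    (h : frechetDist (P.subcurve (P.time a) (P.time c)) (edgeCurve (P.point a) (P.point c)) <
      ENNReal.ofReal δ) :
    MonotonePath P.point (P.point c) (P.point a) δ c a 1 := by
  obtain ⟨τ, hτ⟩ := iInf_lt_iff.1 h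
  have hδ : 0 < δ := ENNReal.ofReal_pos.1 (lt_of_le_of_lt bot_le h)
  have htime := P.time_lt_time hac hc
  have hclose : ∀ t : unitInterval, ‖P.toFun ((1 - (τ.left t : ℝ)) * P.time a +
      (τ.left t : ℝ) * P.time c) - edgeCurve (P.point a) (P.point c) (τ.right t)‖ ≤ δ := by
    intro t
    have h1 := (le_iSup (fun t : unitInterval => edist (P.subcurve (P.time a) (P.time c) (τ.left t))
      (edgeCurve (P.point a) (P.point c) (τ.right t))) t).trans hτ.le
    rw [edist_dist, dist_eq_norm] at h1
    exact (ENNReal.ofReal_le_ofReal_iff hδ.le).1 h1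
  have hex : ∀ j, ∃ t : unitInterval, a ≤ j → j ≤ c →
      (1 - (τ.left t : ℝ)) * P.time a + (τ.left t : ℝ) * P.time c = P.time j := by
    intro j
    by_cases hj : a ≤ j ∧ j ≤ c
    · have h1 := P.time_le_time hj.1 (by omega : j < n)
      have h2 := P.time_le_time hj.2 hc
      obtain ⟨t, ht⟩ := τ.surjective_left ⟨(P.time j - P.time a) / (P.time c - P.time a),
        div_nonneg (by linarith) (by linarith), div_le_one_of_le₀ (by linarith) (by linarith)⟩
      refine ⟨t, fun _ _ => ?_⟩
      rw [ht]
      have : P.time c - P.time a ≠ 0 := by linarith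
      field_simp
      ring
    · exact ⟨0, fun h1 h2 => absurd ⟨h1, h2⟩ hj⟩
  choose t ht using hex
  have htm : ∀ i j, a ≤ i → i ≤ j → j ≤ c → (τ.right (t i) : ℝ) ≤ τ.right (t j) := by
    intro i j hi hij hj
    rcases hij.eq_or_lt with rfl | hij
    · exact le_rfl
    · refine τ.monotone_right (le_of_lt (lt_of_not_ge fun hle => ?_))
      have h1 : (τ.left (t j) : ℝ) ≤ τ.left (t i) := τ.monotone_left hle
      have h2 := P.time_lt_time hij (by omega)
      rw [← ht i hi (by omega), ← ht j (by omega) hj] at h2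
      nlinarith
  refine MonotonePath.of_nonneg (g := fun j => 1 - (τ.right (t j) : ℝ)) hac ?_ ?_ ?_ ?_ ?_ ?_
  · intro j _ _
    exact sub_nonneg.2 (τ.right (t j)).2.2
  · intro j _ _
    linarith [(τ.right (t j)).2.1]
  · intro i j h1 h2 h3
    linarith [htm i j h1 h2 h3]
  · intro j h1 h2
    rw [edgeCurve_swap]
    have := hclose (t j)
    rwa [ht j h1 h2] at this
  · rw [sub_self, norm_zero]
    exact hδ.le
  · rw [sub_self, norm_zero]
    exact hδ.le

end Frechet

/-! ### Fenwick walks -/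

/-- The largest power of two that divides a positive number. -/
def lowBit (m : ℕ) : ℕ := 2 ^ padicValNat 2 m

theorem lowBit_pos (m : ℕ) : 0 < lowBit m := by
  unfold lowBit
  positivity

theorem lowBit_le {m : ℕ} (hm : 0 < m) : lowBit m ≤ m :=
  Nat.le_of_dvd hm pow_padicValNat_dvd

theorem lowBit_two_mul {m : ℕ} (hm : 0 < m) : lowBit (2 * m) = 2 * lowBit m := by
  unfold lowBit
  rw [padicValNat.mul (by norm_num) (by omega), padicValNat.self (by norm_num), pow_add, pow_one]

theorem lowBit_two_mul_add_one (m : ℕ) : lowBit (2 * m + 1) = 1 := by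
  unfold lowBit
  rw [padicValNat.eq_zero_of_not_dvd (by omega), pow_zero]

theorem sum_lowBit_two_mul (k : ℕ) :
    ∑ m ∈ Finset.Icc 1 (2 * k), lowBit m = k + 2 * ∑ m ∈ Finset.Icc 1 k, lowBit m := by
  induction k with
  | zero => simp
  | succ k ih =>
    rw [show 2 * (k + 1) = 2 * k + 1 + 1 by ring, Finset.sum_Icc_succ_top (by omega),
      Finset.sum_Icc_succ_top (by omega), ih, Finset.sum_Icc_succ_top (by omega),
      lowBit_two_mul_add_one, show 2 * k + 1 + 1 = 2 * (k + 1) by ring, lowBit_two_mul (by omega)]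
    ring

theorem sum_lowBit_le (L n : ℕ) (hn : n < 2 ^ L) :
    ∑ m ∈ Finset.Icc 1 n, lowBit m ≤ n * L := by
  induction L generalizing n with
  | zero =>
    obtain rfl : n = 0 := by simpa using hn
    simp
  | succ L ih =>
    rcases Nat.even_or_odd' n with ⟨k, rfl | rfl⟩
    · have := ih k (by omega)
      rw [sum_lowBit_two_mul]
      nlinarith
    · have := ih k (by omega)
      rw [Finset.sum_Icc_succ_top (by omega), sum_lowBit_two_mul, lowBit_two_mul_add_one]
      nlinarith

theorem lowBit_two_pow_mul_odd (i q : ℕ) : lowBit (2 ^ i * (2 * q + 1)) = 2 ^ i := by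
  induction i with
  | zero => simp [lowBit_two_mul_add_one]
  | succ i ih =>
    rw [pow_succ', mul_assoc, lowBit_two_mul (by positivity), ih]

theorem le_lowBit {i m : ℕ} (hm : 0 < m) (h : 2 ^ i ∣ m) : 2 ^ i ≤ lowBit m :=
  Nat.pow_le_pow_right (by norm_num) ((padicValNat_dvd_iff_le hm.ne').1 h)

/-- The number of steps of the walk from `c` down to `a` that goes from `c` to `c - lowBit c` if
this is not below `a`, and to `c - 1` otherwise. -/
def walkLength (a c : ℕ) : ℕ :=
  if h : a < c then
    walkLength a (if a + lowBit c ≤ c then c - lowBit c else c - 1) + 1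
  else 0
termination_by c
decreasing_by
  have := lowBit_pos c
  split_ifs <;> omega

theorem walkLength_self (a : ℕ) : walkLength a a = 0 := by
  rw [walkLength, dif_neg (lt_irrefl a)]

theorem walkLength_of_jump {a c : ℕ} (h : a < c) (hj : a + lowBit c ≤ c) :
    walkLength a c = walkLength a (c - lowBit c) + 1 := by
  rw [walkLength, dif_pos h, if_pos hj]

theorem walkLength_of_not_jump {a c : ℕ} (h : a < c) (hj : ¬ a + lowBit c ≤ c) :
    walkLength a c = walkLength a (c - 1) + 1 := by
  rw [walkLength, dif_pos h, if_neg hj]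

/-- Down to the multiple `x` of `2 ^ i`, the walk removes the binary digits one by one. -/
theorem walkLength_strip {a x : ℕ} (i c : ℕ) (hx : 2 ^ i ∣ x) (ha : a ≤ x) (h0 : x ≤ c)
    (h1 : c < x + 2 ^ i) : walkLength a c ≤ i + walkLength a x := by
  induction i generalizing x c with
  | zero =>
    obtain rfl : c = x := by simp only [pow_zero] at h1; omega
    omega
  | succ i ih =>
    have hd : 2 ^ i ∣ x := (pow_dvd_pow 2 (by omega)).trans hx
    have hpow : 2 ^ (i + 1) = 2 ^ i + 2 ^ i := by rw [pow_succ]; omega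
    by_cases hc : c < x + 2 ^ i
    · have := ih c hd ha h0 hc
      omega
    · have h2 := ih (x := x + 2 ^ i) c (hd.add (dvd_refl _)) (by omega) (by omega) (by omega)
      have h4 : lowBit (x + 2 ^ i) = 2 ^ i := by
        obtain ⟨q, rfl⟩ := hx
        rw [show 2 ^ (i + 1) * q + 2 ^ i = 2 ^ i * (2 * q + 1) by ring, lowBit_two_pow_mul_odd]
      have h5 : 0 < 2 ^ i := by positivity
      have h6 := walkLength_of_jump (a := a) (c := x + 2 ^ i) (by omega) (by omega)
      rw [h4, Nat.add_sub_cancel] at h6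
      omega

/-- In a dyadic block of length `2 ^ i`, the walk either stays in one half or reaches the middle
within `i` steps. -/
theorem walkLength_le_of_block {a x : ℕ} (i c : ℕ) (hx : 2 ^ i ∣ x) (ha : x ≤ a) (hac : a ≤ c)
    (h1 : c ≤ x + 2 ^ i) : walkLength a c ≤ i * i + 1 := by
  induction i generalizing x c with
  | zero =>
    rcases hac.eq_or_lt with rfl | h
    · rw [walkLength_self]
      omega
    · rw [pow_zero] at h1
      obtain rfl : c = a + 1 := by omega
      have := lowBit_pos (a + 1)
      by_cases hj : a + lowBit (a + 1) ≤ a + 1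
      · rw [walkLength_of_jump h hj, show a + 1 - lowBit (a + 1) = a by omega, walkLength_self]
      · rw [walkLength_of_not_jump h hj, Nat.add_sub_cancel, walkLength_self]
  | succ i ih =>
    have hd : 2 ^ i ∣ x := (pow_dvd_pow 2 (by omega)).trans hx
    have hd' : 2 ^ i ∣ x + 2 ^ i := hd.add (dvd_refl _)
    have hpow : 2 ^ (i + 1) = 2 ^ i + 2 ^ i := by rw [pow_succ]; omega
    have hsq : (i + 1) * (i + 1) = i * i + 2 * i + 1 := by ring
    have inner : ∀ c, a ≤ c → c < x + 2 ^ (i + 1) → walkLength a c ≤ i + (i * i + 1) := by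
      intro c hac h1
      by_cases h2 : c ≤ x + 2 ^ i
      · have := ih c hd ha hac h2
        omega
      · by_cases h3 : x + 2 ^ i ≤ a
        · have := ih c hd' h3 hac (by omega)
          omega
        · have h4 := ih (x + 2 ^ i) hd ha (by omega) le_rfl
          have h5 := walkLength_strip (a := a) i c hd' (by omega) (by omega) (by omega)
          omega
    rcases h1.eq_or_lt with h | h
    · rcases hac.eq_or_lt with h2 | h2
      · rw [h2, walkLength_self]
        omega
      · have h3 := le_lowBit (by omega) (h ▸ hx.add (dvd_refl _) : 2 ^ (i + 1) ∣ c)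
        by_cases hj : a + lowBit c ≤ c
        · rw [walkLength_of_jump h2 hj, show c - lowBit c = a by omega, walkLength_self]
          omega
        · have := inner (c - 1) (by omega) (by omega)
          rw [walkLength_of_not_jump h2 hj]
          omega
    · have := inner c hac h
      omega

theorem walkLength_le {L a c : ℕ} (hac : a ≤ c) (hc : c ≤ 2 ^ L) : walkLength a c ≤ L * L + 1 :=
  walkLength_le_of_block (x := 0) L c (dvd_zero _) (Nat.zero_le _) hac (by omega)

/-! ### The approximate test for an edge -/

section EdgeTest

variable {d : ℕ}

/-- The property of the vectors `z 0, ..., z (N - 1)` on which the approximate test relies: they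
form a `1/6`-net of the ball of radius `13/6`, none is longer than `13/6 + 1/6 = 7/3`, and the first
is `0`. -/
structure IsGoodNet (N : ℕ) (z : ℕ → EuclideanSpace ℝ (Fin d)) : Prop where
  pos : 0 < N
  zero : z 0 = 0
  norm_le : ∀ k, ‖z k‖ ≤ 7 / 3
  exists_near : ∀ x : EuclideanSpace ℝ (Fin d), ‖x‖ ≤ 13 / 6 → ∃ k < N, ‖z k - x‖ ≤ 1 / 6

/-- The state of the dynamic program for the edge from `p w` to `p a` at the vertex `c`. The
number `g k` is a lower bound for the parameters at which the vertex `c` can be matched to a point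
near the net point `p c + Δ • z k`, and it is itself such a parameter, for a slightly larger
distance, if it is at most `1`. -/
structure IsReachable (p : ℕ → EuclideanSpace ℝ (Fin d)) (z : ℕ → EuclideanSpace ℝ (Fin d))
    (N : ℕ) (Δ : ℝ) (a w c : ℕ) (g : ℕ → ℝ) : Prop where
  near : ∀ k < N, g k ≤ 1 → ‖p c + Δ • z k - edgeCurve (p w) (p a) (g k)‖ ≤ Δ / 6
  path : ∀ k < N, g k ≤ 1 → MonotonePath p (p w) (p a) (5 / 2 * Δ) w c (g k)
  le : ∀ f : ℕ → ℝ, f w = 0 → f a = 1 → (∀ i j, a ≤ i → i ≤ j → j ≤ w → f j ≤ f i) →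
    (∀ j, a ≤ j → j ≤ w → ‖p j - edgeCurve (p w) (p a) (f j)‖ ≤ 13 / 6 * Δ) →
    ∀ k < N, ‖p c + Δ • z k - edgeCurve (p w) (p a) (f c)‖ ≤ Δ / 6 → g k ≤ f c

variable {p z : ℕ → EuclideanSpace ℝ (Fin d)} {N : ℕ} {Δ : ℝ} {a w c c' : ℕ} {g : ℕ → ℝ}

/-- The initial values of the dynamic program. -/
noncomputable def startParam (z : ℕ → EuclideanSpace ℝ (Fin d)) (k : ℕ) : ℕ :=
  open Classical in if ‖z k‖ ≤ 1 / 6 then 0 else 2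

theorem startParam_of_le_one {k : ℕ} (h : (startParam z k : ℝ) ≤ 1) :
    ‖z k‖ ≤ 1 / 6 ∧ startParam z k = 0 := by
  unfold startParam at h ⊢
  split_ifs at h ⊢ with h1
  · exact ⟨h1, rfl⟩
  · norm_num at h

theorem IsReachable.start (hΔ : 0 < Δ) :
    IsReachable p z N Δ a w w fun k => (startParam z k : ℝ) := by
  have h1 : ∀ k, ‖p w + Δ • z k - p w‖ = Δ * ‖z k‖ := fun k => by
    rw [add_sub_cancel_left, norm_smul, Real.norm_of_nonneg hΔ.le]
  refine ⟨fun k _ h => ?_, fun k _ h => ?_, fun f hf _ _ _ k _ h => ?_⟩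
  · obtain ⟨h2, h3⟩ := startParam_of_le_one h
    simp only [h3, Nat.cast_zero, edgeCurve_zero, h1]
    nlinarith
  · simp only [(startParam_of_le_one h).2, Nat.cast_zero]
    refine MonotonePath.refl ?_
    rw [sub_self, norm_zero]
    positivity
  · rw [hf, edgeCurve_zero, h1] at h
    have h2 : ‖z k‖ ≤ 1 / 6 := by
      by_contra h2
      nlinarith [not_le.1 h2]
    rw [startParam, if_pos h2, hf, Nat.cast_zero]

theorem norm_sub_add_smul_le (hz : IsGoodNet N z) (hΔ : 0 < Δ) (c k : ℕ) :
    ‖p c - (p c + Δ • z k)‖ ≤ 7 / 3 * Δ := by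
  rw [sub_add_cancel_left, norm_neg, norm_smul, Real.norm_of_nonneg hΔ.le]
  nlinarith [hz.norm_le k]

theorem IsGoodNet.exists_near_smul (hz : IsGoodNet N z) (hΔ : 0 < Δ)
    {x y : EuclideanSpace ℝ (Fin d)} (h : ‖x - y‖ ≤ 13 / 6 * Δ) :
    ∃ k < N, ‖x + Δ • z k - y‖ ≤ Δ / 6 := by
  obtain ⟨k, hk, h1⟩ := hz.exists_near (Δ⁻¹ • (y - x)) (by
    rw [norm_smul, Real.norm_of_nonneg (by positivity), norm_sub_rev, inv_mul_le_iff₀ hΔ]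
    linarith)
  refine ⟨k, hk, ?_⟩
  have h2 : x + Δ • z k - y = Δ • (z k - Δ⁻¹ • (y - x)) := by
    rw [smul_sub, smul_inv_smul₀ hΔ.ne']
    abel
  rw [h2, norm_smul, Real.norm_of_nonneg hΔ.le]
  nlinarith

/-- The new value for the net point `y` in a step of the dynamic program, where `t k` tells whether
the step from the `k`-th net point is possible. -/
noncomputable def relax (hN : (Finset.range N).Nonempty) (u v : EuclideanSpace ℝ (Fin d)) (r : ℝ)
    (y : EuclideanSpace ℝ (Fin d)) (t g : ℕ → ℝ) : ℝ :=
  nextParam u v r y ((Finset.range N).inf' hN fun k => if t k ≠ 0 then g k else 2)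

/-- One step of the dynamic program, across the subcurve between the vertices `c'` and `c`. A path
within `7Δ/3` of a segment between two net points is within `5Δ/2` of the edge, and a path within
`13Δ/6` of the edge is within `7Δ/3` of a segment between two net points, since the net points in
question are within `Δ/6` of the edge. -/
theorem IsReachable.step (hz : IsGoodNet N z) (hΔ : 0 < Δ) (h : IsReachable p z N Δ a w c g)
    (hac : a ≤ c') (hcc : c' < c) (hcw : c ≤ w) {t : ℕ → ℕ → ℝ}
    (ht : ∀ k < N, ∀ k' < N, t k' k ≠ 0 ↔
      MonotonePath p (p c + Δ • z k) (p c' + Δ • z k') (7 / 3 * Δ) c c' 1)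
    (hN : (Finset.range N).Nonempty) :
    IsReachable p z N Δ a w c' fun k' =>
      relax hN (p w) (p a) (Δ / 6) (p c' + Δ • z k') (t k') g := by
  have hsound : ∀ k' < N, relax hN (p w) (p a) (Δ / 6) (p c' + Δ • z k') (t k') g ≤ 1 →
      ‖p c' + Δ • z k' - edgeCurve (p w) (p a)
        (relax hN (p w) (p a) (Δ / 6) (p c' + Δ • z k') (t k') g)‖ ≤ Δ / 6 ∧
      MonotonePath p (p w) (p a) (5 / 2 * Δ) w c'
        (relax hN (p w) (p a) (Δ / 6) (p c' + Δ • z k') (t k') g) := by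
    intro k' hk' h1
    obtain ⟨h2, h3⟩ := nextParam_sound (by positivity) h1
    refine ⟨h3, ?_⟩
    obtain ⟨k, hk, h4⟩ := (Finset.inf'_le_iff hN).1 h2
    rw [Finset.mem_range] at hk
    split_ifs at h4 with h5
    · have h6 : g k ≤ 1 := h4.trans h1
      exact (h.path k hk h6).trans (by ring) ((ht k hk k' hk').1 h5) hcw hcc.le h4
        (h.near k hk h6) h3
    · exact absurd (h4.trans h1) (by norm_num)
  refine ⟨fun k' hk' h1 => (hsound k' hk' h1).1, fun k' hk' h1 => (hsound k' hk' h1).2, ?_⟩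
  intro f f0 f1 f2 f3 k' hk' hnear
  obtain ⟨k, hk, h1⟩ := hz.exists_near_smul hΔ (f3 c (by omega) hcw)
  have h2 : t k' k ≠ 0 := (ht k hk k' hk').2
    (MonotonePath.restrict hcc (fun i j hi hij hj => f2 i j (by omega) hij (by omega))
      (fun j hj hj' => f3 j (by omega) (by omega)) (by linarith) h1 hnear)
  refine nextParam_le (by positivity) ?_ ?_ hnear
  · refine (Finset.inf'_le_iff hN).2 ⟨k, Finset.mem_range.2 hk, ?_⟩
    rw [if_pos h2]
    exact (h.le f f0 f1 f2 f3 k hk h1).trans (f2 c' c hac hcc.le hcw)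
  · rw [← f1]
    exact f2 a c' le_rfl hac (by omega)

/-- A positive answer of the test: there is a path within distance `5Δ/2`. -/
theorem IsReachable.monotonePath (hz : IsGoodNet N z) (hΔ : 0 < Δ)
    (h : IsReachable p z N Δ a w a g) (haw : a < w) (hg : g 0 ≤ 1) :
    MonotonePath p (p w) (p a) (5 / 2 * Δ) w a 1 := by
  refine (h.path 0 hz.pos hg).raise haw hg ?_
  rw [edgeCurve_one, sub_self, norm_zero]
  positivity

/-- A negative answer of the test. The bound `13Δ/6` in the dynamic program exceeds `2Δ` because a
traversal with the infimal distance need not exist. -/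
theorem IsReachable.frechetDist_gt {n : ℕ} {P : PolygonalCurve d n} (hz : IsGoodNet N z)
    (hΔ : 0 < Δ) (h : IsReachable P.point z N Δ a w a g) (haw : a < w) (hw : w < n)
    (hg : ¬ g 0 ≤ 1) :
    ENNReal.ofReal (2 * Δ) <
      frechetDist (P.subcurve (P.time a) (P.time w)) (edgeCurve (P.point a) (P.point w)) := by
  by_contra hle
  obtain ⟨f, f0, f1, f2, f3⟩ := monotonePath_of_frechetDist_lt (δ := 13 / 6 * Δ) P haw hw
    ((not_lt.1 hle).trans_lt ((ENNReal.ofReal_lt_ofReal_iff (by positivity)).2 (by linarith)))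
  refine hg (f1 ▸ h.le f f0 f1 f2 f3 0 hz.pos ?_)
  rw [f1, edgeCurve_one, hz.zero, smul_zero, add_zero, sub_self, norm_zero]
  positivity

end EdgeTest

/-! ### The stack -/

section Stack

variable {d n : ℕ}

/-- The invariant of the stack `S 0, ..., S k` after the vertices up to `w`: all conditions on a
good simplification, for the curve that ends at the vertex `w`. -/
structure IsGoodStack (P : PolygonalCurve d n) (Δ : ℝ) (w k : ℕ) (S : ℕ → ℕ) : Prop where
  zero : S 0 = 0
  lt : ∀ j < k, S j < S (j + 1)
  le : S k ≤ w
  no_short_edge : ∀ j < k, Δ / 3 ≤ ‖P.point (S j) - P.point (S (j + 1))‖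
  edge_close : ∀ j < k,
    MonotonePath P.point (P.point (S (j + 1))) (P.point (S j)) (3 * Δ) (S (j + 1)) (S j) 1
  locally_maximal : ∀ j, j + 2 < k + 1 → ENNReal.ofReal (2 * Δ) <
    frechetDist (P.subcurve (P.time (S j)) (P.time (S (j + 2))))
      (edgeCurve (P.point (S j)) (P.point (S (j + 2))))
  end_close : ∀ j, S k ≤ j → j ≤ w → ‖P.point j - P.point (S k)‖ ≤ 3 * Δ

/-- The invariant while the vertex `w` is being processed and the stack is `S 0, ..., S k`: the edge
to `w` from the top of the stack is admissible, unless it is short, and then `w` can be skipped. -/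
structure IsPopping (P : PolygonalCurve d n) (Δ : ℝ) (w k : ℕ) (S : ℕ → ℕ) : Prop where
  zero : S 0 = 0
  lt : ∀ j < k, S j < S (j + 1)
  top_lt : S k < w
  no_short_edge : ∀ j < k, Δ / 3 ≤ ‖P.point (S j) - P.point (S (j + 1))‖
  edge_close : ∀ j < k,
    MonotonePath P.point (P.point (S (j + 1))) (P.point (S j)) (3 * Δ) (S (j + 1)) (S j) 1
  locally_maximal : ∀ j, j + 2 < k + 1 → ENNReal.ofReal (2 * Δ) <
    frechetDist (P.subcurve (P.time (S j)) (P.time (S (j + 2))))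
      (edgeCurve (P.point (S j)) (P.point (S (j + 2))))
  top_close : MonotonePath P.point (P.point w) (P.point (S k)) (3 * Δ) w (S k) 1
  end_close : ‖P.point w - P.point (S k)‖ < Δ / 3 →
    ∀ j, S k ≤ j → j ≤ w → ‖P.point j - P.point (S k)‖ ≤ 3 * Δ

variable {P : PolygonalCurve d n} {Δ : ℝ} {w k : ℕ} {S : ℕ → ℕ}

theorem IsGoodStack.start (hΔ : 0 < Δ) : IsGoodStack P Δ 0 0 fun _ => 0 := by
  refine ⟨rfl, fun j hj => by omega, le_rfl, fun j hj => by omega, fun j hj => by omega,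
    fun j hj => by omega, fun j _ hj => ?_⟩
  obtain rfl : j = 0 := by omega
  rw [sub_self, norm_zero]
  positivity

theorem IsGoodStack.isPopping (h : IsGoodStack P Δ w k S) (hΔ : 0 < Δ) :
    IsPopping P Δ (w + 1) k S := by
  refine ⟨h.zero, h.lt, Nat.lt_succ_of_le h.le, h.no_short_edge, h.edge_close, h.locally_maximal,
    ?_, ?_⟩
  · refine MonotonePath.of_nonneg (g := fun j => if j = w + 1 then 0 else 1)
      (Nat.lt_succ_of_le h.le) ?_ ?_ ?_ ?_ ?_ ?_
    · intro j _ _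
      split_ifs <;> norm_num
    · intro j _ _
      split_ifs <;> norm_num
    · intro i j _ hij hj
      split_ifs <;> first | omega | norm_num
    · intro j hj hj'
      split_ifs with h1
      · rw [h1, edgeCurve_zero, sub_self, norm_zero]
        positivity
      · rw [edgeCurve_one]
        exact h.end_close j hj (by omega)
    · rw [sub_self, norm_zero]
      positivity
    · rw [sub_self, norm_zero]
      positivity
  · intro h1 j hj hj'
    rcases hj'.eq_or_lt with rfl | h2
    · linarith
    · exact h.end_close j hj (by omega)

/-- The top of the stack is popped if the edge from the vertex below it passes the test. -/
theorem IsPopping.pop (h : IsPopping P Δ w (k + 1) S) (hΔ : 0 < Δ)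
    (ht : MonotonePath P.point (P.point w) (P.point (S k)) (5 / 2 * Δ) w (S k) 1) :
    IsPopping P Δ w k S := by
  refine ⟨h.zero, fun j hj => h.lt j (by omega), (h.lt k (by omega)).trans h.top_lt,
    fun j hj => h.no_short_edge j (by omega), fun j hj => h.edge_close j (by omega),
    fun j hj => h.locally_maximal j (by omega), ht.mono (by linarith), ?_⟩
  intro h1 j hj hj'
  obtain ⟨f, f0, f1, f2, f3⟩ := ht
  have h2 : ‖edgeCurve (P.point w) (P.point (S k)) (f j) - P.point (S k)‖ ≤ Δ / 3 := by
    have h0 := norm_edgeCurve_sub_edgeCurve_le (t := f j) h1.le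
      (show ‖P.point (S k) - P.point (S k)‖ ≤ Δ / 3 by
        rw [sub_self, norm_zero]
        positivity) (f0 ▸ f2 j w hj hj' le_rfl) (f1 ▸ f2 (S k) j le_rfl hj hj')
    rwa [edgeCurve_self] at h0
  -- The edge is short, so that all of it is within `Δ / 3` of the top, and `5 / 2 + 1 / 3 ≤ 3`.
  calc _ = ‖(P.point j - edgeCurve (P.point w) (P.point (S k)) (f j)) +
        (edgeCurve (P.point w) (P.point (S k)) (f j) - P.point (S k))‖ := by abel_nf
    _ ≤ 5 / 2 * Δ + Δ / 3 := (norm_add_le _ _).trans (add_le_add (f3 j hj hj') h2)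
    _ ≤ 3 * Δ := by linarith

/-- A vertex within distance `Δ/3` of the top of the stack is skipped. -/
theorem IsPopping.absorb (h : IsPopping P Δ w k S)
    (hw : ‖P.point w - P.point (S k)‖ < Δ / 3) : IsGoodStack P Δ w k S :=
  ⟨h.zero, h.lt, h.top_lt.le, h.no_short_edge, h.edge_close, h.locally_maximal, h.end_close hw⟩

/-- The vertex `w` is pushed once the edge from the vertex below the top is known to be farther than
`2Δ` from its subcurve, or there is no such vertex. -/
theorem IsPopping.push (h : IsPopping P Δ w k S) (hΔ : 0 < Δ)
    (hw : Δ / 3 ≤ ‖P.point w - P.point (S k)‖)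
    (ht : ∀ j, j + 1 = k → ENNReal.ofReal (2 * Δ) <
      frechetDist (P.subcurve (P.time (S j)) (P.time w)) (edgeCurve (P.point (S j)) (P.point w))) :
    IsGoodStack P Δ w (k + 1) (Function.update S (k + 1) w) := by
  have hS : ∀ j, j ≤ k → Function.update S (k + 1) w j = S j := fun j hj =>
    Function.update_of_ne (by omega) _ _
  have hk : Function.update S (k + 1) w (k + 1) = w := Function.update_self _ _ _
  refine ⟨(hS 0 (by omega)).trans h.zero, ?_, hk.le, ?_, ?_, ?_, ?_⟩
  · intro j hj
    rw [hS j (by omega)]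
    rcases (show j ≤ k by omega).eq_or_lt with rfl | h1
    · rw [hk]
      exact h.top_lt
    · rw [hS _ h1]
      exact h.lt j h1
  · intro j hj
    rw [hS j (by omega)]
    rcases (show j ≤ k by omega).eq_or_lt with rfl | h1
    · rw [hk, norm_sub_rev]
      exact hw
    · rw [hS _ h1]
      exact h.no_short_edge j h1
  · intro j hj
    rw [hS j (by omega)]
    rcases (show j ≤ k by omega).eq_or_lt with rfl | h1
    · rw [hk]
      exact h.top_close
    · rw [hS _ h1]
      exact h.edge_close j h1
  · intro j hj
    rw [hS j (by omega)]
    by_cases h1 : j + 1 = k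
    · rw [show j + 2 = k + 1 by omega, hk]
      exact ht j h1
    · rw [hS _ (by omega)]
      exact h.locally_maximal j (by omega)
  · rw [hk]
    intro j hj hj'
    obtain rfl : j = w := by omega
    rw [sub_self, norm_zero]
    positivity

theorem IsGoodStack.strictMonoOn (h : IsGoodStack P Δ w k S) {i j : ℕ} (hij : i < j) (hj : j ≤ k) :
    S i < S j := by
  induction j, hij using Nat.le_induction with
  | base => exact h.lt i hj
  | succ j hij ih => exact (ih (by omega)).trans (h.lt j hj)

theorem IsGoodStack.apply_lt (h : IsGoodStack P Δ (n - 1) k S) (j : Fin (k + 1)) :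
    S j < n := by
  have := P.two_le
  have := h.le
  rcases (show (j : ℕ) ≤ k by omega).eq_or_lt with h1 | h1
  · rw [h1]
    omega
  · have := h.strictMonoOn h1 le_rfl
    omega

/-- After the last vertex, the stack is a good simplification. -/
theorem IsGoodStack.isGoodSimplification (h : IsGoodStack P Δ (n - 1) k S) :
    IsGoodSimplification P Δ fun j : Fin (k + 1) => (⟨S j, h.apply_lt j⟩ : Fin n) := by
  have hv : ∀ j : Fin (k + 1), P.vertex ⟨S j, h.apply_lt j⟩ = P.point (S j) := fun j =>
    (P.point_val _).symm
  have hp : ∀ j : Fin (k + 1), P.param ⟨S j, h.apply_lt j⟩ = P.time (S j) := fun j =>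
    (P.time_val _).symm
  have hn := P.two_le
  refine ⟨?_, ?_, ?_, ?_, ?_, ?_⟩
  · intro i j hij
    exact h.strictMonoOn (Fin.lt_def.1 hij) (by omega)
  · intro j
    rw [hv, hv]
    exact h.no_short_edge j j.2
  · intro j
    rw [hv, hv, hp, hp]
    exact frechetDist_le_of_monotonePath P (h.lt j j.2) (h.apply_lt j.succ) (h.edge_close j j.2)
  · rw [hv, hp]
    simp only [Fin.val_zero, h.zero]
    rw [← P.time_zero]
    refine frechetDist_const_le P le_rfl (by omega) fun j _ hj => ?_
    obtain rfl : j = 0 := by omega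
    have h1 := h.end_close (S k) le_rfl h.le
    rw [sub_self, norm_zero] at h1 ⊢
    exact h1
  · rw [hv, hp, ← P.time_last]
    exact frechetDist_const_le P h.le (by omega) h.end_close
  · intro j hj
    have h1 := h.locally_maximal j hj
    have h2 := hv ⟨j, by omega⟩
    have h3 := hv ⟨j + 2, hj⟩
    have h4 := hp ⟨j, by omega⟩
    have h5 := hp ⟨j + 2, hj⟩
    simp only at h2 h3 h4 h5
    simp only [h2, h3, h4, h5]
    exact h1

end Stack

/-! ### Vectors in registers -/

namespace RealRAM

/-- The program variables. Those with an argument are arrays of registers: points of the curve,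
values of the dynamic programs, and a row of the table. -/
inductive Var
  | n | delta | m | l | j | w | k | a | c | r | out
  | x (i : ℕ) | pa (i : ℕ) | pw (i : ℕ) | bs (i : ℕ) | be (i : ℕ)
  | g (i : ℕ) | h (i : ℕ) | t (i : ℕ) | q (i : ℕ)
  deriving DecidableEq, Encodable

section Vectors

variable {d : ℕ}

/-- The vector whose coordinates are the variables `x 0, ..., x (d - 1)`. -/
def vec (d : ℕ) (x : ℕ → Var) (v : Var → ℝ) : EuclideanSpace ℝ (Fin d) :=
  WithLp.toLp 2 fun i => v (x i)

/-- All coordinates of a vector-valued function are evaluable. -/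
def VecEvaluable (F : (Var → ℝ) → EuclideanSpace ℝ (Fin d)) : Prop :=
  ∀ i, Evaluable fun v => F v i

theorem VecEvaluable.vec (x : ℕ → Var) : VecEvaluable (vec d x) := fun i => Evaluable.var (x i)

theorem VecEvaluable.sub {F G : (Var → ℝ) → EuclideanSpace ℝ (Fin d)} (hF : VecEvaluable F)
    (hG : VecEvaluable G) : VecEvaluable fun v => F v - G v := fun i => (hF i).sub (hG i)

theorem VecEvaluable.norm_sq {F : (Var → ℝ) → EuclideanSpace ℝ (Fin d)} (hF : VecEvaluable F) :
    Evaluable fun v => ‖F v‖ ^ 2 := by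
  simp only [EuclideanSpace.real_norm_sq_eq]
  exact Evaluable.sum _ fun i => (hF i).sq

theorem VecEvaluable.inner {F G : (Var → ℝ) → EuclideanSpace ℝ (Fin d)} (hF : VecEvaluable F)
    (hG : VecEvaluable G) : Evaluable fun v => inner ℝ (F v) (G v) := by
  simp only [PiLp.inner_apply, RCLike.inner_apply, conj_trivial]
  exact Evaluable.sum _ fun i => (hG i).mul (hF i)

/-- The least admissible parameter on a segment is a closed formula with one square root. -/
theorem VecEvaluable.nextParam {u v x : (Var → ℝ) → EuclideanSpace ℝ (Fin d)}
    {r s : (Var → ℝ) → ℝ} (hu : VecEvaluable u) (hv : VecEvaluable v) (hr : Evaluable r)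
    (hx : VecEvaluable x) (hs : Evaluable s) :
    Evaluable fun y => nextParam (u y) (v y) (r y) (x y) (s y) := by
  have hA := (hv.sub hu).norm_sq
  have hB := (hx.sub hu).inner (hv.sub hu)
  have hC := (hx.sub hu).norm_sq.sub hr.sq
  have hD := hB.sq.sub (hA.mul hC)
  have hlo := hs.max ((hB.sub hD.sqrt).div hA)
  exact hA.ite_eq .zero (hC.ite_le .zero (hs.ite_le .one hs .two) .two)
    (hD.ite_lt .zero .two
      (hlo.ite_le ((hB.add hD.sqrt).div hA) (hlo.ite_le .one hlo .two) .two))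

/-- The `k`-th vector of the rational net `z`. -/
noncomputable def netVec (z : ℕ → Fin d → ℚ) (k : ℕ) : EuclideanSpace ℝ (Fin d) :=
  WithLp.toLp 2 fun i => (z k i : ℝ)

theorem VecEvaluable.add_smul {F : (Var → ℝ) → EuclideanSpace ℝ (Fin d)} (hF : VecEvaluable F)
    (z : ℕ → Fin d → ℚ) (k : ℕ) : VecEvaluable fun v => F v + v Var.delta • netVec z k :=
  fun i => (hF i).add ((Evaluable.var Var.delta).mul (Evaluable.ratConst (z k i)))

theorem vec_congr {x : ℕ → Var} {v v' : Var → ℝ} (h : ∀ i, v (x i) = v' (x i)) :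
    vec d x v = vec d x v' := by
  ext i
  exact h i

/-- The memory holds the coordinates of the points `p 0, ..., p (n - 1)`. -/
def HasPoints (n : ℕ) (p : ℕ → EuclideanSpace ℝ (Fin d)) (mem : ℕ → ℝ) : Prop :=
  ∀ i < n, ∀ e : Fin d, mem (i * d + e) = p i e

/-- Loads the point with index `f` into the variables `dst`. -/
noncomputable def loadVec (d : ℕ) (dst : ℕ → Var) (f : (Var → ℝ) → ℝ) (hf : Evaluable f) :
    Program :=
  loadFam d dst (fun v => f v * d) (hf.mul (.natConst d))

theorem Triple.loadVec {s n i : ℕ} {x : Store Var} {Q : Store Var → Prop} {dst : ℕ → Var}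
    {f : (Var → ℝ) → ℝ} {hf : Evaluable f} {p : ℕ → EuclideanSpace ℝ (Fin d)}
    (hp : HasPoints n p x.mem) (hdst : Function.Injective dst) (hi : i < n) (hs : n * d ≤ s)
    (hind : ∀ v : Var → ℝ, (∀ b, (∀ e, b ≠ dst e) → v b = x.var b) → f v = f x.var)
    (hfi : f x.var = i)
    (h : ∀ v : Var → ℝ, (∀ b, (∀ e, b ≠ dst e) → v b = x.var b) → vec d dst v = p i →
      Q ⟨v, x.mem⟩) :
    Triple s (loadVec d dst f hf) x (RealRAM.loadVec d dst f hf).size Q := by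
  refine Triple.loadFam (i * d) (fun k _ g => ?_) ?_ ?_ ?_
  · rw [hind _ fun b hb => updateFam_of_ne hb]
  · simp only [hfi]
    push_cast
    rfl
  · have : (i + 1) * d ≤ n * d := Nat.mul_le_mul_right d hi
    rw [add_mul, one_mul] at this
    omega
  · refine h _ (fun b hb => updateFam_of_ne hb) ?_
    ext e
    simp only [vec, updateFam_apply hdst, e.2, if_true]
    exact hp i hi e

/-- A form of the rule for families of assignments that hides how the new values are stored. -/
theorem Triple.assignFam' {s N : ℕ} {x : Store Var} {Q : Store Var → Prop} {dst : ℕ → Var}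
    {f : ℕ → (Var → ℝ) → ℝ} {hf : ∀ k, Evaluable (f k)} (hdst : Function.Injective dst)
    (hind : ∀ k < N, ∀ v : Var → ℝ, (∀ b, (∀ e, b ≠ dst e) → v b = x.var b) →
      v (dst k) = x.var (dst k) → f k v = f k x.var)
    (h : ∀ v : Var → ℝ, (∀ b, (∀ e, b ≠ dst e) → v b = x.var b) →
      (∀ k < N, v (dst k) = f k x.var) → Q ⟨v, x.mem⟩) :
    Triple s (RealRAM.assignFam N dst f hf) x (RealRAM.assignFam N dst f hf).size Q := by
  refine Triple.assignFam (fun k hk g => ?_) (h _ (fun b hb => updateFam_of_ne hb) ?_)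
  · refine hind k hk _ (fun b hb => updateFam_of_ne hb) ?_
    rw [updateFam_apply hdst, if_neg (lt_irrefl k)]
  · intro k hk
    rw [updateFam_apply hdst, if_pos hk]

/-! ### The powers of two -/

/-- The memory holds the numbers `lowBit j` for `0 < j < M`. -/
def HasLowBits (b M : ℕ) (mem : ℕ → ℝ) : Prop :=
  ∀ j, 0 < j → j < M → mem (b + j) = lowBit j

/-- The address of the number `lowBit j` is `n * d + j`. -/
theorem evaluable_bitAddr (d : ℕ) {f : (Var → ℝ) → ℝ} (hf : Evaluable f) :
    Evaluable fun v => v Var.n * d + f v :=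
  ((Evaluable.var Var.n).mul (.natConst d)).add hf

/-- Computes `lowBit (2 * m)` and `lowBit (2 * m + 1)` from `lowBit m`. -/
noncomputable def lowBitsBody (d : ℕ) : Program :=
  .seq (loadAt Var.l (fun v => v Var.n * d + v Var.m) (evaluable_bitAddr d (.var Var.m)))
  (.seq (storeAt (fun v => v Var.n * d + 2 * v Var.m) (fun v => 2 * v Var.l)
    (evaluable_bitAddr d (Evaluable.two.mul (.var Var.m))) (Evaluable.two.mul (.var Var.l)))
  (.seq (storeAt (fun v => v Var.n * d + (2 * v Var.m + 1)) (fun _ => 1)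
    (evaluable_bitAddr d ((Evaluable.two.mul (.var Var.m)).add .one)) .one)
  (assign Var.m (fun v => v Var.m + 1) ((Evaluable.var Var.m).add .one))))

theorem evaluable_test {f g : (Var → ℝ) → ℝ} (hf : Evaluable f) (hg : Evaluable g) :
    Evaluable fun v => if f v < g v then 1 else 0 :=
  hf.ite_lt hg .one .zero

/-- Computes `lowBit j` for `0 < j < 2 * n`, without integer division: the values for `2 * m` and
`2 * m + 1` are stored when `m` is reached. -/
noncomputable def lowBitsProg (d : ℕ) : Program :=
  .seq (assign Var.m (fun _ => 1) .one)
  (.seq (storeAt (fun v => v Var.n * d + v Var.m) (fun _ => 1)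
    (evaluable_bitAddr d (.var Var.m)) .one)
  (loop (fun v => if v Var.m < v Var.n then 1 else 0)
    (evaluable_test (.var Var.m) (.var Var.n)) (lowBitsBody d)))

theorem HasPoints.congr {n : ℕ} {p : ℕ → EuclideanSpace ℝ (Fin d)} {mem mem' : ℕ → ℝ}
    (h : HasPoints n p mem) (h' : ∀ j < n * d, mem' j = mem j) : HasPoints n p mem' := by
  intro i hi e
  rw [h' _ ?_, h i hi e]
  have : (i + 1) * d ≤ n * d := Nat.mul_le_mul_right d hi
  rw [add_mul, one_mul] at this
  omega

theorem lowBitsProg_spec {s n : ℕ} {x : Store Var} {p : ℕ → EuclideanSpace ℝ (Fin d)}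
    (hn : 2 ≤ n) (hs : n * d + 2 * n ≤ s) (hxn : x.var Var.n = n) (hp : HasPoints n p x.mem) :
    Triple s (lowBitsProg d) x ((lowBitsProg d).size * (n + 1)) fun y =>
      y.var Var.n = n ∧ y.var Var.delta = x.var Var.delta ∧ HasPoints n p y.mem ∧
        HasLowBits (n * d) n y.mem := by
  refine Triple.seq_mul (by omega) (Triple.assign ?_)
  refine Triple.seq_mul (by omega) (Triple.storeAt (n * d + 1) ?_ (by omega) ?_)
  · simp [hxn]
  refine Triple.mono (Triple.loop_size (fun μ y => y.var .n = n ∧ y.var .delta = x.var .delta ∧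
    HasPoints n p y.mem ∧ ∃ m : ℕ, 0 < m ∧ m ≤ n ∧ y.var .m = m ∧
      HasLowBits (n * d) (2 * m) y.mem ∧ μ = n - m) (n - 1) ?_ ?_ ?_) ?_ fun _ => id
  · rintro _ y ⟨hn, hd, hpt, m, hm0, hmn, hm, hb, rfl⟩ hne
    have hlt : m < n := by
      by_contra hle
      refine hne (if_neg ?_)
      rw [hm, hn]
      exact_mod_cast hle
    refine Triple.seq_size (Triple.loadAt (n * d + m) ?_ (by omega) ?_)
    · simp [hn, hm]
    refine Triple.seq_size (Triple.storeAt (n * d + 2 * m) ?_ (by omega) ?_)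
    · simp [hn, hm]
    refine Triple.seq_size (Triple.storeAt (n * d + (2 * m + 1)) ?_ (by omega) ?_)
    · simp [hn, hm]
    refine Triple.assign ?_
    refine ⟨n - (m + 1), by omega, by simp [hn], by simp [hd], hpt.congr ?_, m + 1, by omega,
      by omega, by simp [hm], ?_, rfl⟩
    · intro j hj
      simp only
      rw [Function.update_of_ne (by omega), Function.update_of_ne (by omega)]
    · intro j hj hj'
      rcases (show j < 2 * m ∨ j = 2 * m ∨ j = 2 * m + 1 by omega) with h | rfl | rfl
      · simp only
        rw [Function.update_of_ne (by omega), Function.update_of_ne (by omega)]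
        exact hb j hj h
      · simp only
        rw [Function.update_of_ne (by omega), Function.update_self, lowBit_two_mul hm0]
        simp [hb m hm0 (by omega)]
      · simp only
        rw [Function.update_self, lowBit_two_mul_add_one, Nat.cast_one]
  · refine ⟨by simp [hxn], by simp, hp.congr ?_, 1, one_pos, by omega, by simp, ?_, rfl⟩
    · intro j hj
      simp only
      rw [Function.update_of_ne (by omega)]
    · intro j hj hj'
      obtain rfl : j = 1 := by omega
      simp [show lowBit 1 = 1 from lowBit_two_mul_add_one 0]
  · rintro _ y ⟨hn, hd, hpt, m, hm0, hmn, hm, hb, rfl⟩ hz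
    have hnm : n ≤ m := by
      by_contra hlt
      rw [if_pos] at hz
      · exact one_ne_zero hz
      · rw [hm, hn]
        exact_mod_cast not_le.1 hlt
    exact ⟨hn, hd, hpt, fun j h1 h2 => hb j h1 (by omega)⟩
  · exact Nat.mul_le_mul_left _ (by omega)

end Vectors

end RealRAM

/-! ### The table of the dyadic subcurves -/

namespace RealRAM

section Table

variable {d : ℕ}

/-- The part of the memory and the variables that never changes: the input. -/
structure HasInput (n : ℕ) (p : ℕ → EuclideanSpace ℝ (Fin d)) (Δ : ℝ) (y : Store Var) : Prop where
  n_eq : y.var Var.n = n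
  delta_eq : y.var Var.delta = Δ
  points : HasPoints n p y.mem

/-- The memory holds, for `0 < m < M`, a row with one flag for each pair of net points, which tells
whether the subcurve between the vertices `m` and `m - lowBit m` has a monotone path along the
segment between these net points. -/
def HasTable (b N : ℕ) (z p : ℕ → EuclideanSpace ℝ (Fin d)) (Δ : ℝ) (M : ℕ) (mem : ℕ → ℝ) : Prop :=
  ∀ m, 0 < m → m < M → ∀ k < N, ∀ k' < N, mem (b + m * (N * N) + (k' * N + k)) ≠ 0 ↔
    MonotonePath p (p m + Δ • z k) (p (m - lowBit m) + Δ • z k') (7 / 3 * Δ) m (m - lowBit m) 1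

/-- One step of the scan, simultaneously for all pairs of net points. -/
noncomputable def scanBody (N : ℕ) (z : ℕ → Fin d → ℚ) : Program :=
  .seq (assign Var.j (fun v => v Var.j - 1) ((Evaluable.var Var.j).sub .one))
  (.seq (loadVec d Var.x (fun v => v Var.j) (.var Var.j))
  (assignFam (N * N) Var.q
    (fun K v => nextParam (vec d Var.bs v + v Var.delta • netVec z (K % N))
      (vec d Var.be v + v Var.delta • netVec z (K / N)) (((7 / 3 : ℚ) : ℝ) * v Var.delta)
      (vec d Var.x v) (v (Var.q K)))
    fun K => ((VecEvaluable.vec Var.bs).add_smul z (K % N)).nextParam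
      ((VecEvaluable.vec Var.be).add_smul z (K / N))
      ((Evaluable.ratConst (7 / 3)).mul (.var Var.delta)) (.vec Var.x) (.var (Var.q K))))

/-- The greedy scan of the vertices from `m - 1` down to `m - l`, for all pairs of net points. -/
noncomputable def scanLoop (N : ℕ) (z : ℕ → Fin d → ℚ) : Program :=
  loop (fun v => if v Var.m - v Var.l < v Var.j then 1 else 0)
    (evaluable_test ((Evaluable.var Var.m).sub (.var Var.l)) (.var Var.j)) (scanBody N z)

theorem ite_one_zero_ne_zero {P : Prop} [Decidable P] : (if P then (1 : ℝ) else 0) ≠ 0 ↔ P := by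
  split_ifs with h <;> simp [h]

theorem ite_one_zero_eq_zero {P : Prop} [Decidable P] : (if P then (1 : ℝ) else 0) = 0 ↔ ¬ P := by
  split_ifs with h <;> simp [h]

theorem scanLoop_spec {s n m lb N : ℕ} {Δ : ℝ} {z : ℕ → Fin d → ℚ}
    {p : ℕ → EuclideanSpace ℝ (Fin d)} {x : Store Var}
    (hx : HasInput n p Δ x) (hs : n * d ≤ s) (hm : m < n) (hlb : lb ≤ m)
    (hxm : x.var Var.m = m) (hxl : x.var Var.l = lb) (hxj : x.var Var.j = m)
    (hbs : vec d Var.bs x.var = p m) (hbe : vec d Var.be x.var = p (m - lb))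
    (hq : ∀ K < N * N, x.var (Var.q K) = 0) :
    Triple s (scanLoop N z) x ((scanLoop N z).size * (lb + 1)) fun y =>
      y.mem = x.mem ∧ y.var Var.n = x.var Var.n ∧ y.var Var.delta = x.var Var.delta ∧
      y.var Var.m = x.var Var.m ∧ ∀ K < N * N, y.var (Var.q K) =
        scan p (p m + Δ • netVec z (K % N)) (p (m - lb) + Δ • netVec z (K / N)) (7 / 3 * Δ)
          m lb := by
  refine Triple.loop_size (fun μ y => ∃ i ≤ lb, μ = lb - i ∧ y.mem = x.mem ∧
    (∀ b, b ≠ Var.j → (∀ e, b ≠ Var.x e) → (∀ e, b ≠ Var.q e) → y.var b = x.var b) ∧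
    y.var Var.j = (m - i : ℕ) ∧ ∀ K < N * N, y.var (Var.q K) =
      scan p (p m + Δ • netVec z (K % N)) (p (m - lb) + Δ • netVec z (K / N)) (7 / 3 * Δ) m i) lb
    ?_ ?_ ?_
  · rintro _ y ⟨i, hi, rfl, hmem, hvar, hj, hyq⟩ hne
    have h1 := ite_one_zero_ne_zero.1 hne
    rw [hvar Var.m (by simp) (by simp) (by simp), hvar Var.l (by simp) (by simp) (by simp), hxm,
      hxl, hj, ← Nat.cast_sub hlb, Nat.cast_lt] at h1
    have hpts : HasPoints n p y.mem := hmem ▸ hx.points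
    refine Triple.seq_size (Triple.assign ?_)
    have hj' : y.var Var.j - 1 = (m - (i + 1) : ℕ) := by
      rw [hj, ← Nat.sub_sub, Nat.cast_sub (by omega : 1 ≤ m - i), Nat.cast_one]
    refine Triple.seq_size (Triple.loadVec hpts (fun _ _ h => by simpa using h)
      (by omega : m - (i + 1) < n) hs ?_ ?_ ?_)
    · intro v hv
      exact hv _ (by simp)
    · simp [hj']
    intro v hv hvx
    simp only at hv
    refine Triple.assignFam' (fun _ _ h => by simpa using h) ?_ ?_
    · intro K hK v' hv' hvK
      simp only at hv' hvK ⊢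
      rw [vec_congr fun e => hv' (Var.bs e) (by simp), vec_congr fun e => hv' (Var.be e) (by simp),
        vec_congr fun e => hv' (Var.x e) (by simp), hv' Var.delta (by simp), hvK]
    · intro v' hv' hvK
      have hold : ∀ b, b ≠ Var.j → (∀ e, b ≠ Var.x e) → (∀ e, b ≠ Var.q e) → v' b = x.var b := by
        intro b b1 b2 b3
        rw [hv' b b3]
        simp only
        rw [hv b b2, Function.update_of_ne b1, hvar b b1 b2 b3]
      have hold' : ∀ b, b ≠ Var.j → (∀ e, b ≠ Var.x e) → (∀ e, b ≠ Var.q e) → v b = x.var b := by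
        intro b b1 b2 b3
        rw [hv b b2, Function.update_of_ne b1, hvar b b1 b2 b3]
      refine ⟨lb - (i + 1), by omega, i + 1, by omega, rfl, hmem, hold, ?_, ?_⟩
      · simp only
        rw [hv' _ (by simp)]
        simp only
        rw [hv _ (by simp), Function.update_self, hj']
      · intro K hK
        simp only [hvK K hK, scan]
        rw [vec_congr (x := Var.bs) fun e => hold' (Var.bs e) (by simp) (by simp) (by simp),
          vec_congr (x := Var.be) fun e => hold' (Var.be e) (by simp) (by simp) (by simp), hbs,
          hbe, hvx, hold' Var.delta (by simp) (by simp) (by simp), hx.delta_eq, hv _ (by simp),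
          Function.update_of_ne (by simp), hyq K hK]
        norm_num
  · exact ⟨0, by omega, rfl, rfl, fun _ _ _ _ => rfl, by simpa using hxj, fun K hK => hq K hK⟩
  · rintro _ y ⟨i, hi, rfl, hmem, hvar, hj, hyq⟩ hz
    have h1 := ite_one_zero_eq_zero.1 hz
    rw [hvar Var.m (by simp) (by simp) (by simp), hvar Var.l (by simp) (by simp) (by simp), hxm,
      hxl, hj, ← Nat.cast_sub hlb, Nat.cast_lt] at h1
    obtain rfl : i = lb := by omega
    exact ⟨hmem, hvar _ (by simp) (by simp) (by simp), hvar _ (by simp) (by simp) (by simp),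
      hvar _ (by simp) (by simp) (by simp), hyq⟩

theorem evaluable_rowAddr (d N : ℕ) {f : (Var → ℝ) → ℝ} (hf : Evaluable f) :
    Evaluable fun v => v Var.n * d + 3 * v Var.n + f v * (N * N : ℕ) :=
  (((Evaluable.var Var.n).mul (.natConst d)).add
    ((by simpa using Evaluable.natConst (V := Var) 3 : Evaluable fun _ : Var → ℝ => (3 : ℝ)).mul
      (.var Var.n))).add (hf.mul (.natConst _))

/-- Computes the row of the vertex `m`. -/
noncomputable def tableBody (N : ℕ) (z : ℕ → Fin d → ℚ) : Program :=
  .seq (loadAt Var.l (fun v => v Var.n * d + v Var.m) (evaluable_bitAddr d (.var Var.m)))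
  (.seq (loadVec d Var.bs (fun v => v Var.m) (.var Var.m))
  (.seq (loadVec d Var.be (fun v => v Var.m - v Var.l) ((Evaluable.var Var.m).sub (.var Var.l)))
  (.seq (assignFam (N * N) Var.q (fun _ _ => 0) fun _ => .zero)
  (.seq (assign Var.j (fun v => v Var.m) (.var Var.m))
  (.seq (scanLoop N z)
  (.seq (storeFam (N * N) (fun v => v Var.n * d + 3 * v Var.n + v Var.m * (N * N : ℕ))
    (evaluable_rowAddr d N (.var Var.m)) (fun K v => if v (Var.q K) ≤ 1 then 1 else 0)
    fun K => (Evaluable.var (Var.q K)).ite_le .one .one .zero)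
  (assign Var.m (fun v => v Var.m + 1) ((Evaluable.var Var.m).add .one))))))))

theorem tableBody_spec {s n m N : ℕ} {Δ : ℝ} {z : ℕ → Fin d → ℚ}
    {p : ℕ → EuclideanSpace ℝ (Fin d)} {x : Store Var} (hz : IsGoodNet N (netVec z)) (hΔ : 0 < Δ)
    (hx : HasInput n p Δ x) (hs : n * d + 3 * n + n * (N * N) ≤ s) (hm0 : 0 < m) (hm : m < n)
    (hxm : x.var Var.m = m) (hb : HasLowBits (n * d) n x.mem)
    (ht : HasTable (n * d + 3 * n) N (netVec z) p Δ m x.mem) :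
    Triple s (tableBody N z) x ((tableBody N z).size * (lowBit m + 1)) fun y =>
      HasInput n p Δ y ∧ y.var Var.m = (m + 1 : ℕ) ∧ HasLowBits (n * d) n y.mem ∧
      HasTable (n * d + 3 * n) N (netVec z) p Δ (m + 1) y.mem := by
  have hlb := lowBit_le hm0
  have hlb0 := lowBit_pos m
  have hN := hz.pos
  have hrow : (m + 1) * (N * N) ≤ n * (N * N) := Nat.mul_le_mul_right _ hm
  rw [add_mul, one_mul] at hrow
  refine Triple.seq_mul (by omega) (Triple.loadAt (n * d + m) ?_ (by omega) ?_)
  · simp [hx.n_eq, hxm]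
  refine Triple.seq_mul (by omega) (Triple.loadVec (i := m) hx.points
    (fun _ _ h => by simpa using h) hm (by omega) ?_ ?_ ?_)
  · intro v hv
    exact hv _ (by simp)
  · simp [hxm]
  intro v₁ hv₁ hbs
  simp only at hv₁
  refine Triple.seq_mul (by omega) (Triple.loadVec (i := m - lowBit m) hx.points
    (fun _ _ h => by simpa using h) (by omega) (by omega) ?_ ?_ ?_)
  · intro v hv
    simp only at hv ⊢
    rw [hv _ (by simp), hv _ (by simp)]
  · simp only
    rw [hv₁ _ (by simp), hv₁ _ (by simp), Function.update_of_ne (by simp), Function.update_self,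
      hxm, hb m hm0 hm, Nat.cast_sub hlb]
  intro v₂ hv₂ hbe
  simp only at hv₂
  refine Triple.seq_mul (by omega) (Triple.assignFam' (fun _ _ h => by simpa using h)
    (fun _ _ _ _ _ => rfl) ?_)
  intro v₃ hv₃ hq
  simp only at hv₃ hq
  refine Triple.seq_mul (by omega) (Triple.assign ?_)
  have hold : ∀ b, (∀ e, b ≠ Var.bs e) → (∀ e, b ≠ Var.be e) → (∀ e, b ≠ Var.q e) → b ≠ Var.l →
      v₃ b = x.var b := by
    intro b b1 b2 b3 b4
    rw [hv₃ b b3, hv₂ b b2, hv₁ b b1, Function.update_of_ne b4]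
  have h3n : v₃ Var.n = n := (hold _ (by simp) (by simp) (by simp) (by simp)).trans hx.n_eq
  have h3m : v₃ Var.m = m := (hold _ (by simp) (by simp) (by simp) (by simp)).trans hxm
  have h3d : v₃ Var.delta = Δ := (hold _ (by simp) (by simp) (by simp) (by simp)).trans hx.delta_eq
  refine Triple.mul_seq (by omega) ?_
  refine Triple.mono (scanLoop_spec (m := m) (lb := lowBit m) (Δ := Δ) (p := p) (n := n)
    ⟨?_, ?_, ?_⟩ (show n * d ≤ s by omega) hm hlb ?_ ?_ ?_ ?_ ?_ ?_) le_rfl ?_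
  · simp [h3n]
  · simp [h3d]
  · exact hx.points
  · simp [h3m]
  · simp only
    rw [Function.update_of_ne (by simp), hv₃ _ (by simp), hv₂ _ (by simp), hv₁ _ (by simp),
      Function.update_self, hb m hm0 hm]
  · simp [h3m]
  · rw [← hbs]
    refine vec_congr fun e => ?_
    simp only
    rw [Function.update_of_ne (by simp), hv₃ _ (by simp), hv₂ _ (by simp)]
  · rw [← hbe]
    refine vec_congr fun e => ?_
    simp only
    rw [Function.update_of_ne (by simp), hv₃ _ (by simp)]
  · intro K hK
    simp only
    rw [Function.update_of_ne (by simp), hq K hK]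
  rintro y ⟨hymem, hyn, hyd, hym, hyq⟩
  simp only [ne_eq, reduceCtorEq, not_false_eq_true, Function.update_of_ne, h3n, h3d, h3m]
    at hymem hyn hyd hym
  refine Triple.seq_size (Triple.storeFam (n * d + 3 * n + m * (N * N)) ?_ (by omega) ?_)
  · rw [hyn, hym]
    push_cast
    ring
  refine Triple.assign ⟨⟨?_, ?_, ?_⟩, ?_, ?_, ?_⟩
  · simp [hyn]
  · simp [hyd]
  · refine hx.points.congr fun j hj => ?_
    simp only
    rw [if_neg (by omega), hymem]
  · simp [hym]
  · intro j hj hj'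
    simp only
    rw [if_neg (by omega), hymem]
    exact hb j hj hj'
  · intro m' hm' hm'' k hk k' hk'
    have hK : k' * N + k < N * N := by
      have : (k' + 1) * N ≤ N * N := Nat.mul_le_mul_right N hk'
      rw [add_mul, one_mul] at this
      omega
    simp only
    rcases (show m' < m ∨ m' = m by omega) with h | rfl
    · have hr : (m' + 1) * (N * N) ≤ m * (N * N) := Nat.mul_le_mul_right _ h
      rw [add_mul, one_mul] at hr
      rw [if_neg (by omega), hymem]
      exact ht m' hm' h k hk k' hk'
    · rw [if_pos (by omega), Nat.add_sub_cancel_left, ite_one_zero_ne_zero, hyq _ hK,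
        show (k' * N + k) % N = k by rw [Nat.mul_add_mod', Nat.mod_eq_of_lt hk],
        show (k' * N + k) / N = k' by
          rw [mul_comm, Nat.mul_add_div hN, Nat.div_eq_of_lt hk, add_zero]]
      exact scan_le_one_iff (by positivity) (norm_sub_add_smul_le hz hΔ _ _)
        (norm_sub_add_smul_le hz hΔ _ _) hlb hlb0

/-- Computes the table. The row of `m` costs `lowBit m + 1` steps, and these costs sum up to
`O(n log n)`. -/
noncomputable def tableProg (N : ℕ) (z : ℕ → Fin d → ℚ) : Program :=
  .seq (assign Var.m (fun _ => 1) .one)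
  (loop (fun v => if v Var.m < v Var.n then 1 else 0) (evaluable_test (.var Var.m) (.var Var.n))
    (tableBody N z))

theorem tableProg_spec {s n N L : ℕ} {Δ : ℝ} {z : ℕ → Fin d → ℚ}
    {p : ℕ → EuclideanSpace ℝ (Fin d)} {x : Store Var} (hz : IsGoodNet N (netVec z)) (hΔ : 0 < Δ)
    (hx : HasInput n p Δ x) (hs : n * d + 3 * n + n * (N * N) ≤ s) (hn : 2 ≤ n) (hL : n ≤ 2 ^ L)
    (hb : HasLowBits (n * d) n x.mem) :
    Triple s (tableProg N z) x ((tableProg N z).size * (n * (L + 1))) fun y =>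
      HasInput n p Δ y ∧ HasLowBits (n * d) n y.mem ∧
      HasTable (n * d + 3 * n) N (netVec z) p Δ n y.mem := by
  refine Triple.seq_mul (by nlinarith) (Triple.assign ?_)
  set A := (tableBody N z).size +
    (evalProg 0 (fun v : Var → ℝ => if v Var.m < v Var.n then (1 : ℝ) else 0)
      (evaluable_test (.var Var.m) (.var Var.n))).size + 1 with hA
  refine Triple.mono (Triple.loop (fun Φ y => ∃ m, 0 < m ∧ m ≤ n ∧ y.var Var.m = m ∧
    HasInput n p Δ y ∧ HasLowBits (n * d) n y.mem ∧
    HasTable (n * d + 3 * n) N (netVec z) p Δ m y.mem ∧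
    Φ = A * ∑ i ∈ Finset.Ico m n, (lowBit i + 1)) (A * ∑ i ∈ Finset.Ico 1 n, (lowBit i + 1))
    ?_ ?_ ?_) ?_ fun _ => id
  · rintro _ y ⟨m, hm0, hmn, hm, hy, hbits, htab, rfl⟩ hne
    have hlt := ite_one_zero_ne_zero.1 hne
    rw [hm, hy.n_eq, Nat.cast_lt] at hlt
    refine ⟨_, (tableBody_spec hz hΔ hy hs hm0 hlt hm hbits htab).mono le_rfl ?_⟩
    rintro y' ⟨h1, h2, h3, h4⟩
    refine ⟨_, ⟨m + 1, by omega, by omega, h2, h1, h3, h4, rfl⟩, ?_⟩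
    rw [Finset.sum_eq_sum_Ico_succ_bot hlt]
    nlinarith
  · refine ⟨1, one_pos, by omega, by simp, ⟨by simp [hx.n_eq], by simp [hx.delta_eq], hx.points⟩,
      hb, ?_, rfl⟩
    intro m h1 h2
    omega
  · rintro _ y ⟨m, hm0, hmn, hm, hy, hbits, htab, rfl⟩ hzero
    have hge := ite_one_zero_eq_zero.1 hzero
    rw [hm, hy.n_eq, Nat.cast_lt] at hge
    obtain rfl : m = n := by omega
    exact ⟨hy, hbits, htab⟩
  · have h1 : ∑ i ∈ Finset.Ico 1 n, (lowBit i + 1) ≤ (n - 1) * L + (n - 1) := by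
      rw [Finset.sum_add_distrib]
      have h2 := sum_lowBit_le L (n - 1) (by omega)
      have h3 : Finset.Icc 1 (n - 1) = Finset.Ico 1 n := by
        ext i
        simp only [Finset.mem_Icc, Finset.mem_Ico]
        omega
      rw [h3] at h2
      simpa using h2
    have h4 : (n - 1) * L + (n - 1) + 1 ≤ n * (L + 1) := by
      obtain ⟨n', rfl⟩ : ∃ n', n = n' + 1 := ⟨n - 1, by omega⟩
      simp only [Nat.add_sub_cancel]
      nlinarith
    calc _ ≤ A * (∑ i ∈ Finset.Ico 1 n, (lowBit i + 1) + 1) := by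
          rw [mul_add, mul_one]
          omega
      _ ≤ A * (n * (L + 1)) := Nat.mul_le_mul_left _ (by omega)
      _ ≤ _ := by
          refine Nat.mul_le_mul_right _ ?_
          simp only [RealRAM.loop, Program.size, hA]
          omega

end Table

end RealRAM

/-! ### The program for the edge test -/

theorem IsReachable.congr {d N a w c : ℕ} {Δ : ℝ} {p z : ℕ → EuclideanSpace ℝ (Fin d)}
    {g g' : ℕ → ℝ} (h : IsReachable p z N Δ a w c g) (hg : ∀ k < N, g' k = g k) :
    IsReachable p z N Δ a w c g' := by
  refine ⟨fun k hk => ?_, fun k hk => ?_, fun f f0 f1 f2 f3 k hk => ?_⟩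
  · rw [hg k hk]
    exact h.near k hk
  · rw [hg k hk]
    exact h.path k hk
  · rw [hg k hk]
    exact h.le f f0 f1 f2 f3 k hk

namespace RealRAM

section Query

variable {d : ℕ}

/-- Chooses the next vertex of the Fenwick walk from `c` down to `a`, and loads the row of the
table for the subcurve in between; between consecutive vertices all flags are `1`. -/
noncomputable def walkStep (d N : ℕ) : Program :=
  .seq (loadAt Var.l (fun v => v Var.n * d + v Var.c) (evaluable_bitAddr d (.var Var.c)))
  (cond (fun v => if v Var.a + v Var.l ≤ v Var.c then 1 else 0)
    (((Evaluable.var Var.a).add (.var Var.l)).ite_le (.var Var.c) .one .zero)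
    (.seq (loadFam (N * N) Var.t (fun v => v Var.n * d + 3 * v Var.n + v Var.c * (N * N : ℕ))
        (evaluable_rowAddr d N (.var Var.c)))
      (assign Var.c (fun v => v Var.c - v Var.l) ((Evaluable.var Var.c).sub (.var Var.l))))
    (.seq (assignFam (N * N) Var.t (fun _ _ => 1) fun _ => .one)
      (assign Var.c (fun v => v Var.c - 1) ((Evaluable.var Var.c).sub .one))))

theorem walkStep_spec {s n N a c : ℕ} {Δ : ℝ} {z : ℕ → Fin d → ℚ}
    {p : ℕ → EuclideanSpace ℝ (Fin d)} {x : Store Var} (hz : IsGoodNet N (netVec z)) (hΔ : 0 < Δ)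
    (hxn : x.var Var.n = n) (hs : n * d + 3 * n + n * (N * N) ≤ s)
    (hb : HasLowBits (n * d) n x.mem)
    (ht : HasTable (n * d + 3 * n) N (netVec z) p Δ n x.mem) (hac : a < c) (hcn : c < n)
    (hxa : x.var Var.a = a) (hxc : x.var Var.c = c) :
    Triple s (walkStep d N) x (walkStep d N).size fun y => y.mem = x.mem ∧
      (∀ b, b ≠ Var.l → b ≠ Var.c → (∀ e, b ≠ Var.t e) → y.var b = x.var b) ∧
      ∃ c', a ≤ c' ∧ c' < c ∧ y.var Var.c = c' ∧ walkLength a c = walkLength a c' + 1 ∧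
        ∀ k < N, ∀ k' < N, y.var (Var.t (k' * N + k)) ≠ 0 ↔
          MonotonePath p (p c + Δ • netVec z k) (p c' + Δ • netVec z k') (7 / 3 * Δ) c c' 1 := by
  have hbc := hb c (by omega) hcn
  have hpos := lowBit_pos c
  have hinj : Function.Injective Var.t := fun _ _ h => by simpa using h
  have hK : ∀ k < N, ∀ k' < N, k' * N + k < N * N := by
    intro k hk k' hk'
    have : (k' + 1) * N ≤ N * N := Nat.mul_le_mul_right N hk'
    rw [add_mul, one_mul] at this
    omega
  have hrow : (c + 1) * (N * N) ≤ n * (N * N) := Nat.mul_le_mul_right _ hcn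
  rw [add_mul, one_mul] at hrow
  refine Triple.seq_size (Triple.loadAt (n * d + c) ?_ (by omega) ?_)
  · simp [hxn, hxc]
  refine Triple.cond_size (fun h => ?_) (fun h => ?_)
  · rw [ite_one_zero_ne_zero] at h
    simp only [ne_eq, reduceCtorEq, not_false_eq_true, Function.update_of_ne, Function.update_self,
      hxa, hxc, hbc] at h
    have hj : a + lowBit c ≤ c := by exact_mod_cast h
    refine Triple.seq_size (Triple.loadFam (n * d + 3 * n + c * (N * N)) (fun k _ g => ?_) ?_
      (by omega) ?_)
    · simp only
      rw [updateFam_of_ne (by simp), updateFam_of_ne (by simp)]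
    · simp [hxn, hxc]
    refine Triple.assign ⟨rfl, ?_, c - lowBit c, by omega, by omega, ?_,
      walkLength_of_jump hac hj, ?_⟩
    · intro b b1 b2 b3
      simp only
      rw [Function.update_of_ne b2, updateFam_of_ne b3, Function.update_of_ne b1]
    · simp only
      rw [Function.update_self, updateFam_of_ne (by simp), updateFam_of_ne (by simp),
        Function.update_of_ne (by simp), Function.update_self, hxc, hbc, Nat.cast_sub (by omega)]
    · intro k hk k' hk'
      simp only
      rw [Function.update_of_ne (by simp), updateFam_apply hinj, if_pos (hK k hk k' hk')]
      exact ht c (by omega) hcn k hk k' hk'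
  · rw [ite_one_zero_eq_zero] at h
    simp only [ne_eq, reduceCtorEq, not_false_eq_true, Function.update_of_ne, Function.update_self,
      hxa, hxc, hbc] at h
    have hj : ¬ a + lowBit c ≤ c := by exact_mod_cast h
    obtain ⟨c', rfl⟩ : ∃ c', c = c' + 1 := ⟨c - 1, by omega⟩
    refine Triple.seq_size (Triple.assignFam (fun k _ g => rfl) ?_)
    refine Triple.assign ⟨rfl, ?_, c', by omega, by omega, ?_, walkLength_of_not_jump hac hj, ?_⟩
    · intro b b1 b2 b3
      simp only
      rw [Function.update_of_ne b2, updateFam_of_ne b3, Function.update_of_ne b1]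
    · simp only
      rw [Function.update_self, updateFam_of_ne (by simp), Function.update_of_ne (by simp), hxc]
      push_cast
      ring
    · intro k hk k' hk'
      simp only
      rw [Function.update_of_ne (by simp), updateFam_apply hinj, if_pos (hK k hk k' hk')]
      exact iff_of_true one_ne_zero (MonotonePath.single (norm_sub_add_smul_le hz hΔ _ _)
        (norm_sub_add_smul_le hz hΔ _ _))

variable {N : ℕ}

theorem evaluable_relax (hN : (Finset.range N).Nonempty) (z : ℕ → Fin d → ℚ) (k' : ℕ) :
    Evaluable fun v : Var → ℝ => relax hN (vec d Var.pw v) (vec d Var.pa v)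
      (((1 / 6 : ℚ) : ℝ) * v Var.delta) (vec d Var.x v + v Var.delta • netVec z k')
      (fun k => v (Var.t (k' * N + k))) (fun k => v (Var.g k)) :=
  (VecEvaluable.vec Var.pw).nextParam (.vec Var.pa)
    ((Evaluable.ratConst (1 / 6)).mul (.var Var.delta)) ((VecEvaluable.vec Var.x).add_smul z k')
    (Evaluable.inf' hN fun k => (Evaluable.var (Var.t (k' * N + k))).ite_ne (.var (Var.g k)) .two)

/-- One step of the dynamic program. The new values are collected in `h` first, because all of them
depend on the old values in `g`. -/
noncomputable def queryBody (hN : (Finset.range N).Nonempty) (z : ℕ → Fin d → ℚ) : Program :=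
  .seq (walkStep d N)
  (.seq (loadVec d Var.x (fun v => v Var.c) (.var Var.c))
  (.seq (assignFam N Var.h _ (evaluable_relax hN z))
  (assignFam N Var.g (fun k v => v (Var.h k)) fun k => .var (Var.h k))))

theorem queryBody_spec {s n a w c : ℕ} {Δ : ℝ} {z : ℕ → Fin d → ℚ}
    {p : ℕ → EuclideanSpace ℝ (Fin d)} {x : Store Var} (hN : (Finset.range N).Nonempty)
    (hz : IsGoodNet N (netVec z)) (hΔ : 0 < Δ) (hx : HasInput n p Δ x)
    (hs : n * d + 3 * n + n * (N * N) ≤ s) (hb : HasLowBits (n * d) n x.mem)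
    (ht : HasTable (n * d + 3 * n) N (netVec z) p Δ n x.mem) (hac : a < c) (hcw : c ≤ w)
    (hwn : w < n) (hxa : x.var Var.a = a) (hxc : x.var Var.c = c)
    (hpa : vec d Var.pa x.var = p a) (hpw : vec d Var.pw x.var = p w)
    (hg : IsReachable p (netVec z) N Δ a w c fun k => x.var (Var.g k)) :
    Triple s (queryBody hN z) x (queryBody hN z).size fun y => y.mem = x.mem ∧
      (∀ b, b ≠ Var.l → b ≠ Var.c → (∀ e, b ≠ Var.t e) → (∀ e, b ≠ Var.x e) → (∀ e, b ≠ Var.h e) →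
        (∀ e, b ≠ Var.g e) → y.var b = x.var b) ∧
      ∃ c', a ≤ c' ∧ c' < c ∧ y.var Var.c = c' ∧ walkLength a c = walkLength a c' + 1 ∧
        IsReachable p (netVec z) N Δ a w c' fun k => y.var (Var.g k) := by
  refine Triple.seq_size
    ((walkStep_spec hz hΔ hx.n_eq hs hb ht hac (by omega) hxa hxc).mono le_rfl ?_)
  rintro y ⟨hmem, hvar, c', hac', hcc', hc', hwalk, htab⟩
  refine Triple.seq_size (Triple.loadVec (i := c') (hmem ▸ hx.points)
    (fun _ _ h => by simpa using h) (by omega) (by omega) ?_ hc' ?_)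
  · intro v hv
    exact hv _ (by simp)
  intro v hv hvx
  refine Triple.seq_size (Triple.assignFam' (fun _ _ h => by simpa using h) ?_ ?_)
  · intro k hk v' hv' _
    simp only at hv' ⊢
    rw [vec_congr fun e => hv' (Var.pw e) (by simp), vec_congr fun e => hv' (Var.pa e) (by simp),
      vec_congr fun e => hv' (Var.x e) (by simp), hv' Var.delta (by simp)]
    congr 1
    · exact funext fun k => hv' _ (by simp)
    · exact funext fun k => hv' _ (by simp)
  intro v₂ hv₂ hh
  simp only at hv₂ hh
  refine Triple.assignFam' (fun _ _ h => by simpa using h) ?_ ?_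
  · intro k hk v' hv' _
    exact hv' _ (by simp)
  intro v₃ hv₃ hg₃
  simp only at hv₃ hg₃
  refine ⟨hmem, ?_, c', hac', hcc', ?_, hwalk, ?_⟩
  · intro b b1 b2 b3 b4 b5 b6
    simp only
    rw [hv₃ b b6, hv₂ b b5, hv b b4, hvar b b1 b2 b3]
  · simp only
    rw [hv₃ _ (by simp), hv₂ _ (by simp), hv _ (by simp), hc']
  · have hold : ∀ b, b ≠ Var.l → b ≠ Var.c → (∀ e, b ≠ Var.t e) → (∀ e, b ≠ Var.x e) →
        v b = x.var b := by
      intro b b1 b2 b3 b4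
      rw [hv b b4, hvar b b1 b2 b3]
    refine (hg.step hz hΔ hac' hcc' hcw (t := fun k' k => y.var (Var.t (k' * N + k))) htab
      hN).congr ?_
    intro k hk
    simp only
    rw [hg₃ k hk, hh k hk,
      vec_congr (x := Var.pw) fun e => hold (Var.pw e) (by simp) (by simp) (by simp) (by simp),
      vec_congr (x := Var.pa) fun e => hold (Var.pa e) (by simp) (by simp) (by simp) (by simp),
      hpa, hpw, hvx, hold Var.delta (by simp) (by simp) (by simp) (by simp), hx.delta_eq]
    congr 1
    · push_cast
      ring
    · exact funext fun k => hv _ (by simp)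
    · exact funext fun k => hold _ (by simp) (by simp) (by simp) (by simp)

/-- The test for the edge between the vertices `a` and `w`, with answer in `r`. -/
noncomputable def queryProg (hN : (Finset.range N).Nonempty) (z : ℕ → Fin d → ℚ) : Program :=
  .seq (loadVec d Var.pa (fun v => v Var.a) (.var Var.a))
  (.seq (loadVec d Var.pw (fun v => v Var.w) (.var Var.w))
  (.seq (assign Var.c (fun v => v Var.w) (.var Var.w))
  (.seq (assignFam N Var.g (fun k _ => (startParam (netVec z) k : ℝ)) fun _ => .natConst _)
  (.seq (loop (fun v => if v Var.a < v Var.c then 1 else 0)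
    (evaluable_test (.var Var.a) (.var Var.c)) (queryBody hN z))
  (assign Var.r (fun v => if v (Var.g 0) ≤ 1 then 1 else 0)
    ((Evaluable.var (Var.g 0)).ite_le .one .one .zero))))))

theorem queryProg_spec {s n a w L : ℕ} {Δ : ℝ} {z : ℕ → Fin d → ℚ}
    {p : ℕ → EuclideanSpace ℝ (Fin d)} {x : Store Var} (hN : (Finset.range N).Nonempty)
    (hz : IsGoodNet N (netVec z)) (hΔ : 0 < Δ) (hx : HasInput n p Δ x)
    (hs : n * d + 3 * n + n * (N * N) ≤ s) (hb : HasLowBits (n * d) n x.mem)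
    (ht : HasTable (n * d + 3 * n) N (netVec z) p Δ n x.mem) (haw : a < w)
    (hwn : w < n) (hL : n ≤ 2 ^ L) (hxa : x.var Var.a = a) (hxw : x.var Var.w = w) :
    Triple s (queryProg hN z) x ((queryProg hN z).size * (L * L + 2)) fun y => y.mem = x.mem ∧
      y.var Var.n = x.var Var.n ∧ y.var Var.delta = x.var Var.delta ∧ y.var Var.w = x.var Var.w ∧
      y.var Var.k = x.var Var.k ∧
      ∃ g, IsReachable p (netVec z) N Δ a w a g ∧ y.var Var.r = if g 0 ≤ 1 then 1 else 0 := by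
  refine Triple.seq_mul (by omega) (Triple.loadVec (i := a) hx.points
    (fun _ _ h => by simpa using h) (by omega) (by omega) ?_ hxa ?_)
  · intro v hv
    exact hv _ (by simp)
  intro v₁ hv₁ hpa
  refine Triple.seq_mul (by omega) (Triple.loadVec (i := w) hx.points
    (fun _ _ h => by simpa using h) hwn (by omega) ?_ ?_ ?_)
  · intro v hv
    exact hv _ (by simp)
  · simp only
    rw [hv₁ _ (by simp), hxw]
  intro v₂ hv₂ hpw
  simp only at hv₂
  refine Triple.seq_mul (by omega) (Triple.assign ?_)
  refine Triple.seq_mul (by omega) (Triple.assignFam' (fun _ _ h => by simpa using h)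
    (fun _ _ _ _ _ => rfl) ?_)
  intro v₃ hv₃ hg
  simp only at hv₃ hg
  have hold : ∀ b, b ≠ Var.c → (∀ e, b ≠ Var.g e) → (∀ e, b ≠ Var.pa e) → (∀ e, b ≠ Var.pw e) →
      v₃ b = x.var b := by
    intro b b1 b2 b3 b4
    rw [hv₃ b b2, Function.update_of_ne b1, hv₂ b b4, hv₁ b b3]
  have hpa₃ : vec d Var.pa v₃ = p a := by
    rw [← hpa]
    refine vec_congr fun e => ?_
    rw [hv₃ _ (by simp), Function.update_of_ne (by simp), hv₂ _ (by simp)]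
  have hpw₃ : vec d Var.pw v₃ = p w := by
    rw [← hpw]
    refine vec_congr fun e => ?_
    rw [hv₃ _ (by simp), Function.update_of_ne (by simp)]
  refine Triple.mul_seq (by omega) ?_
  refine Triple.mono (Triple.loop_size (fun μ y => y.mem = x.mem ∧
      (∀ b, b ≠ Var.l → b ≠ Var.c → (∀ e, b ≠ Var.t e) → (∀ e, b ≠ Var.x e) → (∀ e, b ≠ Var.h e) →
        (∀ e, b ≠ Var.g e) → y.var b = v₃ b) ∧
      ∃ c, a ≤ c ∧ c ≤ w ∧ y.var Var.c = c ∧ μ = walkLength a c ∧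
        IsReachable p (netVec z) N Δ a w c fun k => y.var (Var.g k)) (walkLength a w)
    (Q := fun y => y.mem = x.mem ∧
      (∀ b, b ≠ Var.l → b ≠ Var.c → (∀ e, b ≠ Var.t e) → (∀ e, b ≠ Var.x e) → (∀ e, b ≠ Var.h e) →
        (∀ e, b ≠ Var.g e) → y.var b = v₃ b) ∧
      IsReachable p (netVec z) N Δ a w a fun k => y.var (Var.g k)) ?_ ?_ ?_) ?_ ?_
  · rintro _ y ⟨hmem, hvar, c, hac, hcw, hc, rfl, hr⟩ hne
    have hvar' : ∀ b, b ≠ Var.l → b ≠ Var.c → (∀ e, b ≠ Var.t e) → (∀ e, b ≠ Var.x e) →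
        (∀ e, b ≠ Var.h e) → (∀ e, b ≠ Var.g e) → (∀ e, b ≠ Var.pa e) → (∀ e, b ≠ Var.pw e) →
        y.var b = x.var b := by
      intro b b1 b2 b3 b4 b5 b6 b7 b8
      rw [hvar b b1 b2 b3 b4 b5 b6, hold b b2 b6 b7 b8]
    have hya : y.var Var.a = a :=
      (by apply hvar' <;> simp : y.var Var.a = x.var Var.a).trans hxa
    have hlt := ite_one_zero_ne_zero.1 hne
    rw [hya, hc, Nat.cast_lt] at hlt
    have hin : HasInput n p Δ y := by
      refine ⟨?_, ?_, hmem ▸ hx.points⟩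
      · rw [← hx.n_eq]
        apply hvar' <;> simp
      · rw [← hx.delta_eq]
        apply hvar' <;> simp
    refine (queryBody_spec hN hz hΔ hin hs (hmem ▸ hb) (hmem ▸ ht) hlt hcw hwn hya hc ?_ ?_ hr).mono
      le_rfl ?_
    · rw [← hpa₃]
      exact vec_congr fun e => hvar _ (by simp) (by simp) (by simp) (by simp) (by simp) (by simp)
    · rw [← hpw₃]
      exact vec_congr fun e => hvar _ (by simp) (by simp) (by simp) (by simp) (by simp) (by simp)
    · rintro y' ⟨hmem', hv', c', hac', hcc', hc', hwalk, hr'⟩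
      refine ⟨walkLength a c', by omega, hmem'.trans hmem, ?_, c', hac', by omega, hc', rfl, hr'⟩
      intro b b1 b2 b3 b4 b5 b6
      rw [hv' b b1 b2 b3 b4 b5 b6, hvar b b1 b2 b3 b4 b5 b6]
  · refine ⟨rfl, fun _ _ _ _ _ _ _ => rfl, w, haw.le, le_rfl, ?_, rfl, ?_⟩
    · simp only
      rw [hv₃ _ (by simp), Function.update_self, hv₂ _ (by simp), hv₁ _ (by simp), hxw]
    · exact (IsReachable.start hΔ).congr hg
  · rintro _ y ⟨hmem, hvar, c, hac, hcw, hc, rfl, hr⟩ hzero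
    have hge := ite_one_zero_eq_zero.1 hzero
    rw [hvar _ (by simp) (by simp) (by simp) (by simp) (by simp) (by simp),
      hold _ (by simp) (by simp) (by simp) (by simp), hxa, hc, Nat.cast_lt] at hge
    obtain rfl : c = a := by omega
    exact ⟨hmem, hvar, hr⟩
  · have := walkLength_le (L := L) haw.le (by omega)
    exact Nat.mul_le_mul_left _ (by omega)
  · rintro y ⟨hmem, hvar, hr⟩
    have hvar' : ∀ b, b ≠ Var.l → b ≠ Var.c → (∀ e, b ≠ Var.t e) → (∀ e, b ≠ Var.x e) →
        (∀ e, b ≠ Var.h e) → (∀ e, b ≠ Var.g e) → (∀ e, b ≠ Var.pa e) → (∀ e, b ≠ Var.pw e) →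
        b ≠ Var.r →
        Function.update y.var Var.r (if y.var (Var.g 0) ≤ 1 then 1 else 0) b = x.var b := by
      intro b b1 b2 b3 b4 b5 b6 b7 b8 b9
      rw [Function.update_of_ne b9, hvar b b1 b2 b3 b4 b5 b6, hold b b2 b6 b7 b8]
    refine Triple.assign ⟨hmem, ?_, ?_, ?_, ?_, _, hr, Function.update_self _ _ _⟩
    all_goals
      simp only
      apply hvar' <;> simp

end Query

end RealRAM

/-! ### The main loop -/

theorem IsPopping.le_apply {d n w k : ℕ} {P : PolygonalCurve d n} {Δ : ℝ} {S : ℕ → ℕ}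
    (h : IsPopping P Δ w k S) {j : ℕ} (hj : j ≤ k) : j ≤ S j := by
  induction j with
  | zero => exact Nat.zero_le _
  | succ j ih => exact (ih (by omega)).trans_lt (h.lt j hj)

namespace RealRAM

section Main

variable {d N : ℕ}

theorem evaluable_stackAddr (d : ℕ) {f : (Var → ℝ) → ℝ} (hf : Evaluable f) :
    Evaluable fun v => v Var.n * d + 2 * v Var.n + f v :=
  (((Evaluable.var Var.n).mul (.natConst d)).add (Evaluable.two.mul (.var Var.n))).add hf

/-- The flag `r` is set to `1` if there is a vertex below the top of the stack. -/
noncomputable def setFlag : Program :=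
  assign Var.r (fun v => if 0 < v Var.k then 1 else 0)
    (Evaluable.zero.ite_lt (.var Var.k) .one .zero)

/-- Tests the edge from the vertex below the top of the stack to the vertex `w`, and pops the top
if the test succeeds. -/
noncomputable def popProg (hN : (Finset.range N).Nonempty) (z : ℕ → Fin d → ℚ) : Program :=
  .seq (loadAt Var.a (fun v => v Var.n * d + 2 * v Var.n + (v Var.k - 1))
    (evaluable_stackAddr d ((Evaluable.var Var.k).sub .one)))
  (.seq (assign Var.a (fun v => v Var.a - 1) ((Evaluable.var Var.a).sub .one))
  (.seq (queryProg hN z)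
  (cond (fun v => v Var.r) (.var Var.r)
    (.seq (assign Var.k (fun v => v Var.k - 1) ((Evaluable.var Var.k).sub .one)) setFlag)
    .skip)))

/-- Pushes the vertex `w` unless it is close to the top of the stack, and proceeds to the next
vertex. -/
noncomputable def pushProg (d : ℕ) : Program :=
  .seq (loadAt Var.a (fun v => v Var.n * d + 2 * v Var.n + v Var.k)
    (evaluable_stackAddr d (.var Var.k)))
  (.seq (assign Var.a (fun v => v Var.a - 1) ((Evaluable.var Var.a).sub .one))
  (.seq (loadVec d Var.pa (fun v => v Var.a) (.var Var.a))
  (.seq (loadVec d Var.pw (fun v => v Var.w) (.var Var.w))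
  (.seq (cond (fun v => if ‖vec d Var.pw v - vec d Var.pa v‖ ^ 2 <
        (((1 / 3 : ℚ) : ℝ) * v Var.delta) ^ 2 then 1 else 0)
      (((VecEvaluable.vec Var.pw).sub (.vec Var.pa)).norm_sq.ite_lt
        ((Evaluable.ratConst (1 / 3)).mul (.var Var.delta)).sq .one .zero)
      .skip
      (.seq (assign Var.k (fun v => v Var.k + 1) ((Evaluable.var Var.k).add .one))
        (storeAt (fun v => v Var.n * d + 2 * v Var.n + v Var.k) (fun v => v Var.w + 1)
          (evaluable_stackAddr d (.var Var.k)) ((Evaluable.var Var.w).add .one))))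
  (.seq (assign Var.w (fun v => v Var.w + 1) ((Evaluable.var Var.w).add .one)) setFlag)))))

/-- One action on the stack: a test followed by a pop if it succeeds, or a push. -/
noncomputable def mainBody (hN : (Finset.range N).Nonempty) (z : ℕ → Fin d → ℚ) : Program :=
  cond (fun v => v Var.r) (.var Var.r) (popProg hN z) (pushProg d)

/-- The memory holds the stack, with vertices counted from `1`. -/
def HasStack (b k : ℕ) (S : ℕ → ℕ) (mem : ℕ → ℝ) : Prop :=
  ∀ j ≤ k, mem (b + j) = (S j + 1 : ℕ)

/-- The invariant of the main loop. The flag `r` is `1` if the next action is a test, and `0` if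
the edge that would skip the top of the stack is known to fail. -/
structure IsMainState {n : ℕ} (P : PolygonalCurve d n) (N : ℕ) (z : ℕ → EuclideanSpace ℝ (Fin d))
    (Δ : ℝ) (w k : ℕ) (S : ℕ → ℕ) (y : Store Var) : Prop where
  input : HasInput n P.point Δ y
  bits : HasLowBits (n * d) n y.mem
  table : HasTable (n * d + 3 * n) N z P.point Δ n y.mem
  stack : HasStack (n * d + 2 * n) k S y.mem
  w_eq : y.var Var.w = w
  k_eq : y.var Var.k = k
  le : w ≤ n
  popping : w < n → IsPopping P Δ w k S
  finished : w = n → IsGoodStack P Δ (n - 1) k S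
  flag : y.var Var.r ≠ 0 → 0 < k
  fails : y.var Var.r = 0 → w < n → ∀ j, j + 1 = k → ENNReal.ofReal (2 * Δ) <
    frechetDist (P.subcurve (P.time (S j)) (P.time w)) (edgeCurve (P.point (S j)) (P.point w))

variable {s n L : ℕ} {Δ : ℝ} {z : ℕ → Fin d → ℚ} {P : PolygonalCurve d n} {w k : ℕ} {S : ℕ → ℕ}
  {x : Store Var}

/-- An upper bound for the number of iterations of the main loop that remain. Passing
to the next vertex lowers it by `4` and pays for a push and for raising the flag, a pop lowers it by
`2` and pays for raising the flag, and a failed test clears the flag. -/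
noncomputable def mainMeasure (n w k : ℕ) (r : ℝ) : ℕ :=
  open Classical in 4 * (n - w) + 2 * k + if r = 0 then 0 else 1

theorem mainMeasure_le (n w k : ℕ) (r : ℝ) : mainMeasure n w k r ≤ 4 * (n - w) + 2 * k + 1 := by
  unfold mainMeasure
  split_ifs <;> omega

theorem popProg_spec (hN : (Finset.range N).Nonempty) (hz : IsGoodNet N (netVec z)) (hΔ : 0 < Δ)
    (hs : n * d + 3 * n + n * (N * N) ≤ s) (hL : n ≤ 2 ^ L)
    (h : IsMainState P N (netVec z) Δ w k S x) (hw : w < n) (hr : x.var Var.r ≠ 0) :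
    Triple s (popProg hN z) x ((popProg hN z).size * (L * L + 2)) fun y =>
      ∃ k', IsMainState P N (netVec z) Δ w k' S y ∧
        mainMeasure n w k' (y.var Var.r) < mainMeasure n w k (x.var Var.r) := by
  obtain ⟨k, rfl⟩ : ∃ k', k = k' + 1 := ⟨k - 1, by have := h.flag hr; omega⟩
  have hpop := h.popping hw
  have hk := hpop.le_apply (j := k + 1) le_rfl
  have htop := hpop.top_lt
  have haw : S k < w := (hpop.lt k (by omega)).trans htop
  have hm0 : mainMeasure n w (k + 1) (x.var Var.r) = 4 * (n - w) + 2 * (k + 1) + 1 := by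
    rw [mainMeasure, if_neg hr]
  refine Triple.seq_mul (by omega) (Triple.loadAt (n * d + 2 * n + k) ?_ (by omega) ?_)
  · rw [h.input.n_eq, h.k_eq]
    push_cast
    ring
  refine Triple.seq_mul (by omega) (Triple.assign ?_)
  refine Triple.mul_seq (by omega) ?_
  refine Triple.mono (queryProg_spec (a := S k) (w := w) (L := L) (n := n) (Δ := Δ) (p := P.point)
    hN hz hΔ ⟨?_, ?_, ?_⟩ hs ?_ ?_ haw hw hL ?_ ?_) le_rfl ?_
  · simp [h.input.n_eq]
  · simp [h.input.delta_eq]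
  · exact h.input.points
  · exact h.bits
  · exact h.table
  · simp [h.stack k (by omega)]
  · simp [h.w_eq]
  rintro y ⟨hmem, hyn, hyd, hyw, hyk, g, hg, hyr⟩
  simp only [ne_eq, reduceCtorEq, not_false_eq_true, Function.update_of_ne] at hmem hyn hyd hyw hyk
  refine Triple.cond_size (fun hne => ?_) (fun hzero => ?_)
  · rw [hyr, ite_one_zero_ne_zero] at hne
    refine Triple.seq_size (Triple.assign (Triple.assign ⟨k, ?_, ?_⟩))
    · refine ⟨⟨?_, ?_, hmem ▸ h.input.points⟩, hmem ▸ h.bits, hmem ▸ h.table, ?_, ?_, ?_, h.le,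
        fun _ => hpop.pop hΔ (hg.monotonePath hz hΔ haw hne), fun hwn => absurd hwn hw.ne, ?_, ?_⟩
      · simp [hyn, h.input.n_eq]
      · simp [hyd, h.input.delta_eq]
      · intro j hj
        simp only
        rw [hmem]
        exact h.stack j (by omega)
      · simp [hyw, h.w_eq]
      · simp [hyk, h.k_eq]
      · intro hne'
        simp only [Function.update_self, hyk, h.k_eq] at hne'
        have := ite_one_zero_ne_zero.1 hne'
        push_cast at this
        rw [add_sub_cancel_right] at this
        exact_mod_cast this
      · intro hz' _ j hj
        simp only [Function.update_self, hyk, h.k_eq] at hz'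
        have := ite_one_zero_eq_zero.1 hz'
        push_cast at this
        rw [add_sub_cancel_right] at this
        have h0 : ¬ 0 < k := by exact_mod_cast this
        omega
    · have := mainMeasure_le n w k (Function.update
        (Function.update y.var Var.k (y.var Var.k - 1)) Var.r
        (if 0 < Function.update y.var Var.k (y.var Var.k - 1) Var.k then 1 else 0) Var.r)
      simp only at this ⊢
      omega
  · refine Triple.skip ⟨k + 1, ?_, ?_⟩
    · refine ⟨⟨?_, ?_, hmem ▸ h.input.points⟩, hmem ▸ h.bits, hmem ▸ h.table, hmem ▸ h.stack,
        ?_, ?_, h.le, h.popping, h.finished, fun hne => absurd hzero hne, ?_⟩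
      · rw [hyn, h.input.n_eq]
      · rw [hyd, h.input.delta_eq]
      · rw [hyw, h.w_eq]
      · rw [hyk, h.k_eq]
      · intro _ _ j hj
        obtain rfl : j = k := by omega
        rw [hyr, ite_one_zero_eq_zero] at hzero
        exact hg.frechetDist_gt hz hΔ haw hw hzero
    · rw [hm0, mainMeasure, if_pos hzero]
      omega

theorem pushProg_spec (hΔ : 0 < Δ) (hs : n * d + 3 * n + n * (N * N) ≤ s)
    (h : IsMainState P N (netVec z) Δ w k S x) (hw : w < n) (hr : x.var Var.r = 0) :
    Triple s (pushProg d) x (pushProg d).size fun y =>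
      ∃ k' S', IsMainState P N (netVec z) Δ (w + 1) k' S' y ∧
        mainMeasure n (w + 1) k' (y.var Var.r) < mainMeasure n w k (x.var Var.r) := by
  have hpop := h.popping hw
  have hk := hpop.le_apply (j := k) le_rfl
  have htop := hpop.top_lt
  refine Triple.seq_size (Triple.loadAt (n * d + 2 * n + k) ?_ (by omega) ?_)
  · rw [h.input.n_eq, h.k_eq]
    push_cast
    ring
  refine Triple.seq_size (Triple.assign ?_)
  refine Triple.seq_size (Triple.loadVec (i := S k) h.input.points (fun _ _ h => by simpa using h)
    (by omega) (by omega) ?_ ?_ ?_)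
  · intro v hv
    exact hv _ (by simp)
  · simp [h.stack k le_rfl]
  intro v₁ hv₁ hpa
  simp only at hv₁
  refine Triple.seq_size (Triple.loadVec (i := w) h.input.points (fun _ _ h => by simpa using h)
    hw (by omega) ?_ ?_ ?_)
  · intro v hv
    exact hv _ (by simp)
  · simp only
    rw [hv₁ _ (by simp), Function.update_of_ne (by simp), Function.update_of_ne (by simp), h.w_eq]
  intro v₂ hv₂ hpw
  simp only at hv₂
  have hold : ∀ b, b ≠ Var.a → (∀ e, b ≠ Var.pa e) → (∀ e, b ≠ Var.pw e) → v₂ b = x.var b := by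
    intro b b1 b2 b3
    rw [hv₂ b b3, hv₁ b b2, Function.update_of_ne b1, Function.update_of_ne b1]
  have h2n : v₂ Var.n = n := (hold _ (by simp) (by simp) (by simp)).trans h.input.n_eq
  have h2d : v₂ Var.delta = Δ := (hold _ (by simp) (by simp) (by simp)).trans h.input.delta_eq
  have h2w : v₂ Var.w = w := (hold _ (by simp) (by simp) (by simp)).trans h.w_eq
  have h2k : v₂ Var.k = k := (hold _ (by simp) (by simp) (by simp)).trans h.k_eq
  have hpa₂ : vec d Var.pa v₂ = P.point (S k) := by
    rw [← hpa]
    exact vec_congr fun e => hv₂ _ (by simp)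
  have hsq : ∀ y : EuclideanSpace ℝ (Fin d),
      ‖y‖ ^ 2 < (((1 / 3 : ℚ) : ℝ) * Δ) ^ 2 ↔ ‖y‖ < Δ / 3 := by
    intro y
    rw [show ((1 / 3 : ℚ) : ℝ) * Δ = Δ / 3 by push_cast; ring]
    exact sq_lt_sq₀ (norm_nonneg _) (by positivity)
  have hm0 : mainMeasure n w k (x.var Var.r) = 4 * (n - w) + 2 * k := by
    rw [mainMeasure, if_pos hr, add_zero]
  have finish : ∀ (k' : ℕ) (S' : ℕ → ℕ) (y : Store Var), HasInput n P.point Δ y →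
      HasLowBits (n * d) n y.mem → HasTable (n * d + 3 * n) N (netVec z) P.point Δ n y.mem →
      HasStack (n * d + 2 * n) k' S' y.mem → y.var Var.w = w → y.var Var.k = k' → k' ≤ k + 1 →
      IsGoodStack P Δ w k' S' →
      Triple s (.seq (assign Var.w (fun v => v Var.w + 1) ((Evaluable.var Var.w).add .one)) setFlag)
        y (Program.seq (assign Var.w (fun v => v Var.w + 1) ((Evaluable.var Var.w).add .one))
          setFlag).size fun y =>
      ∃ k' S', IsMainState P N (netVec z) Δ (w + 1) k' S' y ∧
        mainMeasure n (w + 1) k' (y.var Var.r) < mainMeasure n w k (x.var Var.r) := by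
    intro k' S' y hin hbits htab hstack hyw hyk hkk hgood
    refine Triple.seq_size (Triple.assign (Triple.assign ⟨k', S', ?_, ?_⟩))
    · refine ⟨⟨?_, ?_, hin.points⟩, hbits, htab, hstack, ?_, ?_, hw, fun _ => hgood.isPopping hΔ,
        fun hwn => ?_, fun hne => ?_, fun hzero _ j hj => ?_⟩
      · simp [hin.n_eq]
      · simp [hin.delta_eq]
      · simp [hyw]
      · simp [hyk]
      · rw [show n - 1 = w by omega]
        exact hgood
      · simp only [Function.update_self, ne_eq, reduceCtorEq, not_false_eq_true,
          Function.update_of_ne, hyk] at hne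
        exact_mod_cast ite_one_zero_ne_zero.1 hne
      · simp only [Function.update_self, ne_eq, reduceCtorEq, not_false_eq_true,
          Function.update_of_ne, hyk] at hzero
        have : ¬ 0 < k' := by exact_mod_cast ite_one_zero_eq_zero.1 hzero
        omega
    · refine (mainMeasure_le _ _ _ _).trans_lt ?_
      omega
  refine Triple.seq_size (Triple.cond_size (fun hne => ?_) (fun hzero => ?_))
  · rw [ite_one_zero_ne_zero] at hne
    simp only [hpw, hpa₂, h2d] at hne
    rw [hsq] at hne
    exact Triple.skip (finish k S _ ⟨h2n, h2d, h.input.points⟩ h.bits h.table h.stack h2w h2k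
      (by omega) (hpop.absorb hne))
  · rw [ite_one_zero_eq_zero] at hzero
    simp only [hpw, hpa₂, h2d] at hzero
    rw [hsq, not_lt] at hzero
    refine Triple.seq_size
      (Triple.assign (Triple.storeAt (n * d + 2 * n + (k + 1)) ?_ (by omega) ?_))
    · simp [h2n, h2k]
    refine finish (k + 1) _ _ ⟨?_, ?_, h.input.points.congr fun j hj => ?_⟩ (fun j hj hj' => ?_)
      (fun m hm hm' i hi i' hi' => ?_) (fun j hj => ?_) ?_ ?_ le_rfl
      (hpop.push hΔ hzero (h.fails hr hw))
    · simp [h2n]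
    · simp [h2d]
    · exact Function.update_of_ne (by omega) _ _
    · simp only
      rw [Function.update_of_ne (by omega)]
      exact h.bits j hj hj'
    · simp only
      rw [Function.update_of_ne (by omega)]
      exact h.table m hm hm' i hi i' hi'
    · simp only
      rcases hj.eq_or_lt with rfl | hlt
      · rw [Function.update_self, Function.update_self, Function.update_of_ne (by simp), h2w]
        push_cast
        rfl
      · rw [Function.update_of_ne (by omega), Function.update_of_ne (by omega)]
        exact h.stack j (by omega)
    · simp [h2w]
    · simp [h2k]

/-- Computes the stack after all vertices; its size and address end up in `k` and `out`. -/
noncomputable def mainProg (hN : (Finset.range N).Nonempty) (z : ℕ → Fin d → ℚ) : Program :=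
  .seq (assign Var.w (fun _ => 1) .one)
  (.seq (assign Var.k (fun _ => 0) .zero)
  (.seq (assign Var.r (fun _ => 0) .zero)
  (.seq (storeAt (fun v => v Var.n * d + 2 * v Var.n + v Var.k) (fun _ => 1)
    (evaluable_stackAddr d (.var Var.k)) .one)
  (.seq (loop (fun v => if v Var.w < v Var.n then 1 else 0)
    (evaluable_test (.var Var.w) (.var Var.n)) (mainBody hN z))
  (.seq (assign Var.out (fun v => v Var.n * d + 2 * v Var.n + 0) (evaluable_stackAddr d .zero))
  (assign Var.k (fun v => v Var.k + 1) ((Evaluable.var Var.k).add .one)))))))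

theorem mainProg_spec (hN : (Finset.range N).Nonempty) (hz : IsGoodNet N (netVec z)) (hΔ : 0 < Δ)
    (hs : n * d + 3 * n + n * (N * N) ≤ s) (hL : n ≤ 2 ^ L)
    (hx : HasInput n P.point Δ x) (hb : HasLowBits (n * d) n x.mem)
    (ht : HasTable (n * d + 3 * n) N (netVec z) P.point Δ n x.mem) :
    Triple s (mainProg hN z) x ((mainProg hN z).size * ((L * L + 2) * (4 * n))) fun y =>
      ∃ k S, IsGoodStack P Δ (n - 1) k S ∧ HasStack (n * d + 2 * n) k S y.mem ∧
        y.var Var.k = (k + 1 : ℕ) ∧ y.var Var.out = (n * d + 2 * n : ℕ) := by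
  have hn := P.two_le
  have hK : 1 ≤ (L * L + 2) * (4 * n) := by nlinarith
  refine Triple.seq_mul hK (Triple.assign ?_)
  refine Triple.seq_mul hK (Triple.assign ?_)
  refine Triple.seq_mul hK (Triple.assign ?_)
  refine Triple.seq_mul hK (Triple.storeAt (n * d + 2 * n + 0) ?_ (by omega) ?_)
  · simp [hx.n_eq]
  refine Triple.mul_seq hK ?_
  set E := (evalProg 0 (fun v : Var → ℝ => if v Var.w < v Var.n then (1 : ℝ) else 0)
    (evaluable_test (.var Var.w) (.var Var.n))).size with hE
  set A := (mainBody hN z).size * (L * L + 2) + (E + 1) with hA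
  refine Triple.mono (Triple.loop (fun Φ y => ∃ w k S, IsMainState P N (netVec z) Δ w k S y ∧
    Φ = A * mainMeasure n w k (y.var Var.r)) (A * (4 * (n - 1)))
    (Q := fun y => ∃ k S, IsMainState P N (netVec z) Δ n k S y) ?_ ?_ ?_) ?_ ?_
  · rintro _ y ⟨w, k, S, h, rfl⟩ hne
    have hw := ite_one_zero_ne_zero.1 hne
    rw [h.w_eq, h.input.n_eq, Nat.cast_lt] at hw
    refine ⟨(mainBody hN z).size * (L * L + 2), Triple.mono (Q := fun y' => ∃ w' k' S',
      IsMainState P N (netVec z) Δ w' k' S' y' ∧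
        mainMeasure n w' k' (y'.var Var.r) < mainMeasure n w k (y.var Var.r))
      (Triple.cond_mul (by omega) (fun hr => ?_) fun hr => ?_) le_rfl ?_⟩
    · refine (popProg_spec hN hz hΔ hs hL h hw hr).mono le_rfl ?_
      rintro y' ⟨k', h1, h2⟩
      exact ⟨w, k', S, h1, h2⟩
    · refine (pushProg_spec hΔ hs h hw hr).mono (Nat.le_mul_of_pos_right _ (by omega)) ?_
      rintro y' ⟨k', S', h1, h2⟩
      exact ⟨w + 1, k', S', h1, h2⟩
    · rintro y' ⟨w', k', S', h1, h2⟩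
      refine ⟨_, ⟨w', k', S', h1, rfl⟩, ?_⟩
      rw [add_assoc, ← hA, ← mul_add_one]
      exact Nat.mul_le_mul_left _ h2
  · refine ⟨1, 0, fun _ => 0, ?_, ?_⟩
    · refine ⟨⟨?_, ?_, hx.points.congr fun j hj => ?_⟩, fun j hj hj' => ?_,
        fun m hm hm' i hi i' hi' => ?_, fun j hj => ?_, ?_, ?_, by omega,
        fun _ => (IsGoodStack.start hΔ).isPopping hΔ, fun h => by omega, fun h => ?_,
        fun _ _ j hj => by omega⟩
      · simp [hx.n_eq]
      · simp [hx.delta_eq]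
      · exact Function.update_of_ne (by omega) _ _
      · simp only
        rw [Function.update_of_ne (by omega)]
        exact hb j hj hj'
      · simp only
        rw [Function.update_of_ne (by omega)]
        exact ht m hm hm' i hi i' hi'
      · obtain rfl : j = 0 := by omega
        simp
      · simp
      · simp
      · simp at h
    · simp [mainMeasure]
  · rintro _ y ⟨w, k, S, h, rfl⟩ hzero
    have hw := ite_one_zero_eq_zero.1 hzero
    rw [h.w_eq, h.input.n_eq, Nat.cast_lt] at hw
    have := h.le
    obtain rfl : w = n := by omega
    exact ⟨k, S, h⟩
  · calc _ ≤ A * (4 * (n - 1) + 1) := by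
          rw [mul_add, mul_one]
          omega
      _ ≤ A * (4 * n) := Nat.mul_le_mul_left _ (by omega)
      _ ≤ ((loop (fun v => if v Var.w < v Var.n then 1 else 0)
            (evaluable_test (.var Var.w) (.var Var.n)) (mainBody hN z)).size * (L * L + 2)) *
            (4 * n) := by
          refine Nat.mul_le_mul_right _ ?_
          simp only [RealRAM.loop, Program.size, hA]
          nlinarith
      _ = _ := mul_assoc _ _ _
  · rintro y ⟨k, S, h⟩
    refine Triple.seq_size (Triple.assign (Triple.assign ⟨k, S, h.finished rfl, h.stack, ?_, ?_⟩))
    · simp [h.k_eq]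
    · simp [h.input.n_eq]

end Main

end RealRAM

/-! ### The whole algorithm -/

namespace RealRAM

section Whole

variable {d N : ℕ}

/-- The computation between reading the input registers and setting the output registers. -/
noncomputable def coreProg (hN : (Finset.range N).Nonempty) (z : ℕ → Fin d → ℚ) : Program :=
  .seq (lowBitsProg d) (.seq (tableProg N z) (mainProg hN z))

/-- The whole program. Registers `0` and `1` are used for the input and the output only. -/
noncomputable def goodProg (hN : (Finset.range N).Nonempty) (z : ℕ → Fin d → ℚ) : Program :=
  .seq (.seq (.instr (.copy (varReg Var.n) 0)) (.instr (.copy (varReg Var.delta) 1)))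
  (.seq (coreProg hN z)
  (.seq (.instr (.copy 0 (varReg Var.k))) (.instr (.copy 1 (varReg Var.out)))))

variable {s n L : ℕ} {Δ : ℝ} {z : ℕ → Fin d → ℚ} {P : PolygonalCurve d n} {x : Store Var}

theorem coreProg_spec (hN : (Finset.range N).Nonempty) (hz : IsGoodNet N (netVec z)) (hΔ : 0 < Δ)
    (hs : n * d + 3 * n + n * (N * N) ≤ s) (hL : n ≤ 2 ^ L) (hx : HasInput n P.point Δ x) :
    Triple s (coreProg hN z) x ((coreProg hN z).size * ((L * L + 2) * (4 * n))) fun y =>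
      ∃ k S, IsGoodStack P Δ (n - 1) k S ∧ HasStack (n * d + 2 * n) k S y.mem ∧
        y.var Var.k = (k + 1 : ℕ) ∧ y.var Var.out = (n * d + 2 * n : ℕ) := by
  have hn := P.two_le
  have hLL : L ≤ L * L := Nat.le_mul_self L
  have h1 : n + 1 ≤ (L * L + 2) * (4 * n) := by nlinarith
  have h2 : n * (L + 1) ≤ (L * L + 2) * (4 * n) := by nlinarith
  refine Triple.mono
    (Triple.seq ((lowBitsProg_spec hn (by omega) hx.n_eq hx.points).mono le_rfl ?_))
    (B := (lowBitsProg d).size * (n + 1) + ((tableProg N z).size * (n * (L + 1)) +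
      (mainProg hN z).size * ((L * L + 2) * (4 * n)))) ?_ fun _ => id
  · rintro y ⟨hyn, hyd, hyp, hyb⟩
    refine Triple.seq ((tableProg_spec (L := L) hz hΔ ⟨hyn, hyd.trans hx.delta_eq, hyp⟩ hs hn hL
      hyb).mono le_rfl ?_)
    rintro y ⟨hyi, hyb, hyt⟩
    exact mainProg_spec hN hz hΔ hs hL hyi hyb hyt
  · rw [coreProg, Program.size, Program.size, add_mul (lowBitsProg d).size,
      add_mul (tableProg N z).size]
    exact add_le_add (Nat.mul_le_mul_left _ h1) (Nat.add_le_add_right (Nat.mul_le_mul_left _ h2) _)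

theorem hasPoints_input (P : PolygonalCurve d n) (Δ : ℝ) :
    HasPoints n P.point (input P.vertex Δ).mem := by
  intro i hi e
  have he := e.2
  have hlt : i * d + e < n * d := by
    have : (i + 1) * d ≤ n * d := Nat.mul_le_mul_right d hi
    rw [add_mul, one_mul] at this
    omega
  have hdiv : (i * d + e) / d = i := by
    rw [mul_comm, Nat.mul_add_div (by omega), Nat.div_eq_of_lt he, add_zero]
  have hmod : (i * d + e) % d = e := by
    rw [mul_comm, Nat.mul_add_mod, Nat.mod_eq_of_lt he]
  simp only [input, dif_pos hlt, hdiv, hmod]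
  exact congrArg (· e) (P.point_val ⟨i, hi⟩).symm

theorem goodProg_spec (hN : (Finset.range N).Nonempty) (hz : IsGoodNet N (netVec z)) (hΔ : 0 < Δ)
    (hs : n * d + 3 * n + n * (N * N) ≤ s) (hL : n ≤ 2 ^ L) :
    ∃ (T : ℕ) (final : State) (k : ℕ) (idx : Fin (k + 1) → Fin n),
      Exec s (goodProg hN z) (input P.vertex Δ) T final ∧ Outputs s final idx ∧
        IsGoodSimplification P Δ idx ∧
        T ≤ ((coreProg hN z).size + 1) * ((L * L + 2) * (4 * n)) := by
  have hn := P.two_le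
  set σ₀ : State := input P.vertex Δ with hσ₀
  set σ₁ : State := ⟨Function.update σ₀.reg (varReg Var.n) (σ₀.reg 0), σ₀.mem⟩ with hσ₁
  set σ₂ : State := ⟨Function.update σ₁.reg (varReg Var.delta) (σ₁.reg 1), σ₁.mem⟩ with hσ₂
  have h0 : ∀ b : Var, 0 ≠ varReg b := fun b => by simp [varReg]
  have h1 : ∀ b : Var, 1 ≠ varReg b := fun b => by simp only [varReg]; omega
  have hx : HasInput n P.point Δ (σ₂.toStore Var) := by
    refine ⟨?_, ?_, hasPoints_input P Δ⟩
    · simp [State.toStore, hσ₂, hσ₁, hσ₀, input,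
        Function.update_of_ne (varReg_injective.ne (show Var.n ≠ Var.delta by simp))]
    · simp [State.toStore, hσ₂, hσ₁, hσ₀, input, Function.update_of_ne (h1 _)]
  obtain ⟨T, σ₃, he, hT, k, S, hgood, hstack, hk, hout⟩ :=
    coreProg_spec hN hz hΔ hs hL hx σ₂ rfl
  refine ⟨1 + 1 + (T + (1 + 1)), _, k, fun j => ⟨S j, hgood.apply_lt j⟩,
    .seq (.seq (.instr (.copy _ _ _)) (.instr (.copy _ _ _)))
      (.seq he (.seq (.instr (.copy _ _ _)) (.instr (.copy _ _ _)))),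
    ⟨?_, n * d + 2 * n, ?_, ?_, fun j => ?_⟩, hgood.isGoodSimplification, ?_⟩
  · simp only [ne_eq, zero_ne_one, not_false_eq_true, Function.update_of_ne, Function.update_self]
    exact hk
  · simp only [Function.update_self, Function.update_of_ne (h0 _).symm]
    exact hout
  · have := (hgood.isPopping hΔ).le_apply le_rfl
    have := hgood.apply_lt (Fin.last k)
    simp only [Fin.val_last] at this
    omega
  · exact hstack j (by omega)
  · rw [add_mul, one_mul]
    nlinarith

end Whole

end RealRAM

theorem mainTheorem5 (d : ℕ) :
    ∃ (prog : RealRAM.Program) (C : ℝ),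
      ∀ (n : ℕ) (P : PolygonalCurve d n) (Δ : ℝ), 0 < Δ →
        ∃ (T s : ℕ) (final : RealRAM.State) (k : ℕ) (idx : Fin (k + 1) → Fin n),
          n * d ≤ s ∧
          RealRAM.Exec s prog (RealRAM.input P.vertex Δ) T final ∧
          RealRAM.Outputs s final idx ∧
          IsGoodSimplification P Δ idx ∧
          (T : ℝ) ≤ C * (n * Real.log n ^ 2) ∧
          (s : ℝ) ≤ C * n := by
  obtain ⟨N, z, hN, hz0, hznorm, hznear⟩ :=
    exists_rational_net d (13 / 6) (1 / 6) (by norm_num) (by norm_num)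
  have hz : IsGoodNet N (RealRAM.netVec z) := by
    refine ⟨hN, ?_, fun k => (hznorm k).trans (by norm_num), hznear⟩
    ext i
    simp [RealRAM.netVec, hz0]
  have hNe : (Finset.range N).Nonempty := Finset.nonempty_range_iff.2 hN.ne'
  set A : ℝ := (((RealRAM.coreProg hNe z).size + 1 : ℕ) : ℝ) with hA
  have hlog2 : 0 < Real.log 2 := Real.log_pos one_lt_two
  refine ⟨RealRAM.goodProg hNe z, A * (24 / Real.log 2 ^ 2) + (d + 3 + N * N : ℕ),
    fun n P Δ hΔ => ?_⟩
  have hn := P.two_le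
  have hnR : (2 : ℝ) ≤ n := by exact_mod_cast hn
  obtain ⟨T, final, k, idx, he, hout, hgood, hT⟩ := RealRAM.goodProg_spec (P := P) hNe hz hΔ
    (s := n * d + 3 * n + n * (N * N)) le_rfl (Nat.lt_pow_succ_log_self one_lt_two n).le
  refine ⟨T, _, final, k, idx, by omega, he, hout, hgood, ?_, ?_⟩
  · set L := Nat.log 2 n + 1 with hL
    have hlog : Real.log 2 ≤ Real.log n := Real.log_le_log two_pos hnR
    have h1 : (Nat.log 2 n : ℝ) * Real.log 2 ≤ Real.log n := by
      rw [← Real.log_pow]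
      refine Real.log_le_log (by positivity) ?_
      exact_mod_cast Nat.pow_log_le_self 2 (by omega)
    have h2 : (L : ℝ) ≤ 2 * (Real.log n / Real.log 2) := by
      rw [← mul_div_assoc, le_div_iff₀ hlog2, hL]
      push_cast
      linarith
    have h3 : 1 ≤ Real.log n / Real.log 2 := (one_le_div hlog2).2 hlog
    set q := Real.log n / Real.log 2 with hq
    have h4 : (L : ℝ) * L + 2 ≤ 6 * q ^ 2 := by
      nlinarith [Nat.cast_nonneg (α := ℝ) L]
    calc (T : ℝ) ≤ A * ((L * L + 2) * (4 * n)) := by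
          rw [hA]
          exact_mod_cast hT
      _ ≤ A * (6 * q ^ 2 * (4 * n)) := by gcongr
      _ = A * (24 / Real.log 2 ^ 2) * (n * Real.log n ^ 2) := by
          rw [hq, div_pow]
          ring
      _ ≤ _ := by
          gcongr
          exact le_add_of_nonneg_right (Nat.cast_nonneg _)
  · calc ((n * d + 3 * n + n * (N * N) : ℕ) : ℝ) = (d + 3 + N * N : ℕ) * (n : ℝ) := by
          push_cast
          ring
      _ ≤ _ := by
          gcongr
          exact le_add_of_nonneg_left (by positivity)
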